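/- Conventions. All algebras are unital associative algebras over $\mathbb{C}$, ideals are two-sided unless said otherwise. A differential calculus $\Gamma(A)$ over an algebra $A$ is an $\mathbb{N}$-graded algebra $\Gamma(A)=\bigoplus_n\Gamma^n(A)$ with $\Gamma^0(A)=A$ and a graded derivation $d$ of degree $1$ with $d^2=0$, generated as an algebra by $A$ and the elements $da$, $a\in A$. $\Omega(A)$ is the universal calculus; a differential ideal is a graded $d$-invariant ideal; the differential ideal $J(A)\subset\Omega(A)$ corresponding to $\Gamma(A)$ is the kernel of the canonical map $\Omega(A)\to\Gamma(A)$. For a homomorphism $f$ of algebras, $f_\Omega$ is its extension to the universal calculi. $\Gamma(A)\hat\otimes\Gamma(B)$ is $\Gamma(A)\otimes\Gamma(B)$ with product $(\gamma\hat\otimes\rho)(\omega\hat\otimes\tau)=(-1)^{mn}\gamma\omega\hat\otimes\rho\tau$ ($\rho$ of degree $m$, $\omega$ of degree $n$) and differential $d(\gamma\hat\otimes\rho)=d\gamma\hat\otimes\rho+(-1)^n\gamma\hat\otimes d\rho$ ($\gamma$ of degree $n$), a calculus over $A\otimes B$. A complete covering of an algebra $B$ is a finite family of ideals $(J_i)_{i\in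 I}$ with $\bigcap_iJ_i=0$ such that every family $(b_i)\in\prod_iB/J_i$ whose members $b_i,b_j$ agree in $B/(J_i+J_j)$ for all $i,j$ comes from an element of $B$. Setting. Let $H$ be a Hopf algebra with invertible antipode $S$ and counit $\varepsilon$, and let $\mathcal P$ be a locally trivial quantum principal fibre bundle with structure group $H$ over an algebra $B$ with complete covering $(J_i)_{i\in I}$: $\mathcal P$ is a right $H$-comodule algebra with coaction $\Delta_{\mathcal P}$, and, with $B_i=B/J_i$ and $\pi_i:B\to B_i$ the projection, there are surjective homomorphisms $\chi_i:\mathcal P\to B_i\otimes H$ with $(id\otimes\Delta)\circ\chi_i=(\chi_i\otimes id)\circ\Delta_{\mathcal P}$ such that $(\ker\chi_i)_{i\in I}$ is a complete covering of $\mathcal P$, and an injective homomorphism $\iota:B\to\mathcal P$ with $\chi_i(\iota(a))=\pi_i(a)\otimes1$ and $\iota(B)=\{f:\Delta_{\mathcal P}(f)=f\otimes1\}$. Put $B_{ij}=B_{ji}=B/(J_i+J_j)$ and let $\pi^i_j:B_i\to B_{ij}$ be the projection. The map $(\pi^i_j\otimes id)\circ\chi_i$ induces an isomorphism $\chi^i_{ij}:\mathcal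 P/(\ker\chi_i+\ker\chi_j)\to B_{ij}\otimes H$; put $\phi_{ij}=\chi^i_{ij}\circ(\chi^j_{ij})^{-1}$, and let $\tau_{ji}:H\to B_{ij}$, $\tau_{ji}(h)=(id\otimes\varepsilon)\phi_{ij}(1\otimes h)$, be the transition functions. Let differential calculi $\Gamma(B_i)$, $i\in I$, be given, with corresponding differential ideals $J(B_i)$. Let $R\subset\ker\varepsilon\subset H$ be a right ideal, let $J(H)\subset\Omega(H)$ be the differential ideal generated by $\{\sum S^{-1}(r_2)\,dr_1: r\in R\}$, and let $\Gamma(H)=\Omega(H)/J(H)$. Let $\Gamma(\mathcal P)=\Omega(\mathcal P)/\bigcap_i\ker\bigl(\Omega(\mathcal P)\to\Gamma(B_i)\hat\otimes\Gamma(H)\bigr)$, where the maps are the extensions of the $\chi_i$; let $\chi_{i_\Gamma}:\Gamma(\mathcal P)\to\Gamma(B_i)\hat\otimes\Gamma(H)$ be the induced maps; and let $$\Gamma^i(B_{ij}\otimes H)=(\Gamma(B_i)\hat\otimes\Gamma(H))/\chi_{i_\Gamma}(\ker\chi_{j_\Gamma}),\qquad \Gamma^j(B_{ij}\otimes H)=(\Gamma(B_j)\hat\otimes\Gamma(H))/\chi_{j_\Gamma}(\ker\chi_{i_\Gamma}),$$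 which are differential calculi over $B_{ij}\otimes H$. Proposition. Suppose that $$\sum\tau_{ij}(S(r_1)r_3)\otimes r_2\in B_{ij}\otimes R\qquad\text{for all } r\in R \text{ and all } i,j\in I. \qquad(*)$$ For $i,j\in I$ let $J_m(B_{ij})\subset\Omega(B_{ij})$ be the differential ideal generated by $$(\pi^i_j)_\Omega(J(B_i)),\quad (\pi^j_i)_\Omega(J(B_j)),\quad \Bigl\{\sum\tau_{ji}(r_1)\,d\tau_{ij}(r_2): r\in R\Bigr\},\quad \{(d\tau_{ji}(h))\,a-a\,d\tau_{ji}(h): a\in B_{ij},\ h\in H\},$$ and put $\Gamma_m(B_{ij})=\Omega(B_{ij})/J_m(B_{ij})$. Then, for all $i,j\in I$, $$\Gamma^i(B_{ij}\otimes H)=\Gamma^j(B_{ij}\otimes H)\cong\Gamma_m(B_{ij})\hat\otimes\Gamma(H),$$ where the equality means that the two calculi have the same corresponding differential ideal in $\Omega(B_{ij}\otimes H)$, and $\cong$ is an isomorphism of differential calculi over $B_{ij}\otimes H$ (the identity on $B_{ij}\otimes H$). Moreover, exchanging $i$ and $j$ in the definition gives the same differential ideal $J_m(B_{ij})$. Condition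 $(*)$ holds whenever the calculus $\Gamma(H)$ determined by $R$ is bicovariant. -/

import Mathlib

open scoped TensorProduct DirectSum

noncomputable section

/-! ## Graded vector spaces -/

/-- A family of subspaces, each given by a set of homogeneous generators, together with a linear map
that sends every generator to its own component, is a decomposition. -/
abbrev decompositionOfSpan {M : Type*} [AddCommGroup M] [Module ℂ M] (gr : ℕ → Submodule ℂ M)
    (s : ℕ → Set M) (hs : ∀ n, gr n = Submodule.span ℂ (s n))
    (dec : M →ₗ[ℂ] ⨁ n, gr n)
    (hdec : ∀ n x (hx : x ∈ gr n), x ∈ s n → dec x = DirectSum.lof ℂ ℕ (fun n => gr n) n ⟨x, hx⟩)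
    (htop : Submodule.span ℂ (⋃ n, s n) = ⊤) : DirectSum.Decomposition gr :=
  DirectSum.Decomposition.ofLinearMap gr dec
    (by
      refine LinearMap.ext_on_range (v := fun x : (⋃ n, s n : Set M) => (x : M))
        (by rw [Subtype.range_coe]; exact htop) ?_
      rintro ⟨x, hx⟩
      obtain ⟨n, hn⟩ := Set.mem_iUnion.1 hx
      have hx' : x ∈ gr n := by rw [hs]; exact Submodule.subset_span hn
      simp [hdec n x hx' hn])
    (by
      refine DirectSum.linearMap_ext _ fun n => ?_
      ext1 ⟨x, hx⟩
      have key : ∀ y (hy : y ∈ Submodule.span ℂ (s n)),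
          dec y = DirectSum.lof ℂ ℕ (fun n => gr n) n ⟨y, (hs n).symm ▸ hy⟩ := by
        intro y hy
        induction hy using Submodule.span_induction with
        | mem y h => exact hdec n y _ h
        | zero => rw [map_zero]; exact (map_zero _).symm
        | add y z _ _ h1 h2 => rw [map_add, h1, h2, ← map_add]; rfl
        | smul c y _ h => rw [map_smul, h, ← map_smul]; rfl
      simpa using key x (hs n ▸ hx))

/-! ## Differential calculi -/

universe u v w

/-- A differential calculus over a complex unital algebra `A`: an `ℕ`-graded algebra
`Γ = ⨁ₙ Γⁿ` with `Γ⁰ = A` (through the embedding `ι`), with a graded derivation `d` of degree `1`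
with `d² = 0`, which is generated as an algebra by `A` and the elements `d a`, `a ∈ A`. -/
structure DiffCalculus (A : Type u) [Ring A] [Algebra ℂ A] where
  Carrier : Type v
  [ring : Ring Carrier]
  [algebra : Algebra ℂ Carrier]
  gr : ℕ → Submodule ℂ Carrier
  [graded : GradedAlgebra gr]
  d : Carrier →ₗ[ℂ] Carrier
  d_mem : ∀ n, ∀ x ∈ gr n, d x ∈ gr (n + 1)
  d_d : ∀ x, d (d x) = 0
  leibniz : ∀ n, ∀ x ∈ gr n, ∀ y, d (x * y) = d x * y + (-1 : ℂ) ^ n • (x * d y)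
  ι : A →ₐ[ℂ] Carrier
  ι_injective : Function.Injective ι
  gr_zero : gr 0 = LinearMap.range ι.toLinearMap
  generated : Algebra.adjoin ℂ (Set.range ι ∪ Set.range fun a => d (ι a)) = ⊤

attribute [instance] DiffCalculus.ring DiffCalculus.algebra DiffCalculus.graded

namespace DiffCalculus

variable {A : Type*} [Ring A] [Algebra ℂ A] (Γ : DiffCalculus A)

lemma ι_mem (a : A) : Γ.ι a ∈ Γ.gr 0 := by
  rw [Γ.gr_zero]; exact ⟨a, rfl⟩

lemma dι_mem (a : A) : Γ.d (Γ.ι a) ∈ Γ.gr 1 := Γ.d_mem 0 _ (Γ.ι_mem a)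

lemma leibniz_zero (a : A) (y : Γ.Carrier) :
    Γ.d (Γ.ι a * y) = Γ.d (Γ.ι a) * y + Γ.ι a * Γ.d y := by
  simpa using Γ.leibniz 0 _ (Γ.ι_mem a) y

/-- The homogeneous component of degree `n`. -/
def proj (n : ℕ) : Γ.Carrier →ₗ[ℂ] Γ.Carrier := GradedAlgebra.proj Γ.gr n

lemma proj_of_mem {n : ℕ} {x : Γ.Carrier} (hx : x ∈ Γ.gr n) (m : ℕ) :
    Γ.proj m x = if n = m then x else 0 := by
  unfold proj
  rw [GradedAlgebra.proj_apply]
  split_ifs with h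
  · subst h; exact DirectSum.decompose_of_mem_same _ hx
  · exact DirectSum.decompose_of_mem_ne _ hx h

lemma proj_mem (n : ℕ) (x : Γ.Carrier) : Γ.proj n x ∈ Γ.gr n := by
  unfold proj
  rw [GradedAlgebra.proj_apply]
  exact SetLike.coe_mem _

lemma gr_induction {p : Γ.Carrier → Prop} (h0 : p 0) (h1 : ∀ n, ∀ x ∈ Γ.gr n, p x)
    (h2 : ∀ x y, p x → p y → p (x + y)) (x : Γ.Carrier) : p x :=
  DirectSum.Decomposition.inductionOn Γ.gr h0 (fun m => h1 _ _ m.2) h2 x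

lemma hom_ext_gr {M : Type*} [AddCommGroup M] [Module ℂ M] {f g : Γ.Carrier →ₗ[ℂ] M}
    (h : ∀ n, ∀ x ∈ Γ.gr n, f x = g x) : f = g := by
  ext x
  exact Γ.gr_induction (p := fun x => f x = g x) (by simp) h
    (fun x y hx hy => by rw [map_add, map_add, hx, hy]) x

/-- The grading involution `x ↦ (-1)ⁿ x` for `x` of degree `n`. -/
def sgn : Γ.Carrier →ₗ[ℂ] Γ.Carrier :=
  DirectSum.toModule ℂ ℕ Γ.Carrier (fun n => (-1 : ℂ) ^ n • (Γ.gr n).subtype) ∘ₗ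
    (DirectSum.decomposeLinearEquiv Γ.gr).toLinearMap

lemma sgn_of_mem {n : ℕ} {x : Γ.Carrier} (hx : x ∈ Γ.gr n) : Γ.sgn x = (-1 : ℂ) ^ n • x := by
  unfold sgn
  simp only [LinearMap.comp_apply, LinearEquiv.coe_coe, DirectSum.decomposeLinearEquiv_apply]
  rw [DirectSum.decompose_of_mem _ hx, ← DirectSum.lof_eq_of ℂ, DirectSum.toModule_lof]
  simp

lemma leibniz_sgn (x y : Γ.Carrier) : Γ.d (x * y) = Γ.d x * y + Γ.sgn x * Γ.d y := by
  refine Γ.gr_induction (p := fun x => Γ.d (x * y) = Γ.d x * y + Γ.sgn x * Γ.d y)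
    (by simp) ?_ ?_ x
  · intro n x hx
    rw [Γ.leibniz n x hx, Γ.sgn_of_mem hx, smul_mul_assoc]
  · intro x z hx hz
    rw [add_mul, map_add, map_add, map_add, hx, hz]; noncomm_ring

end DiffCalculus

/-- Homomorphisms of differential algebras: algebra homomorphisms of degree `0` that commute with
the differentials. -/
structure DiffHom {A A' : Type*} [Ring A] [Algebra ℂ A] [Ring A'] [Algebra ℂ A']
    (Γ : DiffCalculus A) (Γ' : DiffCalculus A') where
  toAlgHom : Γ.Carrier →ₐ[ℂ] Γ'.Carrier
  map_d : ∀ x, toAlgHom (Γ.d x) = Γ'.d (toAlgHom x)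
  map_gr : ∀ n, ∀ x ∈ Γ.gr n, toAlgHom x ∈ Γ'.gr n

/-- A differential ideal: a `d`-invariant graded two-sided ideal. -/
structure DiffIdeal {A : Type*} [Ring A] [Algebra ℂ A] (Γ : DiffCalculus A) where
  toIdeal : Ideal Γ.Carrier
  [isTwoSided : toIdeal.IsTwoSided]
  d_mem : ∀ x ∈ toIdeal, Γ.d x ∈ toIdeal
  proj_mem : ∀ x ∈ toIdeal, ∀ n, Γ.proj n x ∈ toIdeal

attribute [instance] DiffIdeal.isTwoSided

section DiffIdeal

variable {A A' : Type*} [Ring A] [Algebra ℂ A] [Ring A'] [Algebra ℂ A']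
  {Γ : DiffCalculus A} {Γ' : DiffCalculus A'}

lemma DiffHom.map_proj (F : DiffHom Γ Γ') (n : ℕ) (x : Γ.Carrier) :
    F.toAlgHom (Γ.proj n x) = Γ'.proj n (F.toAlgHom x) := by
  have : F.toAlgHom.toLinearMap ∘ₗ Γ.proj n = Γ'.proj n ∘ₗ F.toAlgHom.toLinearMap := by
    refine Γ.hom_ext_gr fun m x hx => ?_
    simp only [LinearMap.comp_apply, AlgHom.toLinearMap_apply]
    rw [Γ.proj_of_mem hx, Γ'.proj_of_mem (F.map_gr m x hx)]
    split_ifs <;> simp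
  exact LinearMap.congr_fun this x

/-- The kernel of a homomorphism of differential algebras. -/
def DiffHom.ker (F : DiffHom Γ Γ') : DiffIdeal Γ where
  toIdeal := RingHom.ker F.toAlgHom
  isTwoSided := inferInstance
  d_mem x hx := by
    rw [RingHom.mem_ker] at hx ⊢
    rw [F.map_d, hx, map_zero]
  proj_mem x hx n := by
    rw [RingHom.mem_ker] at hx ⊢
    rw [F.map_proj, hx, map_zero]

/-- The image of a differential ideal under a surjective homomorphism. -/
def DiffIdeal.map (F : DiffHom Γ Γ') (hF : Function.Surjective F.toAlgHom) (J : DiffIdeal Γ) :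
    DiffIdeal Γ' where
  toIdeal :=
    { carrier := {y | ∃ x ∈ J.toIdeal, F.toAlgHom x = y}
      add_mem' := by
        rintro _ _ ⟨x, hx, rfl⟩ ⟨y, hy, rfl⟩
        exact ⟨x + y, add_mem hx hy, map_add _ _ _⟩
      zero_mem' := ⟨0, zero_mem _, map_zero _⟩
      smul_mem' := by
        rintro c _ ⟨x, hx, rfl⟩
        obtain ⟨c, rfl⟩ := hF c
        exact ⟨c * x, J.toIdeal.mul_mem_left c hx, map_mul _ _ _⟩ }
  isTwoSided := ⟨by
    rintro _ c ⟨x, hx, rfl⟩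
    obtain ⟨c, rfl⟩ := hF c
    exact ⟨x * c, J.toIdeal.mul_mem_right c hx, map_mul _ _ _⟩⟩
  d_mem := by
    rintro _ ⟨x, hx, rfl⟩
    exact ⟨Γ.d x, J.d_mem x hx, F.map_d x⟩
  proj_mem := by
    rintro _ ⟨x, hx, rfl⟩ n
    exact ⟨Γ.proj n x, J.proj_mem x hx n, F.map_proj n x⟩

lemma DiffIdeal.mem_map {F : DiffHom Γ Γ'} {hF : Function.Surjective F.toAlgHom}
    {J : DiffIdeal Γ} {y : Γ'.Carrier} :
    y ∈ (J.map F hF).toIdeal ↔ ∃ x ∈ J.toIdeal, F.toAlgHom x = y := Iff.rfl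

/-- The intersection of a family of differential ideals. -/
def DiffIdeal.iInf {I : Type*} (J : I → DiffIdeal Γ) : DiffIdeal Γ where
  toIdeal := ⨅ i, (J i).toIdeal
  isTwoSided := inferInstance
  d_mem x hx := by
    simp only [Ideal.mem_iInf] at hx ⊢
    exact fun i => (J i).d_mem x (hx i)
  proj_mem x hx n := by
    simp only [Ideal.mem_iInf] at hx ⊢
    exact fun i => (J i).proj_mem x (hx i) n

lemma DiffIdeal.mem_iInf {I : Type*} {J : I → DiffIdeal Γ} {x : Γ.Carrier} :
    x ∈ (DiffIdeal.iInf J).toIdeal ↔ ∀ i, x ∈ (J i).toIdeal := Ideal.mem_iInf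

/-- The differential ideal generated by a set: the smallest differential ideal containing it. -/
def DiffIdeal.generate (Γ : DiffCalculus A) (S : Set Γ.Carrier) : DiffIdeal Γ :=
  DiffIdeal.iInf (I := {J : DiffIdeal Γ // S ⊆ J.toIdeal}) fun J => J.1

lemma proj_zero_mul (x y : Γ.Carrier) : Γ.proj 0 (x * y) = Γ.proj 0 x * Γ.proj 0 y :=
  map_mul (GradedRing.projZeroRingHom Γ.gr) x y

/-- The differential ideal of all elements of positive degree. -/
def DiffIdeal.positive (Γ : DiffCalculus A) : DiffIdeal Γ where
  toIdeal :=
    { carrier := {x | Γ.proj 0 x = 0}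
      add_mem' := by
        intro x y hx hy
        simp only [Set.mem_ofPred_eq] at hx hy ⊢
        rw [map_add, hx, hy, add_zero]
      zero_mem' := map_zero _
      smul_mem' := by
        intro c x hx
        simp only [Set.mem_ofPred_eq] at hx ⊢
        rw [smul_eq_mul, proj_zero_mul, hx, mul_zero] }
  isTwoSided := ⟨by
    intro x c hx
    change Γ.proj 0 (x * c) = 0
    rw [proj_zero_mul, show Γ.proj 0 x = 0 from hx, zero_mul]⟩
  d_mem x _ := by
    change Γ.proj 0 (Γ.d x) = 0
    have : Γ.proj 0 ∘ₗ Γ.d = 0 := by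
      refine Γ.hom_ext_gr fun n x hx => ?_
      simp [Γ.proj_of_mem (Γ.d_mem n x hx)]
    exact LinearMap.congr_fun this x
  proj_mem x hx n := by
    change Γ.proj 0 (Γ.proj n x) = 0
    rw [Γ.proj_of_mem (Γ.proj_mem n x)]
    split_ifs with h
    · subst h; exact hx
    · rfl

lemma DiffIdeal.ι_mem_generate {S : Set Γ.Carrier} (hS : ∀ x ∈ S, Γ.proj 0 x = 0) {a : A} :
    Γ.ι a ∈ (DiffIdeal.generate Γ S).toIdeal ↔ a = 0 := by
  constructor
  · intro h
    have := DiffIdeal.mem_iInf.1 h ⟨DiffIdeal.positive Γ, hS⟩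
    have h2 : Γ.proj 0 (Γ.ι a) = 0 := this
    rw [Γ.proj_of_mem (Γ.ι_mem a), if_pos rfl] at h2
    exact Γ.ι_injective (by rw [h2, map_zero])
  · rintro rfl
    rw [map_zero]; exact zero_mem _

end DiffIdeal

/-! ## Factor calculi -/

section Quot

/-- Factorization of an algebra homomorphism through a surjective one. -/
def surjLift {A A' C : Type*} [Ring A] [Algebra ℂ A] [Ring A'] [Algebra ℂ A'] [Ring C]
    [Algebra ℂ C] (f : A →ₐ[ℂ] A') (hf : Function.Surjective f) (g : A →ₐ[ℂ] C)
    (h : ∀ a, f a = 0 → g a = 0) : A' →ₐ[ℂ] C :=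
  (Ideal.Quotient.liftₐ (RingHom.ker f) g fun a ha => h a ha).comp
    (Ideal.quotientKerAlgEquivOfSurjective hf).symm.toAlgHom

lemma surjLift_apply {A A' C : Type*} [Ring A] [Algebra ℂ A] [Ring A'] [Algebra ℂ A'] [Ring C]
    [Algebra ℂ C] (f : A →ₐ[ℂ] A') (hf : Function.Surjective f) (g : A →ₐ[ℂ] C)
    (h : ∀ a, f a = 0 → g a = 0) (a : A) : surjLift f hf g h (f a) = g a := by
  have : (Ideal.quotientKerAlgEquivOfSurjective hf).symm (f a) =
      Ideal.Quotient.mk (RingHom.ker f) a := by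
    rw [AlgEquiv.symm_apply_eq]
    rfl
  exact congrArg (Ideal.Quotient.liftₐ (RingHom.ker f) g fun a ha => h a ha) this

/-- Linear maps on the quotient of an algebra by an ideal. -/
def quotLinLift {C M : Type*} [Ring C] [Algebra ℂ C] [AddCommMonoid M] [Module ℂ M]
    (I : Ideal C) [I.IsTwoSided] (f : C →ₗ[ℂ] M) (h : ∀ x ∈ I, f x = 0) : (C ⧸ I) →ₗ[ℂ] M where
  toFun := QuotientAddGroup.lift I.toAddSubgroup f.toAddMonoidHom h
  map_add' := map_add _
  map_smul' := by
    rintro c ⟨x⟩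
    exact f.map_smul c x

lemma quotLinLift_mk {C M : Type*} [Ring C] [Algebra ℂ C] [AddCommMonoid M] [Module ℂ M]
    (I : Ideal C) [I.IsTwoSided] (f : C →ₗ[ℂ] M) (h : ∀ x ∈ I, f x = 0) (x : C) :
    quotLinLift I f h (Ideal.Quotient.mkₐ ℂ I x) = f x := rfl

variable {A A' : Type*} [Ring A] [Algebra ℂ A] [Ring A'] [Algebra ℂ A']
  (Γ : DiffCalculus A) (J : DiffIdeal Γ)

/-- The grading of `Γ/J`. -/
def quotGr (n : ℕ) : Submodule ℂ (Γ.Carrier ⧸ J.toIdeal) :=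
  (Γ.gr n).map (Ideal.Quotient.mkₐ ℂ J.toIdeal).toLinearMap

instance quotGr_gradedMonoid : SetLike.GradedMonoid (quotGr Γ J) where
  one_mem := ⟨1, SetLike.one_mem_graded _, map_one (Ideal.Quotient.mkₐ ℂ J.toIdeal)⟩
  mul_mem := by
    rintro i j _ _ ⟨x, hx, rfl⟩ ⟨y, hy, rfl⟩
    exact ⟨x * y, SetLike.mul_mem_graded hx hy, map_mul (Ideal.Quotient.mkₐ ℂ J.toIdeal) x y⟩

/-- The decomposition of the class of `x` into homogeneous components. -/
def quotPreDec : Γ.Carrier →ₗ[ℂ] ⨁ n, quotGr Γ J n :=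
  DirectSum.toModule ℂ ℕ _ (fun n => DirectSum.lof ℂ ℕ (fun n => quotGr Γ J n) n ∘ₗ
    LinearMap.restrict (p := Γ.gr n) (q := quotGr Γ J n)
      (Ideal.Quotient.mkₐ ℂ J.toIdeal).toLinearMap fun x hx => ⟨x, hx, rfl⟩) ∘ₗ
      (DirectSum.decomposeLinearEquiv Γ.gr).toLinearMap

lemma quotPreDec_of_mem {n : ℕ} {x : Γ.Carrier} (hx : x ∈ Γ.gr n) :
    quotPreDec Γ J x = DirectSum.lof ℂ ℕ (fun n => quotGr Γ J n) n
      ⟨Ideal.Quotient.mkₐ ℂ J.toIdeal x, x, hx, rfl⟩ := by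
  unfold quotPreDec
  simp only [LinearMap.comp_apply, LinearEquiv.coe_coe, DirectSum.decomposeLinearEquiv_apply]
  rw [DirectSum.decompose_of_mem _ hx, ← DirectSum.lof_eq_of ℂ, DirectSum.toModule_lof]
  rfl

lemma quotPreDec_apply (n : ℕ) (x : Γ.Carrier) :
    (quotPreDec Γ J x n : Γ.Carrier ⧸ J.toIdeal) =
      Ideal.Quotient.mkₐ ℂ J.toIdeal (Γ.proj n x) := by
  have : (quotGr Γ J n).subtype ∘ₗ DirectSum.component ℂ ℕ (fun n => quotGr Γ J n) n ∘ₗ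
      quotPreDec Γ J = (Ideal.Quotient.mkₐ ℂ J.toIdeal).toLinearMap ∘ₗ Γ.proj n := by
    refine Γ.hom_ext_gr fun m x hx => ?_
    simp only [LinearMap.comp_apply]
    rw [quotPreDec_of_mem Γ J hx, Γ.proj_of_mem hx]
    split_ifs with h
    · subst h
      rw [DirectSum.component.lof_self]; rfl
    · rw [DirectSum.component.of, dif_neg h]
      simp
  exact LinearMap.congr_fun this x

lemma quotPreDec_eq_zero (x : Γ.Carrier) (hx : x ∈ J.toIdeal) : quotPreDec Γ J x = 0 := by
  refine DFinsupp.ext (β := fun n => quotGr Γ J n) fun n => ?_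
  apply Subtype.ext
  refine (quotPreDec_apply Γ J n x).trans ?_
  exact (Ideal.Quotient.eq_zero_iff_mem).2 (J.proj_mem x hx n)

/-- The decomposition of `Γ/J` into homogeneous components. -/
def quotDec : (Γ.Carrier ⧸ J.toIdeal) →ₗ[ℂ] ⨁ n, quotGr Γ J n :=
  quotLinLift J.toIdeal (quotPreDec Γ J) (quotPreDec_eq_zero Γ J)

instance quotGr_decomposition : DirectSum.Decomposition (quotGr Γ J) :=
  decompositionOfSpan (quotGr Γ J) (fun n => (quotGr Γ J n : Set _)) (fun n => by simp)
    (quotDec Γ J)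
    (by
      rintro n _ hx ⟨x, hx', rfl⟩
      exact quotPreDec_of_mem Γ J hx')
    (by
      rw [eq_top_iff]
      rintro x -
      obtain ⟨x, rfl⟩ := Ideal.Quotient.mkₐ_surjective ℂ J.toIdeal x
      refine Γ.gr_induction (p := fun x => Ideal.Quotient.mkₐ ℂ J.toIdeal x ∈ _) (by simp) ?_ ?_ x
      · intro n x hx
        exact Submodule.subset_span (Set.mem_iUnion.2 ⟨n, x, hx, rfl⟩)
      · intro x y hx hy
        rw [map_add]; exact add_mem hx hy)

instance quotGr_gradedAlgebra : GradedAlgebra (quotGr Γ J) where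

/-- The embedding of `A'` into `Γ/J`. -/
def quotι (f : A →ₐ[ℂ] A') (hf : Function.Surjective f)
    (hJ : ∀ a, Γ.ι a ∈ J.toIdeal ↔ f a = 0) : A' →ₐ[ℂ] Γ.Carrier ⧸ J.toIdeal :=
  surjLift f hf ((Ideal.Quotient.mkₐ ℂ J.toIdeal).comp Γ.ι) fun a ha =>
    Ideal.Quotient.eq_zero_iff_mem.2 ((hJ a).2 ha)

lemma quotι_apply (f : A →ₐ[ℂ] A') (hf : Function.Surjective f)
    (hJ : ∀ a, Γ.ι a ∈ J.toIdeal ↔ f a = 0) (a : A) :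
    quotι Γ J f hf hJ (f a) = Ideal.Quotient.mkₐ ℂ J.toIdeal (Γ.ι a) :=
  surjLift_apply _ _ _ _ a

/-- The factor calculus `Γ/J`, as a differential calculus over the image `A'` of a surjective
homomorphism `f : A → A'` whose kernel is the degree zero component of `J`. -/
def DiffCalculus.quot (f : A →ₐ[ℂ] A') (hf : Function.Surjective f)
    (hJ : ∀ a, Γ.ι a ∈ J.toIdeal ↔ f a = 0) : DiffCalculus A' where
  Carrier := Γ.Carrier ⧸ J.toIdeal
  gr := quotGr Γ J
  d := quotLinLift J.toIdeal ((Ideal.Quotient.mkₐ ℂ J.toIdeal).toLinearMap ∘ₗ Γ.d)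
    fun x hx => Ideal.Quotient.eq_zero_iff_mem.2 (J.d_mem x hx)
  d_mem := by
    rintro n _ ⟨x, hx, rfl⟩
    exact ⟨Γ.d x, Γ.d_mem n x hx, rfl⟩
  d_d := by
    intro x
    obtain ⟨x, rfl⟩ := Ideal.Quotient.mkₐ_surjective ℂ J.toIdeal x
    change Ideal.Quotient.mkₐ ℂ J.toIdeal (Γ.d (Γ.d x)) = 0
    rw [Γ.d_d, map_zero]
  leibniz := by
    rintro n _ ⟨x, hx, rfl⟩ y
    obtain ⟨y, rfl⟩ := Ideal.Quotient.mkₐ_surjective ℂ J.toIdeal y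
    change Ideal.Quotient.mkₐ ℂ J.toIdeal (Γ.d (x * y)) = _
    rw [Γ.leibniz n x hx y, map_add, map_smul, map_mul, map_mul]
    rfl
  ι := quotι Γ J f hf hJ
  ι_injective := by
    rw [injective_iff_map_eq_zero]
    intro a ha
    obtain ⟨a, rfl⟩ := hf a
    rw [quotι_apply] at ha
    exact (hJ a).1 (Ideal.Quotient.eq_zero_iff_mem.1 ha)
  gr_zero := by
    ext x
    constructor
    · rintro ⟨x, hx, rfl⟩
      rw [SetLike.mem_coe, Γ.gr_zero] at hx
      obtain ⟨a, rfl⟩ := hx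
      exact ⟨f a, quotι_apply Γ J f hf hJ a⟩
    · rintro ⟨a, rfl⟩
      obtain ⟨a, rfl⟩ := hf a
      exact ⟨Γ.ι a, Γ.ι_mem a, (quotι_apply Γ J f hf hJ a).symm⟩
  generated := by
    have h := congrArg (Subalgebra.map (Ideal.Quotient.mkₐ ℂ J.toIdeal)) Γ.generated
    rw [AlgHom.map_adjoin, Algebra.map_top,
      (AlgHom.range_eq_top _).2 (Ideal.Quotient.mkₐ_surjective ℂ J.toIdeal)] at h
    rw [eq_top_iff, ← h]
    apply Algebra.adjoin_mono
    rintro _ ⟨x, ⟨a, rfl⟩ | ⟨a, rfl⟩, rfl⟩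
    · exact Or.inl ⟨f a, quotι_apply Γ J f hf hJ a⟩
    · refine Or.inr ⟨f a, ?_⟩
      simp only
      rw [quotι_apply]
      rfl

/-- The canonical projection `Γ → Γ/J`. -/
def DiffCalculus.quotMk (f : A →ₐ[ℂ] A') (hf : Function.Surjective f)
    (hJ : ∀ a, Γ.ι a ∈ J.toIdeal ↔ f a = 0) : DiffHom Γ (Γ.quot J f hf hJ) where
  toAlgHom := Ideal.Quotient.mkₐ ℂ J.toIdeal
  map_d _ := rfl
  map_gr _ x hx := ⟨x, hx, rfl⟩

end Quot

/-! ## The universal differential calculus -/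

section Omega

variable (A : Type u) [Ring A] [Algebra ℂ A]

/-- The relations of the universal differential calculus in the free algebra on linear symbols
`a = (a, 0)` and `da = (0, a)`: the unit and the product of `A`, and the Leibniz rule. -/
inductive OmegaRel : TensorAlgebra ℂ (A × A) → TensorAlgebra ℂ (A × A) → Prop
  | one : OmegaRel (TensorAlgebra.ι ℂ (1, 0)) 1
  | mul (a b : A) : OmegaRel (TensorAlgebra.ι ℂ (a * b, 0))
      (TensorAlgebra.ι ℂ (a, 0) * TensorAlgebra.ι ℂ (b, 0))
  | leibniz (a b : A) : OmegaRel (TensorAlgebra.ι ℂ (0, a * b))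
      (TensorAlgebra.ι ℂ (0, a) * TensorAlgebra.ι ℂ (b, 0) +
        TensorAlgebra.ι ℂ (a, 0) * TensorAlgebra.ι ℂ (0, b))

/-- The underlying algebra of the universal differential calculus: generated by `A` and symbols
`da`, linear in `a`, with `d(ab) = (da) b + a (db)`. -/
def OmegaAlg : Type u := RingQuot (OmegaRel A)

instance : Ring (OmegaAlg A) := inferInstanceAs (Ring (RingQuot (OmegaRel A)))
instance : Algebra ℂ (OmegaAlg A) := inferInstanceAs (Algebra ℂ (RingQuot (OmegaRel A)))

namespace OmegaAlg

def mk : TensorAlgebra ℂ (A × A) →ₐ[ℂ] OmegaAlg A := RingQuot.mkAlgHom ℂ (OmegaRel A)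

variable {A} in
lemma mk_rel {x y : TensorAlgebra ℂ (A × A)} (h : OmegaRel A x y) : mk A x = mk A y :=
  RingQuot.mkAlgHom_rel ℂ h

/-- The embedding of `A`. -/
def of : A →ₐ[ℂ] OmegaAlg A :=
  AlgHom.ofLinearMap ((mk A).toLinearMap ∘ₗ TensorAlgebra.ι ℂ ∘ₗ LinearMap.inl ℂ A A)
    ((mk_rel OmegaRel.one).trans (map_one _))
    (fun a b => (mk_rel (OmegaRel.mul a b)).trans (map_mul _ _ _))

/-- The differential `a ↦ da` in degree zero. -/
def del : A →ₗ[ℂ] OmegaAlg A :=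
  (mk A).toLinearMap ∘ₗ TensorAlgebra.ι ℂ ∘ₗ LinearMap.inr ℂ A A

variable {A}

lemma del_mul (a b : A) : del A (a * b) = del A a * of A b + of A a * del A b :=
  (mk_rel (OmegaRel.leibniz a b)).trans ((map_add _ _ _).trans
    (congrArg₂ _ (map_mul _ _ _) (map_mul _ _ _)))

section lift

variable {C : Type*} [Semiring C] [Algebra ℂ C] (f : A →ₐ[ℂ] C) (D : A →ₗ[ℂ] C)
  (h : ∀ a b, D (a * b) = D a * f b + f a * D b)

/-- The universal property: an algebra homomorphism `f : A → C` and an `f`-derivation `D : A → C`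
extend to a homomorphism with `a ↦ f a` and `da ↦ D a`. -/
def lift : OmegaAlg A →ₐ[ℂ] C :=
  RingQuot.liftAlgHom ℂ ⟨TensorAlgebra.lift ℂ (LinearMap.coprod f.toLinearMap D), by
    rintro _ _ (_ | ⟨a, b⟩ | ⟨a, b⟩)
    · simp
    · simp
    · simp [h]⟩

lemma lift_of (a : A) : lift f D h (of A a) = f a := by
  change RingQuot.liftAlgHom ℂ _ (RingQuot.mkAlgHom ℂ (OmegaRel A) (TensorAlgebra.ι ℂ (a, 0))) = _
  rw [RingQuot.liftAlgHom_mkAlgHom_apply]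
  simp

lemma lift_del (a : A) : lift f D h (del A a) = D a := by
  change RingQuot.liftAlgHom ℂ _ (RingQuot.mkAlgHom ℂ (OmegaRel A) (TensorAlgebra.ι ℂ (0, a))) = _
  rw [RingQuot.liftAlgHom_mkAlgHom_apply]
  simp

end lift

lemma hom_ext {C : Type*} [Ring C] [Algebra ℂ C] {f g : OmegaAlg A →ₐ[ℂ] C}
    (h0 : ∀ a, f (of A a) = g (of A a)) (h1 : ∀ a, f (del A a) = g (del A a)) : f = g := by
  refine RingQuot.ringQuot_ext' ℂ f g ?_
  refine TensorAlgebra.hom_ext (LinearMap.ext fun x => ?_)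
  have hx : (TensorAlgebra.ι ℂ x : TensorAlgebra ℂ (A × A)) =
      TensorAlgebra.ι ℂ (x.1, 0) + TensorAlgebra.ι ℂ (0, x.2) := by
    rw [← map_add]; simp
  simp only [LinearMap.comp_apply, AlgHom.toLinearMap_apply, hx, map_add]
  exact congrArg₂ _ (h0 x.1) (h1 x.2)

lemma adjoin_eq_top :
    Algebra.adjoin ℂ (Set.range (of A) ∪ Set.range (del A)) = ⊤ := by
  set S := Algebra.adjoin ℂ (Set.range (of A) ∪ Set.range (del A)) with hS
  have m0 : ∀ a, of A a ∈ S := fun a => Algebra.subset_adjoin (Or.inl ⟨a, rfl⟩)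
  have m1 : ∀ a, del A a ∈ S := fun a => Algebra.subset_adjoin (Or.inr ⟨a, rfl⟩)
  let F : OmegaAlg A →ₐ[ℂ] S := lift ((of A).codRestrict S m0)
    ((del A).codRestrict (Subalgebra.toSubmodule S) m1)
    (fun a b => Subtype.ext (del_mul a b))
  have hF : S.val.comp F = AlgHom.id ℂ _ := by
    refine hom_ext (fun a => ?_) (fun a => ?_)
    · simp only [F, AlgHom.comp_apply, lift_of]; rfl
    · simp only [F, AlgHom.comp_apply, lift_del]; rfl
  rw [eq_top_iff]
  rintro x -
  have := DFunLike.congr_fun hF x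
  rw [AlgHom.id_apply] at this
  rw [← this]
  exact (F x).2

/-- The sign automorphism `a ↦ a`, `da ↦ -da`. -/
def sign : OmegaAlg A →ₐ[ℂ] OmegaAlg A :=
  lift (of A) (-del A) fun a b => by
    simp only [LinearMap.neg_apply, del_mul]; noncomm_ring

/-- The homomorphism `x ↦ (sign x, dx; 0, x)`, which encodes the graded Leibniz rule. -/
def dMatrix : OmegaAlg A →ₐ[ℂ] Matrix (Fin 2) (Fin 2) (OmegaAlg A) :=
  lift
    (AlgHom.ofLinearMap
      { toFun := fun a => !![of A a, del A a; 0, of A a]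
        map_add' := fun a b => by simp
        map_smul' := fun a b => by simp }
      (by
        have h : del A (1 : A) = 0 := by
          have := del_mul (1 : A) 1
          simpa using this
        simp [h, Matrix.one_fin_two])
      (fun a b => by
        simp [del_mul,
          add_comm]))
    { toFun := fun a => !![-del A a, 0; 0, del A a]
      map_add' := fun a b => by simp [add_comm]
      map_smul' := fun a b => by simp }
    (fun a b => by
      simp [del_mul,
        add_comm])

lemma dMatrix_of (a : A) : dMatrix (of A a) = !![of A a, del A a; 0, of A a] := lift_of _ _ _ a

lemma dMatrix_del (a : A) : dMatrix (del A a) = !![-del A a, 0; 0, del A a] := lift_del _ _ _ a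

/-- The differential. -/
def d : OmegaAlg A →ₗ[ℂ] OmegaAlg A where
  toFun x := dMatrix x 0 1
  map_add' x y := by simp
  map_smul' c x := by simp

lemma d_of (a : A) : d (of A a) = del A a := by
  change dMatrix (of A a) 0 1 = _
  rw [dMatrix_of]; simp

lemma d_del (a : A) : d (del A a) = 0 := by
  change dMatrix (del A a) 0 1 = _
  rw [dMatrix_del]; simp

lemma induction {p : OmegaAlg A → Prop} (h0 : ∀ a, p (of A a)) (h1 : ∀ a, p (del A a))
    (hadd : ∀ x y, p x → p y → p (x + y)) (hmul : ∀ x y, p x → p y → p (x * y))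
    (x : OmegaAlg A) : p x := by
  have hx : x ∈ Algebra.adjoin ℂ (Set.range (of A) ∪ Set.range (del A)) := by
    rw [adjoin_eq_top]; trivial
  induction hx using Algebra.adjoin_induction with
  | mem x hx =>
    rcases hx with ⟨a, rfl⟩ | ⟨a, rfl⟩
    · exact h0 a
    · exact h1 a
  | algebraMap r =>
    have := h0 (algebraMap ℂ A r)
    rwa [AlgHom.commutes] at this
  | add x y _ _ hx hy => exact hadd x y hx hy
  | mul x y _ _ hx hy => exact hmul x y hx hy

lemma dMatrix_eq (x : OmegaAlg A) : dMatrix x = !![sign x, d x; 0, x] := by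
  refine induction (p := fun x => dMatrix x = !![sign x, d x; 0, x]) ?_ ?_ ?_ ?_ x
  · intro a; rw [dMatrix_of, d_of, sign, lift_of]
  · intro a; rw [dMatrix_del, d_del, sign, lift_del]; simp
  · intro x y hx hy
    rw [map_add, hx, hy, map_add, map_add]
    simp
  · intro x y hx hy
    have h : dMatrix (x * y) = !![sign x * sign y, sign x * d y + d x * y; 0, x * y] := by
      rw [map_mul, hx, hy]
      simp
    have h' : d (x * y) = sign x * d y + d x * y := by
      change dMatrix (x * y) 0 1 = _
      rw [h]; simp
    rw [h, h', map_mul]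

lemma d_mul (x y : OmegaAlg A) : d (x * y) = d x * y + sign x * d y := by
  change dMatrix (x * y) 0 1 = _
  rw [map_mul, dMatrix_eq, dMatrix_eq]
  simp [Matrix.mul_apply, Fin.sum_univ_two, add_comm]

lemma d_sign (x : OmegaAlg A) : d (sign x) = -sign (d x) := by
  refine induction (p := fun x => d (sign x) = -sign (d x)) ?_ ?_ ?_ ?_ x
  · intro a
    simp only [sign, lift_of, d_of, lift_del]; simp
  · intro a
    simp only [sign, lift_del, d_del]; simp [d_del]
  · intro x y hx hy
    rw [map_add, map_add, hx, hy, map_add, map_add, neg_add]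
  · intro x y hx hy
    rw [map_mul, d_mul, d_mul, hx, hy, map_add, map_mul, map_mul]
    noncomm_ring

lemma d_d (x : OmegaAlg A) : d (d x) = 0 := by
  refine induction (p := fun x => d (d x) = 0) ?_ ?_ ?_ ?_ x
  · intro a; rw [d_of, d_del]
  · intro a; rw [d_del, map_zero]
  · intro x y hx hy; rw [map_add, map_add, hx, hy, add_zero]
  · intro x y hx hy
    rw [d_mul, map_add, d_mul, d_mul, hx, hy, d_sign]
    noncomm_ring

variable (A) in
/-- The component of degree `n`, spanned by the elements `a₀ da₁ ⋯ daₙ` (defined recursively by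
`Ωⁿ⁺¹ = Ωⁿ dA`, `Ω⁰ = A`). -/
def gr : ℕ → Submodule ℂ (OmegaAlg A)
  | 0 => LinearMap.range (of A).toLinearMap
  | n + 1 => gr n * LinearMap.range (del A)

lemma gr_mul_of (n : ℕ) {x : OmegaAlg A} (hx : x ∈ gr A n) (a : A) : x * of A a ∈ gr A n := by
  induction n generalizing x a with
  | zero =>
    obtain ⟨b, rfl⟩ := hx
    exact ⟨b * a, map_mul (of A) _ _⟩
  | succ n ih =>
    refine Submodule.mul_induction_on (C := fun x => x * of A a ∈ gr A (n + 1)) hx ?_ ?_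
    · rintro y hy _ ⟨b, rfl⟩
      have h : y * del A b * of A a = y * del A (b * a) - y * of A b * del A a := by
        rw [del_mul]; noncomm_ring
      rw [h]
      exact sub_mem (Submodule.mul_mem_mul hy ⟨_, rfl⟩)
        (Submodule.mul_mem_mul (ih hy b) ⟨_, rfl⟩)
    · intro y z hy hz
      rw [add_mul]; exact add_mem hy hz

instance gr_gradedMonoid : SetLike.GradedMonoid (gr A) where
  one_mem := ⟨1, map_one (of A)⟩
  mul_mem := by
    intro i j x y hx hy
    induction j generalizing y with
    | zero =>
      obtain ⟨a, rfl⟩ := hy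
      exact gr_mul_of i hx a
    | succ j ih =>
      refine Submodule.mul_induction_on (C := fun y => x * y ∈ gr A (i + (j + 1))) hy ?_ ?_
      · rintro y hy b hb
        rw [← mul_assoc]
        exact Submodule.mul_mem_mul (ih hy) hb
      · intro y z hy hz
        rw [mul_add]; exact add_mem hy hz

lemma del_mem (a : A) : del A a ∈ gr A 1 := by
  have := Submodule.mul_mem_mul (M := gr A 0) (N := LinearMap.range (del A))
    (SetLike.one_mem_graded (gr A)) ⟨a, rfl⟩
  rwa [one_mul] at this

/-- The embedding of `A` as the component of degree zero. -/
def decOf : A →ₐ[ℂ] ⨁ n, gr A n :=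
  AlgHom.ofLinearMap (DirectSum.lof ℂ ℕ (fun n => gr A n) 0 ∘ₗ
        (of A).toLinearMap.codRestrict (gr A 0) fun a => ⟨a, rfl⟩)
      (by
        refine congrArg (DirectSum.of (fun n => gr A n) 0) ?_
        exact Subtype.ext (map_one (of A)))
      (fun a b => by
        refine Eq.trans ?_ (DirectSum.of_mul_of (A := fun n => gr A n) (i := 0) (j := 0) _ _).symm
        exact DirectSum.of_eq_of_gradedMonoid_eq (Sigma.subtype_ext rfl (map_mul (of A) a b)))

/-- The differential of degree zero elements, as homogeneous elements of degree one. -/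
def decDel : A →ₗ[ℂ] ⨁ n, gr A n :=
  DirectSum.lof ℂ ℕ (fun n => gr A n) 1 ∘ₗ (del A).codRestrict (gr A 1) del_mem

lemma decDel_mul (a b : A) : decDel (a * b) = decDel a * decOf b + decOf a * decDel b := by
  have h1 : del A a * of A b ∈ gr A 1 :=
    SetLike.mul_mem_graded (A := gr A) (i := 1) (j := 0) (del_mem a) ⟨b, rfl⟩
  have h2 : of A a * del A b ∈ gr A 1 := by
    have := SetLike.mul_mem_graded (A := gr A) (i := 0) (j := 1) ⟨a, rfl⟩ (del_mem b)
    rwa [zero_add] at this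
  have e1 : decDel a * decOf b = DirectSum.of (fun n => gr A n) 1 ⟨_, h1⟩ :=
    DirectSum.of_mul_of (A := fun n => gr A n) (i := 1) (j := 0) ⟨_, del_mem a⟩ ⟨_, b, rfl⟩
  have e2 : decOf a * decDel b = DirectSum.of (fun n => gr A n) 1 ⟨_, h2⟩ :=
    (DirectSum.of_mul_of (A := fun n => gr A n) (i := 0) (j := 1) ⟨_, a, rfl⟩
      ⟨_, del_mem b⟩).trans
      (DirectSum.of_eq_of_gradedMonoid_eq (Sigma.subtype_ext (zero_add 1) rfl))
  rw [e1, e2, ← map_add]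
  exact congrArg (DirectSum.of (fun n => gr A n) 1) (Subtype.ext (del_mul a b))

/-- The decomposition into homogeneous components. -/
def dec : OmegaAlg A →ₐ[ℂ] ⨁ n, gr A n := lift decOf decDel decDel_mul

lemma dec_of (a : A) :
    dec (of A a) = DirectSum.of (fun n => gr A n) 0 ⟨of A a, a, rfl⟩ :=
  lift_of decOf decDel decDel_mul a

lemma dec_del (a : A) :
    dec (del A a) = DirectSum.of (fun n => gr A n) 1 ⟨del A a, del_mem a⟩ :=
  lift_del decOf decDel decDel_mul a

instance gr_gradedAlgebra : GradedAlgebra (gr A) :=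
  GradedAlgebra.ofAlgHom (gr A) dec
    (by
      refine hom_ext (fun a => ?_) (fun a => ?_)
      · rw [AlgHom.comp_apply, dec_of]; simp
      · rw [AlgHom.comp_apply, dec_del]; simp)
    (by
      rintro n ⟨x, hx⟩
      change dec x = _
      induction n generalizing x with
      | zero =>
        obtain ⟨a, rfl⟩ := id hx
        exact dec_of a
      | succ n ih =>
        have key : ∀ x (hx : x ∈ gr A n * LinearMap.range (del A)),
            dec x = DirectSum.of (fun n => gr A n) (n + 1) ⟨x, hx⟩ := by
          intro x hx
          induction hx using Submodule.mul_induction_on' with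
          | mem_mul_mem y hy z hz =>
            obtain ⟨b, rfl⟩ := id hz
            rw [map_mul, ih y hy, dec_del, DirectSum.of_mul_of]
            rfl
          | add y hy z hz h1 h2 => rw [map_add, h1, h2, ← map_add]; rfl
        exact key x hx)

lemma d_mem (n : ℕ) (x : OmegaAlg A) (hx : x ∈ gr A n) : d x ∈ gr A (n + 1) := by
  induction n generalizing x with
  | zero =>
    obtain ⟨a, rfl⟩ := hx
    change d (of A a) ∈ _
    rw [d_of]; exact del_mem a
  | succ n ih =>
    refine Submodule.mul_induction_on (C := fun x => d x ∈ gr A (n + 1 + 1)) hx ?_ ?_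
    · rintro y hy _ ⟨b, rfl⟩
      rw [d_mul, d_del, mul_zero, add_zero]
      exact Submodule.mul_mem_mul (ih y hy) ⟨b, rfl⟩
    · intro y z hy hz
      rw [map_add]; exact add_mem hy hz

lemma sign_of_mem (n : ℕ) (x : OmegaAlg A) (hx : x ∈ gr A n) : sign x = (-1 : ℂ) ^ n • x := by
  induction n generalizing x with
  | zero =>
    obtain ⟨a, rfl⟩ := hx
    change sign (of A a) = (-1 : ℂ) ^ 0 • of A a
    rw [sign, lift_of]; simp
  | succ n ih =>
    refine Submodule.mul_induction_on (C := fun x => sign x = (-1 : ℂ) ^ (n + 1) • x) hx ?_ ?_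
    · rintro y hy _ ⟨b, rfl⟩
      rw [map_mul, ih y hy]
      simp only [sign, lift_del]
      simp [pow_succ]
    · intro y z hy hz
      rw [map_add, hy, hz, smul_add]

lemma of_injective : Function.Injective (of A) := by
  have h : ∀ a, lift (AlgHom.id ℂ A) 0 (by simp) (of A a) = a := fun a => lift_of _ _ _ a
  exact Function.LeftInverse.injective h

end OmegaAlg

/-- The universal differential calculus `Ω(A)`. -/
def Omega : DiffCalculus A where
  Carrier := OmegaAlg A
  gr := OmegaAlg.gr A
  d := OmegaAlg.d
  d_mem := OmegaAlg.d_mem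
  d_d := OmegaAlg.d_d
  leibniz n x hx y := by
    rw [OmegaAlg.d_mul, OmegaAlg.sign_of_mem n x hx, smul_mul_assoc]
  ι := OmegaAlg.of A
  ι_injective := OmegaAlg.of_injective
  gr_zero := rfl
  generated := by
    have : (fun a => OmegaAlg.d (OmegaAlg.of A a)) = OmegaAlg.del A := funext OmegaAlg.d_of
    rw [this]
    exact OmegaAlg.adjoin_eq_top

end Omega

section ext

variable {A A' : Type*} [Ring A] [Algebra ℂ A] [Ring A'] [Algebra ℂ A']

namespace OmegaAlg

variable (ψ : A →ₐ[ℂ] A') (Γ : DiffCalculus A')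

/-- The algebra homomorphism underlying the differential extension. -/
def ext : OmegaAlg A →ₐ[ℂ] Γ.Carrier :=
  lift (Γ.ι.comp ψ) (Γ.d ∘ₗ Γ.ι.toLinearMap ∘ₗ ψ.toLinearMap) fun a b => by
    simp only [LinearMap.comp_apply, AlgHom.toLinearMap_apply, AlgHom.comp_apply, map_mul]
    exact Γ.leibniz_zero _ _

lemma ext_of (a : A) : ext ψ Γ (of A a) = Γ.ι (ψ a) := lift_of _ _ _ a

lemma ext_del (a : A) : ext ψ Γ (del A a) = Γ.d (Γ.ι (ψ a)) := lift_del _ _ _ a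

lemma ext_gr (n : ℕ) (x : OmegaAlg A) (hx : x ∈ gr A n) : ext ψ Γ x ∈ Γ.gr n := by
  induction n generalizing x with
  | zero =>
    obtain ⟨a, rfl⟩ := hx
    exact (ext_of ψ Γ a) ▸ Γ.ι_mem _
  | succ n ih =>
    refine Submodule.mul_induction_on (C := fun x => ext ψ Γ x ∈ Γ.gr (n + 1)) hx ?_ ?_
    · rintro y hy _ ⟨b, rfl⟩
      rw [map_mul, ext_del]
      exact SetLike.mul_mem_graded (ih y hy) (Γ.dι_mem _)
    · intro y z hy hz
      rw [map_add]; exact add_mem hy hz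

lemma ext_sign (x : OmegaAlg A) : ext ψ Γ (sign x) = Γ.sgn (ext ψ Γ x) := by
  refine DirectSum.Decomposition.inductionOn (gr A)
    (motive := fun x => ext ψ Γ (sign x) = Γ.sgn (ext ψ Γ x)) (by simp) ?_ ?_ x
  · rintro n ⟨x, hx⟩
    rw [sign_of_mem n x hx, Γ.sgn_of_mem (ext_gr ψ Γ n x hx), map_smul]
  · intro x y hx hy
    rw [map_add, map_add, hx, hy, map_add, map_add]

lemma ext_d (x : OmegaAlg A) : ext ψ Γ (d x) = Γ.d (ext ψ Γ x) := by
  refine induction (p := fun x => ext ψ Γ (d x) = Γ.d (ext ψ Γ x)) ?_ ?_ ?_ ?_ x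
  · intro a; rw [d_of, ext_del, ext_of]
  · intro a; rw [d_del, ext_del, Γ.d_d, map_zero]
  · intro x y hx hy
    rw [map_add, map_add, hx, hy, map_add, map_add]
  · intro x y hx hy
    rw [d_mul, map_mul (ext ψ Γ) x y, Γ.leibniz_sgn, map_add, map_mul, map_mul, ext_sign, hx, hy]

end OmegaAlg

/-- The differential extension `Ω(A) → Γ(A')` of an algebra homomorphism `ψ : A → A'`: the
homomorphism of differential algebras with `a₀ da₁ ⋯ daₙ ↦ ψ(a₀) dψ(a₁) ⋯ dψ(aₙ)`. -/
def Omega.ext (ψ : A →ₐ[ℂ] A') (Γ : DiffCalculus A') : DiffHom (Omega A) Γ where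
  toAlgHom := OmegaAlg.ext ψ Γ
  map_gr := OmegaAlg.ext_gr ψ Γ
  map_d := OmegaAlg.ext_d ψ Γ

lemma Omega.ext_ι (ψ : A →ₐ[ℂ] A') (Γ : DiffCalculus A') (a : A) :
    (Omega.ext ψ Γ).toAlgHom ((Omega A).ι a) = Γ.ι (ψ a) := OmegaAlg.ext_of ψ Γ a

lemma Omega.ext_surjective (ψ : A →ₐ[ℂ] A') (hψ : Function.Surjective ψ) (Γ : DiffCalculus A') :
    Function.Surjective (Omega.ext ψ Γ).toAlgHom := by
  rw [← AlgHom.range_eq_top, eq_top_iff, ← Γ.generated, Algebra.adjoin_le_iff]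
  rintro _ (⟨a, rfl⟩ | ⟨a, rfl⟩)
  · obtain ⟨a, rfl⟩ := hψ a
    exact ⟨(Omega A).ι a, OmegaAlg.ext_of ψ Γ a⟩
  · obtain ⟨a, rfl⟩ := hψ a
    exact ⟨(Omega A).d ((Omega A).ι a), (OmegaAlg.ext_d ψ Γ _).trans (congrArg Γ.d (OmegaAlg.ext_of ψ Γ a))⟩

/-- The differential ideal `J(A) ⊆ Ω(A)` corresponding to a differential calculus over `A`, the
kernel of `Ω(A) → Γ(A)`. -/
def DiffCalculus.ideal (Γ : DiffCalculus A) : DiffIdeal (Omega A) :=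
  (Omega.ext (AlgHom.id ℂ A) Γ).ker

lemma DiffCalculus.proj_zero_of_mem_ideal (Γ : DiffCalculus A) {x : (Omega A).Carrier}
    (hx : x ∈ Γ.ideal.toIdeal) : (Omega A).proj 0 x = 0 := by
  have h : (Omega.ext (AlgHom.id ℂ A) Γ).toAlgHom ((Omega A).proj 0 x) = 0 :=
    Γ.ideal.proj_mem x hx 0
  have h0 := (Omega A).proj_mem 0 x
  rw [(Omega A).gr_zero] at h0
  obtain ⟨a, ha⟩ := h0
  rw [AlgHom.toLinearMap_apply] at ha
  rw [← ha, Omega.ext_ι, AlgHom.id_apply] at h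
  rw [← ha, Γ.ι_injective (h.trans (map_zero _).symm), map_zero]

end ext

/-! ## The skew tensor product of differential calculi -/

section Skew

open GradedTensorProduct

variable {A B : Type*} [Ring A] [Algebra ℂ A] [Ring B] [Algebra ℂ B]
  (Γ : DiffCalculus A) (Δ : DiffCalculus B)

/-- The graded tensor product algebra, with `(γ ⊗ ρ)(ω ⊗ τ) = (-1)^{mn} γω ⊗ ρτ` for `ρ` of degree
`m` and `ω` of degree `n`. -/
abbrev SkewAlg : Type _ := Γ.gr ᵍ⊗[ℂ] Δ.gr

lemma smul_gtmul (c : ℂ) (a : Γ.Carrier) (b : Δ.Carrier) :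
    ((c • a) ᵍ⊗ₜ[ℂ] b : SkewAlg Γ Δ) = c • (a ᵍ⊗ₜ[ℂ] b) := by
  rw [tmul, ← TensorProduct.smul_tmul', map_smul]

lemma zero_gtmul (b : Δ.Carrier) : ((0 : Γ.Carrier) ᵍ⊗ₜ[ℂ] b : SkewAlg Γ Δ) = 0 := by
  rw [tmul, TensorProduct.zero_tmul, map_zero]

lemma gtmul_zero (a : Γ.Carrier) : (a ᵍ⊗ₜ[ℂ] (0 : Δ.Carrier) : SkewAlg Γ Δ) = 0 := by
  rw [tmul, TensorProduct.tmul_zero, map_zero]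

lemma skew_mul {q p : ℕ} (a : Γ.Carrier) {b : Δ.Carrier} (hb : b ∈ Δ.gr q)
    {a' : Γ.Carrier} (ha' : a' ∈ Γ.gr p) (b' : Δ.Carrier) :
    ((a ᵍ⊗ₜ[ℂ] b : SkewAlg Γ Δ) * (a' ᵍ⊗ₜ[ℂ] b')) =
      ((-1 : ℂ) ^ (q * p)) • ((a * a') ᵍ⊗ₜ[ℂ] (b * b')) := by
  have := tmul_coe_mul_coe_tmul (R := ℂ) Γ.gr Δ.gr a ⟨b, hb⟩ ⟨a', ha'⟩ b'
  refine this.trans ?_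
  rcases Nat.even_or_odd (q * p) with h | h
  · simp [h.neg_one_pow]
  · simp [h.neg_one_pow, Units.smul_def]

/-- Homogeneous generators of the skew tensor product. -/
def skewGen (n : ℕ) : Set (SkewAlg Γ Δ) :=
  {x | ∃ p q, p + q = n ∧ ∃ a ∈ Γ.gr p, ∃ b ∈ Δ.gr q, x = a ᵍ⊗ₜ[ℂ] b}

/-- The component of degree `n` of the skew tensor product: the sum of all `Γᵖ ⊗ Δ^q`,
`p + q = n`. -/
def skewGr (n : ℕ) : Submodule ℂ (SkewAlg Γ Δ) := Submodule.span ℂ (skewGen Γ Δ n)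

variable {Γ Δ} in
lemma tmul_mem_skewGr {p q n : ℕ} (h : p + q = n) {a : Γ.Carrier} (ha : a ∈ Γ.gr p)
    {b : Δ.Carrier} (hb : b ∈ Δ.gr q) : (a ᵍ⊗ₜ[ℂ] b : SkewAlg Γ Δ) ∈ skewGr Γ Δ n :=
  Submodule.subset_span ⟨p, q, h, a, ha, b, hb, rfl⟩

instance skewGr_gradedMonoid : SetLike.GradedMonoid (skewGr Γ Δ) where
  one_mem := tmul_mem_skewGr (add_zero 0) (SetLike.one_mem_graded Γ.gr)
    (SetLike.one_mem_graded Δ.gr)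
  mul_mem := by
    intro i j x y hx hy
    have h := Submodule.mul_mem_mul hx hy
    unfold skewGr at h
    rw [Submodule.span_mul_span] at h
    refine Submodule.span_le.2 ?_ h
    rintro _ ⟨_, ⟨p, q, rfl, a, ha, b, hb, rfl⟩, _, ⟨p', q', rfl, a', ha', b', hb', rfl⟩, rfl⟩
    simp only
    rw [skew_mul Γ Δ a hb ha' b']
    exact Submodule.smul_mem _ _ (tmul_mem_skewGr (by omega)
      (SetLike.mul_mem_graded ha ha') (SetLike.mul_mem_graded hb hb'))

/-- The bilinear map `Γᵖ × Δ^q → ⨁ₙ` into the component of degree `p + q`. -/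
def skewDecAux (p q : ℕ) : Γ.gr p →ₗ[ℂ] Δ.gr q →ₗ[ℂ] ⨁ n, skewGr Γ Δ n :=
  LinearMap.mk₂ ℂ
    (fun a b => DirectSum.lof ℂ ℕ (fun n => skewGr Γ Δ n) (p + q)
      ⟨(a : Γ.Carrier) ᵍ⊗ₜ[ℂ] (b : Δ.Carrier), tmul_mem_skewGr rfl a.2 b.2⟩)
    (fun a a' b => by
      rw [← map_add]
      exact congrArg _ (Subtype.ext (by simp [tmul, TensorProduct.add_tmul])))
    (fun c a b => by
      rw [← map_smul]
      exact congrArg _ (Subtype.ext (smul_gtmul Γ Δ c _ _)))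
    (fun a b b' => by
      rw [← map_add]
      exact congrArg _ (Subtype.ext (by simp [tmul, TensorProduct.tmul_add])))
    (fun c a b => by
      rw [← map_smul]
      exact congrArg _ (Subtype.ext (by simp [tmul, TensorProduct.tmul_smul])))

/-- The decomposition of the skew tensor product into homogeneous components. -/
def skewDec : SkewAlg Γ Δ →ₗ[ℂ] ⨁ n, skewGr Γ Δ n :=
  TensorProduct.lift
    (DirectSum.toModule ℂ ℕ _ (fun p => LinearMap.flip
      (DirectSum.toModule ℂ ℕ _ (fun q => (skewDecAux Γ Δ p q).flip) ∘ₗ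
        (DirectSum.decomposeLinearEquiv Δ.gr).toLinearMap)) ∘ₗ
      (DirectSum.decomposeLinearEquiv Γ.gr).toLinearMap) ∘ₗ
  ((GradedTensorProduct.of ℂ Γ.gr Δ.gr).symm : SkewAlg Γ Δ →ₗ[ℂ] Γ.Carrier ⊗[ℂ] Δ.Carrier)

lemma skewDec_tmul {p q : ℕ} {a : Γ.Carrier} (ha : a ∈ Γ.gr p) {b : Δ.Carrier} (hb : b ∈ Δ.gr q) :
    skewDec Γ Δ (a ᵍ⊗ₜ[ℂ] b) = DirectSum.lof ℂ ℕ (fun n => skewGr Γ Δ n) (p + q)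
      ⟨a ᵍ⊗ₜ[ℂ] b, tmul_mem_skewGr rfl ha hb⟩ := by
  unfold skewDec
  simp only [LinearMap.comp_apply, LinearEquiv.coe_coe, of_symm_of, TensorProduct.lift.tmul,
    DirectSum.decomposeLinearEquiv_apply]
  rw [DirectSum.decompose_of_mem _ ha, ← DirectSum.lof_eq_of ℂ, DirectSum.toModule_lof,
    LinearMap.flip_apply]
  simp only [LinearMap.comp_apply, LinearEquiv.coe_coe, DirectSum.decomposeLinearEquiv_apply]
  rw [DirectSum.decompose_of_mem _ hb, ← DirectSum.lof_eq_of ℂ, DirectSum.toModule_lof]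
  rfl

lemma skew_induction {p : SkewAlg Γ Δ → Prop} (h0 : p 0) (hadd : ∀ x y, p x → p y → p (x + y))
    (h : ∀ m n, ∀ a ∈ Γ.gr m, ∀ b ∈ Δ.gr n, p (a ᵍ⊗ₜ[ℂ] b)) (x : SkewAlg Γ Δ) : p x := by
  obtain ⟨x, rfl⟩ := (GradedTensorProduct.of ℂ Γ.gr Δ.gr).surjective x
  induction x using TensorProduct.induction_on with
  | zero => rw [map_zero]; exact h0
  | add x y hx hy => rw [map_add]; exact hadd _ _ hx hy
  | tmul a b =>
    refine Γ.gr_induction (p := fun a => p (GradedTensorProduct.of ℂ Γ.gr Δ.gr (a ⊗ₜ b)))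
      (by rw [TensorProduct.zero_tmul, map_zero]; exact h0) ?_
      (fun x y hx hy => by rw [TensorProduct.add_tmul, map_add]; exact hadd _ _ hx hy) a
    intro m a ha
    refine Δ.gr_induction (p := fun b => p (GradedTensorProduct.of ℂ Γ.gr Δ.gr (a ⊗ₜ b)))
      (by rw [TensorProduct.tmul_zero, map_zero]; exact h0) ?_
      (fun x y hx hy => by rw [TensorProduct.tmul_add, map_add]; exact hadd _ _ hx hy) b
    intro n b hb
    exact h m n a ha b hb

instance skewGr_decomposition : DirectSum.Decomposition (skewGr Γ Δ) :=
  decompositionOfSpan (skewGr Γ Δ) (skewGen Γ Δ) (fun _ => rfl) (skewDec Γ Δ)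
    (by
      rintro n _ hx ⟨p, q, rfl, a, ha, b, hb, rfl⟩
      exact skewDec_tmul Γ Δ ha hb)
    (by
      rw [eq_top_iff]
      rintro x -
      refine skew_induction Γ Δ (p := fun x => x ∈ _) (zero_mem _)
        (fun x y hx hy => add_mem hx hy) ?_ x
      intro m n a ha b hb
      exact Submodule.subset_span (Set.mem_iUnion.2 ⟨m + n, m, n, rfl, a, ha, b, hb, rfl⟩))

instance skewGr_gradedAlgebra : GradedAlgebra (skewGr Γ Δ) where

/-- The differential `d(γ ⊗ ρ) = dγ ⊗ ρ + (-1)ⁿ γ ⊗ dρ` for `γ` of degree `n`. -/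
def skewD : SkewAlg Γ Δ →ₗ[ℂ] SkewAlg Γ Δ :=
  (GradedTensorProduct.of ℂ Γ.gr Δ.gr).toLinearMap ∘ₗ
    (TensorProduct.map Γ.d LinearMap.id + TensorProduct.map Γ.sgn Δ.d) ∘ₗ
      ((GradedTensorProduct.of ℂ Γ.gr Δ.gr).symm : SkewAlg Γ Δ →ₗ[ℂ] Γ.Carrier ⊗[ℂ] Δ.Carrier)

lemma skewD_tmul {p : ℕ} {a : Γ.Carrier} (ha : a ∈ Γ.gr p) (b : Δ.Carrier) :
    skewD Γ Δ (a ᵍ⊗ₜ[ℂ] b) = Γ.d a ᵍ⊗ₜ[ℂ] b + (-1 : ℂ) ^ p • (a ᵍ⊗ₜ[ℂ] Δ.d b) := by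
  rw [← smul_gtmul, ← Γ.sgn_of_mem ha]
  simp [skewD]

/-- The embedding of `A ⊗ B` as the component of degree zero. -/
def skewι : A ⊗[ℂ] B →ₐ[ℂ] SkewAlg Γ Δ :=
  Algebra.TensorProduct.lift ((includeLeft Γ.gr Δ.gr).comp Γ.ι) ((includeRight Γ.gr Δ.gr).comp Δ.ι)
    (fun a b => by
      change (Γ.ι a ᵍ⊗ₜ[ℂ] 1 : SkewAlg Γ Δ) * (1 ᵍ⊗ₜ[ℂ] Δ.ι b) =
        (1 ᵍ⊗ₜ[ℂ] Δ.ι b) * (Γ.ι a ᵍ⊗ₜ[ℂ] 1)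
      rw [tmul_one_mul_one_tmul, skew_mul Γ Δ 1 (Δ.ι_mem b) (Γ.ι_mem a) 1]
      simp)

lemma skewι_tmul (a : A) (b : B) :
    skewι Γ Δ (a ⊗ₜ b) = (Γ.ι a ᵍ⊗ₜ[ℂ] Δ.ι b : SkewAlg Γ Δ) := by
  refine (Algebra.TensorProduct.lift_tmul _ _ _ a b).trans ?_
  exact tmul_one_mul_one_tmul Γ.gr Δ.gr (Γ.ι a) (Δ.ι b)

lemma skewι_eq (x : A ⊗[ℂ] B) : skewι Γ Δ x =
    GradedTensorProduct.of ℂ Γ.gr Δ.gr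
      (TensorProduct.map Γ.ι.toLinearMap Δ.ι.toLinearMap x) := by
  induction x using TensorProduct.induction_on with
  | zero => simp
  | add x y hx hy => rw [map_add, map_add, map_add, hx, hy]
  | tmul a b => exact skewι_tmul Γ Δ a b

/-- The skew tensor product `Γ ⊗̂ Δ`, a differential calculus over `A ⊗ B`. -/
def skew : DiffCalculus (A ⊗[ℂ] B) where
  Carrier := SkewAlg Γ Δ
  gr := skewGr Γ Δ
  d := skewD Γ Δ
  d_mem := by
    intro n x hx
    refine (Submodule.span_le (p := (skewGr Γ Δ (n + 1)).comap (skewD Γ Δ))).2 ?_ hx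
    rintro _ ⟨p, q, rfl, a, ha, b, hb, rfl⟩
    rw [SetLike.mem_coe, Submodule.mem_comap, skewD_tmul Γ Δ ha]
    exact add_mem (tmul_mem_skewGr (by omega) (Γ.d_mem p a ha) hb)
      (Submodule.smul_mem _ _ (tmul_mem_skewGr (by omega) ha (Δ.d_mem q b hb)))
  d_d := by
    intro x
    refine skew_induction Γ Δ (p := fun x => skewD Γ Δ (skewD Γ Δ x) = 0) (by simp)
      (fun x y hx hy => by rw [map_add, map_add, hx, hy, add_zero]) ?_ x
    intro m n a ha b hb
    rw [skewD_tmul Γ Δ ha, map_add, map_smul, skewD_tmul Γ Δ (Γ.d_mem m a ha), skewD_tmul Γ Δ ha,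
      Γ.d_d, Δ.d_d, zero_gtmul, gtmul_zero, pow_succ]
    module
  leibniz := by
    intro n x hx y
    refine (Submodule.span_le (p := LinearMap.eqLocus
      (skewD Γ Δ ∘ₗ (LinearMap.mul ℂ (SkewAlg Γ Δ)).flip y)
      ((LinearMap.mul ℂ (SkewAlg Γ Δ)).flip y ∘ₗ skewD Γ Δ +
        (-1 : ℂ) ^ n • (LinearMap.mul ℂ (SkewAlg Γ Δ)).flip (skewD Γ Δ y)))).2 ?_ hx
    rintro _ ⟨p, q, rfl, a, ha, b, hb, rfl⟩
    simp only [SetLike.mem_coe, LinearMap.mem_eqLocus, LinearMap.comp_apply, LinearMap.flip_apply,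
      LinearMap.mul_apply', LinearMap.add_apply, LinearMap.smul_apply]
    refine skew_induction Γ Δ (p := fun y => skewD Γ Δ ((a ᵍ⊗ₜ[ℂ] b) * y) =
      skewD Γ Δ (a ᵍ⊗ₜ[ℂ] b) * y + (-1 : ℂ) ^ (p + q) • ((a ᵍ⊗ₜ[ℂ] b) * skewD Γ Δ y))
      (by simp) (fun x y hx hy => by
        rw [mul_add, map_add, hx, hy, map_add, mul_add, mul_add, smul_add]; abel) ?_ y
    intro p' q' a' ha' b' hb'
    rw [skew_mul Γ Δ a hb ha' b', map_smul, skewD_tmul Γ Δ (SetLike.mul_mem_graded ha ha'),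
      skewD_tmul Γ Δ ha, skewD_tmul Γ Δ ha', add_mul, mul_add, smul_mul_assoc, mul_smul_comm,
      skew_mul Γ Δ _ hb ha' b', skew_mul Γ Δ _ (Δ.d_mem q b hb) ha' b',
      skew_mul Γ Δ _ hb (Γ.d_mem p' a' ha') b', skew_mul Γ Δ _ hb ha' _,
      Γ.leibniz p a ha, Δ.leibniz q b hb]
    have h1 : ((Γ.d a * a' + (-1 : ℂ) ^ p • (a * Γ.d a')) ᵍ⊗ₜ[ℂ] (b * b') : SkewAlg Γ Δ) =
        (Γ.d a * a') ᵍ⊗ₜ[ℂ] (b * b') + (-1 : ℂ) ^ p • ((a * Γ.d a') ᵍ⊗ₜ[ℂ] (b * b')) := by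
      rw [← smul_gtmul, ← map_add, ← TensorProduct.add_tmul]
    have h2 : ((a * a') ᵍ⊗ₜ[ℂ] (Δ.d b * b' + (-1 : ℂ) ^ q • (b * Δ.d b')) : SkewAlg Γ Δ) =
        (a * a') ᵍ⊗ₜ[ℂ] (Δ.d b * b') + (-1 : ℂ) ^ q • ((a * a') ᵍ⊗ₜ[ℂ] (b * Δ.d b')) := by
      simp [tmul, TensorProduct.tmul_add, TensorProduct.tmul_smul]
    rw [h1, h2]
    have hq : ((-1 : ℂ) ^ q) * ((-1 : ℂ) ^ q) = 1 := by rw [← mul_pow]; simp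
    have e1 : (-1 : ℂ) ^ ((q + 1) * p') = (-1) ^ (q * p') * (-1) ^ p' := by
      rw [← pow_add]; congr 1; ring
    have e2 : (-1 : ℂ) ^ (q * (p' + 1)) = (-1) ^ (q * p') * (-1) ^ q := by
      rw [← pow_add]; congr 1
    rw [e1, e2, pow_add, pow_add]
    simp only [smul_add, smul_smul]
    have e3 : (-1 : ℂ) ^ p * (-1) ^ q * ((-1) ^ (q * p') * (-1) ^ q) =
        (-1) ^ (q * p') * (-1) ^ p := by
      linear_combination ((-1 : ℂ) ^ p * (-1) ^ (q * p')) * hq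
    rw [e3]
    module
  ι := skewι Γ Δ
  ι_injective := by
    have h : Function.Injective (TensorProduct.map Γ.ι.toLinearMap Δ.ι.toLinearMap) := by
      have : TensorProduct.map Γ.ι.toLinearMap Δ.ι.toLinearMap =
          LinearMap.lTensor _ Δ.ι.toLinearMap ∘ₗ LinearMap.rTensor _ Γ.ι.toLinearMap :=
        (LinearMap.lTensor_comp_rTensor _ _ _).symm
      rw [this, LinearMap.coe_comp]
      exact (Module.Flat.lTensor_preserves_injective_linearMap _ Δ.ι_injective).comp
        (Module.Flat.rTensor_preserves_injective_linearMap _ Γ.ι_injective)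
    intro x y hxy
    rw [skewι_eq, skewι_eq] at hxy
    exact h ((GradedTensorProduct.of ℂ Γ.gr Δ.gr).injective hxy)
  gr_zero := by
    apply le_antisymm
    · refine Submodule.span_le.2 ?_
      rintro _ ⟨p, q, hpq, a, ha, b, hb, rfl⟩
      obtain ⟨rfl, rfl⟩ : p = 0 ∧ q = 0 := by omega
      rw [Γ.gr_zero] at ha
      rw [Δ.gr_zero] at hb
      obtain ⟨a, rfl⟩ := ha
      obtain ⟨b, rfl⟩ := hb
      exact ⟨a ⊗ₜ b, skewι_tmul Γ Δ a b⟩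
    · rintro _ ⟨x, rfl⟩
      induction x using TensorProduct.induction_on with
      | zero => rw [map_zero]; exact zero_mem _
      | add x y hx hy => rw [map_add]; exact add_mem hx hy
      | tmul a b =>
        have := tmul_mem_skewGr (add_zero 0) (Γ.ι_mem a) (Δ.ι_mem b)
        rwa [← skewι_tmul] at this
  generated := by
    set S := Algebra.adjoin ℂ (Set.range (skewι Γ Δ) ∪
      Set.range fun a => skewD Γ Δ (skewι Γ Δ a)) with hS
    have hL : ∀ x, includeLeft Γ.gr Δ.gr x ∈ S := by
      intro x
      have hx : x ∈ Algebra.adjoin ℂ (Set.range Γ.ι ∪ Set.range fun a => Γ.d (Γ.ι a)) := by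
        rw [Γ.generated]; trivial
      refine (Algebra.adjoin_le_iff (S := S.comap (includeLeft Γ.gr Δ.gr))).2 ?_ hx
      rintro _ (⟨a, rfl⟩ | ⟨a, rfl⟩)
      · refine Algebra.subset_adjoin (Or.inl ⟨a ⊗ₜ 1, ?_⟩)
        rw [skewι_tmul, map_one]; rfl
      · refine Algebra.subset_adjoin (Or.inr ⟨a ⊗ₜ 1, ?_⟩)
        simp only
        rw [skewι_tmul, map_one, skewD_tmul Γ Δ (Γ.ι_mem a)]
        have : Δ.d 1 = 0 := by
          have := Δ.leibniz_zero 1 1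
          simpa using this
        simp [this, gtmul_zero]
    have hR : ∀ x, includeRight Γ.gr Δ.gr x ∈ S := by
      intro x
      have hx : x ∈ Algebra.adjoin ℂ (Set.range Δ.ι ∪ Set.range fun a => Δ.d (Δ.ι a)) := by
        rw [Δ.generated]; trivial
      refine (Algebra.adjoin_le_iff (S := S.comap (includeRight Γ.gr Δ.gr))).2 ?_ hx
      rintro _ (⟨a, rfl⟩ | ⟨a, rfl⟩)
      · refine Algebra.subset_adjoin (Or.inl ⟨1 ⊗ₜ a, ?_⟩)
        rw [skewι_tmul, map_one]; rfl
      · refine Algebra.subset_adjoin (Or.inr ⟨1 ⊗ₜ a, ?_⟩)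
        simp only
        rw [skewι_tmul, skewD_tmul Γ Δ (Γ.ι_mem 1), map_one]
        have : Γ.d 1 = 0 := by
          have := Γ.leibniz_zero 1 1
          simpa using this
        simp [this, zero_gtmul]
    rw [eq_top_iff]
    rintro x -
    refine skew_induction Γ Δ (p := fun x => x ∈ S) (zero_mem _)
      (fun x y hx hy => add_mem hx hy) ?_ x
    intro m n a _ b _
    rw [← tmul_one_mul_one_tmul]
    exact mul_mem (hL a) (hR b)

end Skew

/-! ## Locally trivial quantum principal fibre bundles -/

section Bundle

open Coalgebra

instance supIsTwoSided {B : Type*} [Ring B] (J K : Ideal B) [J.IsTwoSided] [K.IsTwoSided] :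
    (J ⊔ K).IsTwoSided := ⟨by
  intro a b h
  obtain ⟨x, hx, y, hy, rfl⟩ := Submodule.mem_sup.1 h
  rw [add_mul]
  exact add_mem (Submodule.mem_sup_left (J.mul_mem_right b hx))
    (Submodule.mem_sup_right (K.mul_mem_right b hy))⟩

/-- A complete covering of an algebra: two-sided ideals `Jᵢ` with zero intersection such that every
family `aᵢ ∈ B/Jᵢ` which agrees in all `B/(Jᵢ + Jⱼ)` comes from an element of `B`. -/
structure IsCompleteCovering {I B : Type*} [Ring B] (J : I → Ideal B) [∀ i, (J i).IsTwoSided] :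
    Prop where
  iInf_eq_bot : ⨅ i, J i = ⊥
  exists_glue : ∀ a : (∀ i, B ⧸ J i),
    (∀ i j, Ideal.Quotient.factor (le_sup_left : J i ≤ J i ⊔ J j) (a i) =
      Ideal.Quotient.factor (le_sup_right : J j ≤ J i ⊔ J j) (a j)) →
    ∃ b, ∀ i, Ideal.Quotient.mk (J i) b = a i

/-- A locally trivial quantum principal fibre bundle over the base algebra `B` with the Hopf algebra
`H` as structure group: a right `H`-comodule algebra `P` with coaction `coact`, a complete covering
`J` of `B`, surjective local trivializations `χ i : P → B/Jᵢ ⊗ H`, and an embedding `ι : B → P` onto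
the coinvariants. -/
structure LocTrivQPFB (I : Type*) (B : Type*) (H : Type*) [Ring B] [Algebra ℂ B] [Ring H]
    [HopfAlgebra ℂ H] where
  P : Type*
  [ring : Ring P]
  [algebra : Algebra ℂ P]
  coact : P →ₐ[ℂ] P ⊗[ℂ] H
  coact_coassoc : ∀ f, TensorProduct.assoc ℂ P H H (coact.toLinearMap.rTensor H (coact f)) =
    (comul : H →ₗ[ℂ] H ⊗[ℂ] H).lTensor P (coact f)
  coact_counit : ∀ f,
    TensorProduct.rid ℂ P ((counit : H →ₗ[ℂ] ℂ).lTensor P (coact f)) = f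
  J : I → Ideal B
  [isTwoSided : ∀ i, (J i).IsTwoSided]
  covering : IsCompleteCovering J
  χ : ∀ i, P →ₐ[ℂ] (B ⧸ J i) ⊗[ℂ] H
  χ_surjective : ∀ i, Function.Surjective (χ i)
  ι : B →ₐ[ℂ] P
  ι_injective : Function.Injective ι
  χ_coact : ∀ i f, (comul : H →ₗ[ℂ] H ⊗[ℂ] H).lTensor (B ⧸ J i) (χ i f) =
    TensorProduct.assoc ℂ (B ⧸ J i) H H ((χ i).toLinearMap.rTensor H (coact f))
  χ_ι : ∀ i a, χ i (ι a) = Ideal.Quotient.mk (J i) a ⊗ₜ 1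
  covering_ker : IsCompleteCovering fun i => RingHom.ker (χ i)
  coinvariants : ∀ f, f ∈ Set.range ι ↔ coact f = f ⊗ₜ 1

attribute [instance] LocTrivQPFB.ring LocTrivQPFB.algebra LocTrivQPFB.isTwoSided

namespace LocTrivQPFB

variable {I B H : Type*} [Ring B] [Algebra ℂ B] [Ring H] [HopfAlgebra ℂ H]
  (Q : LocTrivQPFB I B H)

/-- `Bᵢ = B/Jᵢ`. -/
abbrev Bl (i : I) : Type _ := B ⧸ Q.J i

/-- `Bᵢⱼ = B/(Jᵢ + Jⱼ)`. -/
abbrev Bov (i j : I) : Type _ := B ⧸ (Q.J i ⊔ Q.J j)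

section

variable {Q} {i j k l : I}

/-- The canonical projection `B_k → B_ij`, for `J_k + J_l = J_i + J_j`. -/
def res (h : Q.J k ⊔ Q.J l = Q.J i ⊔ Q.J j) : Q.Bl k →ₐ[ℂ] Q.Bov i j :=
  Ideal.Quotient.factorₐ ℂ (h ▸ le_sup_left)

/-- The canonical projection `B_k ⊗ H → B_ij ⊗ H`. -/
def resH (h : Q.J k ⊔ Q.J l = Q.J i ⊔ Q.J j) : Q.Bl k ⊗[ℂ] H →ₐ[ℂ] Q.Bov i j ⊗[ℂ] H :=
  Algebra.TensorProduct.map (res h) (AlgHom.id ℂ H)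

lemma res_surjective (h : Q.J k ⊔ Q.J l = Q.J i ⊔ Q.J j) : Function.Surjective (res h) := by
  intro x
  obtain ⟨b, rfl⟩ := Ideal.Quotient.mk_surjective x
  exact ⟨Ideal.Quotient.mk _ b, rfl⟩

lemma res_mk (h : Q.J k ⊔ Q.J l = Q.J i ⊔ Q.J j) (b : B) :
    res h (Ideal.Quotient.mk _ b) = Ideal.Quotient.mk _ b := rfl

lemma resH_eq (h : Q.J k ⊔ Q.J l = Q.J i ⊔ Q.J j) (x : Q.Bl k ⊗[ℂ] H) :
    resH h x = (res h).toLinearMap.rTensor H x := rfl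

lemma resH_surjective (h : Q.J k ⊔ Q.J l = Q.J i ⊔ Q.J j) : Function.Surjective (resH h) :=
  LinearMap.rTensor_surjective H (res_surjective h)

end

/-- An element of `P ⊗ H` that vanishes in all charts is zero. -/
lemma rTensor_χ_injective (x : Q.P ⊗[ℂ] H)
    (hx : ∀ i, (Q.χ i).toLinearMap.rTensor H x = 0) : x = 0 := by
  classical
  let b := Module.Basis.ofVectorSpace ℂ H
  have key : ∀ {M N : Type _} [AddCommGroup M] [Module ℂ M] [AddCommGroup N] [Module ℂ N]
      (f : M →ₗ[ℂ] N) (y : M ⊗[ℂ] H) (n),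
      TensorProduct.equivFinsuppOfBasisRight b (f.rTensor H y) n =
        f (TensorProduct.equivFinsuppOfBasisRight b y n) := by
    intro M N _ _ _ _ f y n
    induction y using TensorProduct.induction_on with
    | zero => simp
    | add y z hy hz => simp only [map_add, Finsupp.add_apply, hy, hz]
    | tmul m h =>
      rw [LinearMap.rTensor_tmul, TensorProduct.equivFinsuppOfBasisRight_apply_tmul_apply,
        TensorProduct.equivFinsuppOfBasisRight_apply_tmul_apply, map_smul]
  apply (TensorProduct.equivFinsuppOfBasisRight b).injective
  rw [map_zero]
  ext n
  have h0 : TensorProduct.equivFinsuppOfBasisRight b x n ∈ ⨅ i, RingHom.ker (Q.χ i) := by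
    rw [Ideal.mem_iInf]
    intro i
    have := key (Q.χ i).toLinearMap x n
    rw [hx i, map_zero] at this
    exact this.symm
  rw [Q.covering_ker.iInf_eq_bot] at h0
  exact h0

/-- A linear lift of `h ↦ 1 ⊗ h` in the chart `k`. -/
lemma exists_lift (k : I) : ∃ γ : H →ₗ[ℂ] Q.P, γ 1 = 1 ∧ ∀ h, Q.χ k (γ h) = 1 ⊗ₜ h := by
  obtain ⟨s, hs⟩ := LinearMap.exists_rightInverse_of_surjective (Q.χ k).toLinearMap
    (LinearMap.range_eq_top.2 (Q.χ_surjective k))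
  have hs' : ∀ x, Q.χ k (s x) = x := fun x => LinearMap.congr_fun hs x
  refine ⟨s ∘ₗ TensorProduct.mk ℂ _ H 1 +
    LinearMap.toSpanSingleton ℂ _ (1 - s (1 ⊗ₜ 1)) ∘ₗ (counit : H →ₗ[ℂ] ℂ), ?_, fun h => ?_⟩
  · simp
  · simp [hs', Algebra.TensorProduct.one_def]

/-- Averaging of an element with respect to the chart `k`. -/
lemma exists_average (k : I) (f : Q.P) : ∃ f' : Q.P,
    Q.χ k f' = (TensorProduct.rid ℂ (Q.Bl k) ((counit : H →ₗ[ℂ] ℂ).lTensor _ (Q.χ k f))) ⊗ₜ 1 ∧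
    ∀ m b, Q.χ m f = b ⊗ₜ 1 → Q.χ m f' = b ⊗ₜ 1 := by
  obtain ⟨γ, h1, hγ⟩ := Q.exists_lift k
  let E : Q.P →ₗ[ℂ] Q.P := LinearMap.mul' ℂ Q.P ∘ₗ
    (γ ∘ₗ HopfAlgebra.antipode ℂ).lTensor Q.P ∘ₗ Q.coact.toLinearMap
  have hE : ∀ m g, Q.χ m (E g) = LinearMap.mul' ℂ _
      (((Q.χ m).toLinearMap ∘ₗ γ ∘ₗ HopfAlgebra.antipode ℂ).lTensor _
        ((Q.χ m).toLinearMap.rTensor H (Q.coact g))) := by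
    intro m g
    change Q.χ m (LinearMap.mul' ℂ Q.P ((γ ∘ₗ HopfAlgebra.antipode ℂ).lTensor Q.P
      (Q.coact g))) = _
    induction Q.coact g using TensorProduct.induction_on with
    | zero => simp
    | add x y hx hy => simp only [map_add, hx, hy]
    | tmul x y => simp
  refine ⟨E f, ?_, ?_⟩
  · have hc : (Q.χ k).toLinearMap.rTensor H (Q.coact f) =
        (TensorProduct.assoc ℂ _ H H).symm
          ((comul : H →ₗ[ℂ] H ⊗[ℂ] H).lTensor _ (Q.χ k f)) := by
      rw [Q.χ_coact, LinearEquiv.symm_apply_apply]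
    rw [hE, hc]
    induction Q.χ k f using TensorProduct.induction_on with
    | zero => simp
    | add x y hx hy => simp only [map_add, hx, hy, TensorProduct.add_tmul]
    | tmul a h =>
      have hh : ∀ z : H ⊗[ℂ] H, LinearMap.mul' ℂ _
          (((Q.χ k).toLinearMap ∘ₗ γ ∘ₗ HopfAlgebra.antipode ℂ).lTensor _
            ((TensorProduct.assoc ℂ (Q.Bl k) H H).symm (a ⊗ₜ z))) =
          a ⊗ₜ LinearMap.mul' ℂ H ((HopfAlgebra.antipode ℂ).lTensor H z) := by
        intro z
        induction z using TensorProduct.induction_on with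
        | zero => simp
        | add x y hx hy => simp only [TensorProduct.tmul_add, map_add, hx, hy]
        | tmul x y => simp [hγ]
      rw [LinearMap.lTensor_tmul, hh, HopfAlgebra.mul_antipode_lTensor_comul_apply]
      simp [Algebra.algebraMap_eq_smul_one, TensorProduct.smul_tmul']
  · intro m b hb
    have hc : (Q.χ m).toLinearMap.rTensor H (Q.coact f) = (b ⊗ₜ 1) ⊗ₜ 1 := by
      apply (TensorProduct.assoc ℂ _ H H).injective
      rw [← Q.χ_coact, hb]
      simp [Algebra.TensorProduct.one_def]
    rw [hE, hc]
    simp [h1]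

variable [Finite I]

/-- An element vanishing in the chart `l` has, after applying the counit, coefficients from `J_l` in
the chart `k`. -/
lemma counit_χ_mem (k l : I) (g : Q.P) (hg : Q.χ l g = 0) : ∃ b ∈ Q.J l,
    TensorProduct.rid ℂ (Q.Bl k) ((counit : H →ₗ[ℂ] ℂ).lTensor _ (Q.χ k g)) =
      Ideal.Quotient.mk _ b := by
  classical
  have := Fintype.ofFinite I
  set c := TensorProduct.rid ℂ (Q.Bl k) ((counit : H →ₗ[ℂ] ℂ).lTensor _ (Q.χ k g)) with hc
  have key : ∀ s : Finset I, ∃ e, Q.χ k e = c ⊗ₜ 1 ∧ Q.χ l e = 0 ∧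
      ∀ m ∈ s, ∃ b, Q.χ m e = b ⊗ₜ 1 := by
    intro s
    induction s using Finset.induction_on with
    | empty =>
      obtain ⟨e, h1, h2⟩ := Q.exists_average k g
      refine ⟨e, h1, ?_, by simp⟩
      rw [h2 l 0 (by rw [hg, TensorProduct.zero_tmul]), TensorProduct.zero_tmul]
    | insert m s _ ih =>
      obtain ⟨e, h1, h2, h3⟩ := ih
      obtain ⟨e', h1', h2'⟩ := Q.exists_average m e
      refine ⟨e', h2' k c h1, ?_, ?_⟩
      · rw [h2' l 0 (by rw [h2, TensorProduct.zero_tmul]), TensorProduct.zero_tmul]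
      · intro n hn
        rcases Finset.mem_insert.1 hn with rfl | hn
        · exact ⟨_, h1'⟩
        · obtain ⟨b, hb⟩ := h3 n hn
          exact ⟨b, h2' n b hb⟩
  obtain ⟨e, h1, h2, h3⟩ := key Finset.univ
  have he : Q.coact e = e ⊗ₜ 1 := by
    rw [← sub_eq_zero]
    refine Q.rTensor_χ_injective _ fun m => ?_
    obtain ⟨b, hb⟩ := h3 m (Finset.mem_univ m)
    rw [map_sub, sub_eq_zero]
    apply (TensorProduct.assoc ℂ _ H H).injective
    rw [← Q.χ_coact, hb]
    simp [Algebra.TensorProduct.one_def, hb]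
  obtain ⟨b, rfl⟩ := (Q.coinvariants e).2 he
  rw [Q.χ_ι] at h1 h2
  have hinj : ∀ (m : I) (x : Q.Bl m), TensorProduct.rid ℂ (Q.Bl m)
      ((counit : H →ₗ[ℂ] ℂ).lTensor _ (x ⊗ₜ 1)) = x := by
    intro m x; simp
  refine ⟨b, ?_, ?_⟩
  · have := congrArg (fun y => TensorProduct.rid ℂ (Q.Bl l)
      ((counit : H →ₗ[ℂ] ℂ).lTensor _ y)) h2
    simp only [hinj, map_zero] at this
    exact Ideal.Quotient.eq_zero_iff_mem.1 this
  · have := congrArg (fun y => TensorProduct.rid ℂ (Q.Bl k)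
      ((counit : H →ₗ[ℂ] ℂ).lTensor _ y)) h1
    simp only [hinj] at this
    exact this.symm

section

variable {Q} {i j k l : I}

lemma resH_χ_eq_zero (h : Q.J k ⊔ Q.J l = Q.J i ⊔ Q.J j) (f : Q.P) (hf : Q.χ l f = 0) : resH h (Q.χ k f) = 0 := by
  let L : Q.P →ₗ[ℂ] Q.Bov i j := (res h).toLinearMap ∘ₗ
    (TensorProduct.rid ℂ (Q.Bl k)).toLinearMap ∘ₗ (counit : H →ₗ[ℂ] ℂ).lTensor _ ∘ₗ
      (Q.χ k).toLinearMap
  have hL : ∀ g, Q.χ l g = 0 → L g = 0 := by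
    intro g hg
    obtain ⟨b, hb, hb'⟩ := Q.counit_χ_mem k l g hg
    change res h (TensorProduct.rid ℂ (Q.Bl k) ((counit : H →ₗ[ℂ] ℂ).lTensor _ (Q.χ k g))) = 0
    rw [hb', res_mk]
    exact Ideal.Quotient.eq_zero_iff_mem.2 (h ▸ Submodule.mem_sup_right hb)
  obtain ⟨s, hs⟩ := LinearMap.exists_rightInverse_of_surjective (Q.χ l).toLinearMap
    (LinearMap.range_eq_top.2 (Q.χ_surjective l))
  have hs' : ∀ x, Q.χ l (s x) = x := fun x => LinearMap.congr_fun hs x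
  have hL' : L = (L ∘ₗ s) ∘ₗ (Q.χ l).toLinearMap := by
    ext g
    have := hL (g - s (Q.χ l g)) (by rw [map_sub, hs', sub_self])
    rw [map_sub, sub_eq_zero] at this
    exact this
  have h1 : L.rTensor H (Q.coact f) = 0 := by
    rw [hL', LinearMap.rTensor_comp, LinearMap.comp_apply]
    have : (Q.χ l).toLinearMap.rTensor H (Q.coact f) = 0 := by
      apply (TensorProduct.assoc ℂ _ H H).injective
      rw [← Q.χ_coact, hf, map_zero, map_zero]
    rw [this, map_zero]
  have h2 : L.rTensor H (Q.coact f) = resH h (Q.χ k f) := by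
    have e : L = ((res h).toLinearMap ∘ₗ (TensorProduct.rid ℂ (Q.Bl k)).toLinearMap ∘ₗ
      (counit : H →ₗ[ℂ] ℂ).lTensor _) ∘ₗ (Q.χ k).toLinearMap := rfl
    have hc : (Q.χ k).toLinearMap.rTensor H (Q.coact f) =
        (TensorProduct.assoc ℂ _ H H).symm
          ((comul : H →ₗ[ℂ] H ⊗[ℂ] H).lTensor _ (Q.χ k f)) := by
      rw [Q.χ_coact, LinearEquiv.symm_apply_apply]
    rw [e, LinearMap.rTensor_comp, LinearMap.comp_apply, hc, resH_eq]
    induction Q.χ k f using TensorProduct.induction_on with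
    | zero => simp
    | add x y hx hy => simp only [map_add, hx, hy]
    | tmul a x =>
      have hh : ∀ z : H ⊗[ℂ] H, LinearMap.rTensor H ((res h).toLinearMap ∘ₗ
          (TensorProduct.rid ℂ (Q.Bl k)).toLinearMap ∘ₗ (counit : H →ₗ[ℂ] ℂ).lTensor _)
          ((TensorProduct.assoc ℂ (Q.Bl k) H H).symm (a ⊗ₜ z)) =
          res h a ⊗ₜ TensorProduct.lid ℂ H ((counit : H →ₗ[ℂ] ℂ).rTensor H z) := by
        intro z
        induction z using TensorProduct.induction_on with
        | zero => simp
        | add x y hx hy => simp only [TensorProduct.tmul_add, map_add, hx, hy]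
        | tmul x y => simp [TensorProduct.smul_tmul]
      rw [LinearMap.lTensor_tmul, hh, Coalgebra.rTensor_counit_comul]
      simp
  rw [← h2, h1]

/-- `χ_k(ker χ_l)` is the kernel of `B_k ⊗ H → B_ij ⊗ H`. -/
lemma mem_χ_ker_iff (h : Q.J k ⊔ Q.J l = Q.J i ⊔ Q.J j) (x : Q.Bl k ⊗[ℂ] H) :
    (∃ f, Q.χ l f = 0 ∧ Q.χ k f = x) ↔ resH h x = 0 := by
  constructor
  · rintro ⟨f, hf, rfl⟩
    exact resH_χ_eq_zero h f hf
  · intro hx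
    have hex : Function.Exact (LinearMap.ker (res h).toLinearMap).subtype (res h).toLinearMap := by
      intro y
      simp
    obtain ⟨y, rfl⟩ := (rTensor_exact H hex (res_surjective h) x).1 hx
    clear hx
    induction y using TensorProduct.induction_on with
    | zero => exact ⟨0, map_zero _, by simp⟩
    | add y z hy hz =>
      obtain ⟨f, h1, h2⟩ := hy
      obtain ⟨g, h3, h4⟩ := hz
      exact ⟨f + g, by rw [map_add, h1, h3, add_zero], by rw [map_add, map_add, h2, h4]⟩
    | tmul a t =>
      obtain ⟨a, ha⟩ := a
      obtain ⟨b, rfl⟩ := Ideal.Quotient.mk_surjective a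
      have hb : b ∈ Q.J k ⊔ Q.J l := by
        rw [h]
        exact Ideal.Quotient.eq_zero_iff_mem.1 ha
      obtain ⟨b1, hb1, b2, hb2, rfl⟩ := Submodule.mem_sup.1 hb
      obtain ⟨g, hg⟩ := Q.χ_surjective k (1 ⊗ₜ t)
      refine ⟨Q.ι b2 * g, ?_, ?_⟩
      · rw [map_mul, Q.χ_ι, Ideal.Quotient.eq_zero_iff_mem.2 hb2, TensorProduct.zero_tmul, zero_mul]
      · rw [map_mul, Q.χ_ι, hg]
        simp [Ideal.Quotient.eq_zero_iff_mem.2 hb1]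

end

end LocTrivQPFB

end Bundle

/-! ## Transition functions -/

section Transition

open Coalgebra

namespace LocTrivQPFB

variable {I B H : Type*} [Ring B] [Algebra ℂ B] [Ring H] [HopfAlgebra ℂ H]
  {Q : LocTrivQPFB I B H} {i j k l : I}

lemma swap (h : Q.J k ⊔ Q.J l = Q.J i ⊔ Q.J j) : Q.J l ⊔ Q.J k = Q.J i ⊔ Q.J j :=
  (sup_comm _ _).trans h

variable (Q) in
/-- `ov i j` and `ovSwap i j` select the roles `(k, l) = (i, j)` and `(k, l) = (j, i)` over the same
algebra `B_ij`. -/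
lemma ov (i j : I) : Q.J i ⊔ Q.J j = Q.J i ⊔ Q.J j := rfl

variable (Q) in
lemma ovSwap (i j : I) : Q.J j ⊔ Q.J i = Q.J i ⊔ Q.J j := sup_comm _ _

/-- The homomorphism `P → B_ij ⊗ H`, `f ↦ (π ⊗ id)(χ_k f)`, for `J_k + J_l = J_i + J_j`. It induces
the isomorphism `χ^k : P/(ker χ_k + ker χ_l) → B_ij ⊗ H`. -/
def χOv (h : Q.J k ⊔ Q.J l = Q.J i ⊔ Q.J j) : Q.P →ₐ[ℂ] Q.Bov i j ⊗[ℂ] H :=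
  (resH h).comp (Q.χ k)

lemma χOv_surjective (h : Q.J k ⊔ Q.J l = Q.J i ⊔ Q.J j) : Function.Surjective (χOv h) :=
  (resH_surjective h).comp (Q.χ_surjective k)

variable [Finite I]

lemma χOv_eq_zero_iff (h : Q.J k ⊔ Q.J l = Q.J i ⊔ Q.J j) (f : Q.P) :
    χOv h f = 0 ↔ f ∈ RingHom.ker (Q.χ k) ⊔ RingHom.ker (Q.χ l) := by
  constructor
  · intro hf
    obtain ⟨g, h1, h2⟩ := (mem_χ_ker_iff h (Q.χ k f)).2 hf
    have h3 : f - g ∈ RingHom.ker (Q.χ k) := by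
      rw [RingHom.mem_ker, map_sub, h2, sub_self]
    have := Submodule.add_mem_sup h3 (show g ∈ RingHom.ker (Q.χ l) from h1)
    rwa [sub_add_cancel] at this
  · intro hf
    obtain ⟨x, hx, y, hy, rfl⟩ := Submodule.mem_sup.1 hf
    have h1 : χOv h x = 0 := by
      change resH h (Q.χ k x) = 0
      rw [show Q.χ k x = 0 from hx, map_zero]
    have h2 : χOv h y = 0 := resH_χ_eq_zero h y hy
    rw [map_add, h1, h2, add_zero]

/-- The isomorphism `φ_kl = χ^k ∘ (χ^l)⁻¹` of `B_ij ⊗ H`, for `J_k + J_l = J_i + J_j`. -/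
def φ (h : Q.J k ⊔ Q.J l = Q.J i ⊔ Q.J j) : Q.Bov i j ⊗[ℂ] H →ₐ[ℂ] Q.Bov i j ⊗[ℂ] H :=
  surjLift (χOv (swap h)) (χOv_surjective (swap h)) (χOv h) fun f hf => by
    rw [χOv_eq_zero_iff] at hf ⊢
    rwa [sup_comm]

lemma φ_χOv (h : Q.J k ⊔ Q.J l = Q.J i ⊔ Q.J j) (f : Q.P) : φ h (χOv (swap h) f) = χOv h f :=
  surjLift_apply _ _ _ _ f

/-- The transition function `τ_kl : H → B_ij`, `τ_kl(x) = (id ⊗ ε)(φ_lk(1 ⊗ x))`, for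
`J_k + J_l = J_i + J_j`. -/
def τ (h : Q.J k ⊔ Q.J l = Q.J i ⊔ Q.J j) : H →ₐ[ℂ] Q.Bov i j :=
  ((Algebra.TensorProduct.rid ℂ ℂ (Q.Bov i j)).toAlgHom.comp
    (Algebra.TensorProduct.map (AlgHom.id ℂ _) (Bialgebra.counitAlgHom ℂ H))).comp
      ((φ (swap h)).comp Algebra.TensorProduct.includeRight)

end LocTrivQPFB

end Transition

/-! ## Calculi on the Hopf algebra -/

section Hopf

open Coalgebra

variable {H : Type*} [Ring H] [HopfAlgebra ℂ H]

/-- The inverse of the antipode. -/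
def antipodeInv (hS : Function.Bijective (HopfAlgebra.antipode ℂ : H →ₗ[ℂ] H)) : H →ₗ[ℂ] H :=
  (LinearEquiv.ofBijective (HopfAlgebra.antipode ℂ : H →ₗ[ℂ] H) hS).symm

/-- `η(r) = ∑ S⁻¹(r₂) dr₁ ∈ Ω(H)`. -/
def ηΩ (hS : Function.Bijective (HopfAlgebra.antipode ℂ : H →ₗ[ℂ] H)) :
    H →ₗ[ℂ] (Omega H).Carrier :=
  LinearMap.mul' ℂ (Omega H).Carrier ∘ₗ
    TensorProduct.map ((Omega H).ι.toLinearMap ∘ₗ antipodeInv hS)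
      ((Omega H).d ∘ₗ (Omega H).ι.toLinearMap) ∘ₗ
    (TensorProduct.comm ℂ H H).toLinearMap ∘ₗ comul

lemma DiffCalculus.proj_zero_mul_of_gr_one {A : Type*} [Ring A] [Algebra ℂ A]
    (Γ : DiffCalculus A) (x : Γ.Carrier) {y : Γ.Carrier} (hy : y ∈ Γ.gr 1) :
    Γ.proj 0 (x * y) = 0 := by
  rw [proj_zero_mul, Γ.proj_of_mem hy, if_neg one_ne_zero, mul_zero]

lemma DiffCalculus.proj_zero_map {A M N : Type*} [Ring A] [Algebra ℂ A] [AddCommGroup M]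
    [Module ℂ M] [AddCommGroup N] [Module ℂ N]
    (Γ : DiffCalculus A) (f : M →ₗ[ℂ] A) (g : N →ₗ[ℂ] A) (z : M ⊗[ℂ] N) :
    Γ.proj 0 (LinearMap.mul' ℂ Γ.Carrier (TensorProduct.map (Γ.ι.toLinearMap ∘ₗ f)
      (Γ.d ∘ₗ Γ.ι.toLinearMap ∘ₗ g) z)) = 0 := by
  induction z using TensorProduct.induction_on with
  | zero => simp
  | add x y hx hy => rw [map_add, map_add, map_add, hx, hy, add_zero]
  | tmul x y =>
    rw [TensorProduct.map_tmul, LinearMap.mul'_apply]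
    exact Γ.proj_zero_mul_of_gr_one _ (Γ.dι_mem _)

/-- The differential ideal `J(H) ⊆ Ω(H)` determined by a right ideal `R ⊆ ker ε`: the one generated
by the elements `∑ S⁻¹(r₂) dr₁`, `r ∈ R`. -/
def idealH (hS : Function.Bijective (HopfAlgebra.antipode ℂ : H →ₗ[ℂ] H)) (R : Submodule ℂ H) :
    DiffIdeal (Omega H) :=
  DiffIdeal.generate (Omega H) (ηΩ hS '' R)

/-- The differential calculus `Γ(H) = Ω(H)/J(H)` determined by a right ideal `R ⊆ ker ε`. -/
def calcH (hS : Function.Bijective (HopfAlgebra.antipode ℂ : H →ₗ[ℂ] H)) (R : Submodule ℂ H) :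
    DiffCalculus H :=
  (Omega H).quot (idealH hS R) (AlgHom.id ℂ H) Function.surjective_id fun a =>
    DiffIdeal.ι_mem_generate (by
      rintro _ ⟨r, -, rfl⟩
      exact (Omega H).proj_zero_map (antipodeInv hS) LinearMap.id _)

/-- The linear map `r ↦ ∑ S(r₁) r₃ ⊗ r₂`. -/
def adMap : H →ₗ[ℂ] H ⊗[ℂ] H :=
  (LinearMap.mul' ℂ H ∘ₗ (HopfAlgebra.antipode ℂ).rTensor H).rTensor H ∘ₗ
    (TensorProduct.assoc ℂ H H H).symm.toLinearMap ∘ₗ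
    (TensorProduct.comm ℂ H H).toLinearMap.lTensor H ∘ₗ
    (comul : H →ₗ[ℂ] H ⊗[ℂ] H).lTensor H ∘ₗ comul

/-- Left covariance: the left coaction `h₀dh₁⋯dhₙ ↦ Δ(h₀)(id ⊗ d)Δ(h₁)⋯(id ⊗ d)Δ(hₙ)` exists and
makes `Γ` a left `H`-comodule algebra. -/
def DiffCalculus.LeftCovariant (Γ : DiffCalculus H) : Prop :=
  ∃ δ : Γ.Carrier →ₐ[ℂ] H ⊗[ℂ] Γ.Carrier,
    (∀ h, δ (Γ.ι h) = Γ.ι.toLinearMap.lTensor H (comul h)) ∧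
    (∀ h, δ (Γ.d (Γ.ι h)) = (Γ.d ∘ₗ Γ.ι.toLinearMap).lTensor H (comul h)) ∧
    (∀ x, TensorProduct.assoc ℂ H H Γ.Carrier ((comul : H →ₗ[ℂ] H ⊗[ℂ] H).rTensor _ (δ x)) =
      δ.toLinearMap.lTensor H (δ x)) ∧
    ∀ x, TensorProduct.lid ℂ Γ.Carrier ((counit : H →ₗ[ℂ] ℂ).rTensor _ (δ x)) = x

/-- Right covariance: the right coaction `h₀dh₁⋯dhₙ ↦ Δ(h₀)(d ⊗ id)Δ(h₁)⋯(d ⊗ id)Δ(hₙ)` exists and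
makes `Γ` a right `H`-comodule algebra. -/
def DiffCalculus.RightCovariant (Γ : DiffCalculus H) : Prop :=
  ∃ δ : Γ.Carrier →ₐ[ℂ] Γ.Carrier ⊗[ℂ] H,
    (∀ h, δ (Γ.ι h) = Γ.ι.toLinearMap.rTensor H (comul h)) ∧
    (∀ h, δ (Γ.d (Γ.ι h)) = (Γ.d ∘ₗ Γ.ι.toLinearMap).rTensor H (comul h)) ∧
    (∀ x, TensorProduct.assoc ℂ Γ.Carrier H H (δ.toLinearMap.rTensor H (δ x)) =
      (comul : H →ₗ[ℂ] H ⊗[ℂ] H).lTensor _ (δ x)) ∧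
    ∀ x, TensorProduct.rid ℂ Γ.Carrier ((counit : H →ₗ[ℂ] ℂ).lTensor _ (δ x)) = x

/-- Bicovariance. -/
def DiffCalculus.Bicovariant (Γ : DiffCalculus H) : Prop := Γ.LeftCovariant ∧ Γ.RightCovariant

end Hopf

/-! ## The calculi on the total space and on the overlaps -/

section Calculi

open Coalgebra

/-- Isomorphism of differential calculi over the same algebra: an isomorphism of differential
algebras which is the identity on the algebra. -/
def DiffCalculus.Isomorphic {A : Type*} [Ring A] [Algebra ℂ A] (Γ Γ' : DiffCalculus A) : Prop :=
  ∃ F : DiffHom Γ Γ', Function.Bijective F.toAlgHom ∧ ∀ a, F.toAlgHom (Γ.ι a) = Γ'.ι a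

/-- Homomorphisms from a factor calculus. -/
def DiffHom.quotLift {A A' A'' : Type*} [Ring A] [Algebra ℂ A] [Ring A'] [Algebra ℂ A']
    [Ring A''] [Algebra ℂ A''] {Γ : DiffCalculus A} {Γ' : DiffCalculus A''} (F : DiffHom Γ Γ')
    (J : DiffIdeal Γ) (hF : ∀ x ∈ J.toIdeal, F.toAlgHom x = 0) (f : A →ₐ[ℂ] A')
    (hf : Function.Surjective f) (hJ : ∀ a, Γ.ι a ∈ J.toIdeal ↔ f a = 0) :
    DiffHom (Γ.quot J f hf hJ) Γ' where
  toAlgHom := Ideal.Quotient.liftₐ J.toIdeal F.toAlgHom hF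
  map_d := by
    intro x
    obtain ⟨x, rfl⟩ := Ideal.Quotient.mkₐ_surjective ℂ J.toIdeal x
    exact F.map_d x
  map_gr := by
    rintro n _ ⟨x, hx, rfl⟩
    exact F.map_gr n x hx

namespace LocTrivQPFB

variable {I B H : Type*} [Ring B] [Algebra ℂ B] [Ring H] [HopfAlgebra ℂ H]

section

variable (Q : LocTrivQPFB I B H) (Γ : ∀ i, DiffCalculus (Q.Bl i)) (ΓH : DiffCalculus H)

/-- The extension `Ω(P) → Γ(Bᵢ) ⊗̂ Γ(H)` of `χᵢ`. -/
def χΩΓ (i : I) : DiffHom (Omega Q.P) (skew (Γ i) ΓH) := Omega.ext (Q.χ i) (skew (Γ i) ΓH)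

/-- The differential ideal `J(P) = ⋂ᵢ ker(Ω(P) → Γ(Bᵢ) ⊗̂ Γ(H))`. -/
def idealP : DiffIdeal (Omega Q.P) := DiffIdeal.iInf fun i => (Q.χΩΓ Γ ΓH i).ker

lemma ι_mem_idealP (f : Q.P) : (Omega Q.P).ι f ∈ (Q.idealP Γ ΓH).toIdeal ↔ f = 0 := by
  constructor
  · intro h
    have h0 : f ∈ ⨅ i, RingHom.ker (Q.χ i) := by
      rw [Ideal.mem_iInf]
      intro i
      have h1 : (Q.χΩΓ Γ ΓH i).toAlgHom ((Omega Q.P).ι f) = 0 := DiffIdeal.mem_iInf.1 h i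
      rw [χΩΓ, Omega.ext_ι] at h1
      exact (skew (Γ i) ΓH).ι_injective (h1.trans (map_zero _).symm)
    rw [Q.covering_ker.iInf_eq_bot] at h0
    exact h0
  · rintro rfl
    rw [map_zero]; exact zero_mem _

/-- The differential structure `Γ(P) = Ω(P)/J(P)` on the bundle. -/
def calcP : DiffCalculus Q.P :=
  (Omega Q.P).quot (Q.idealP Γ ΓH) (AlgHom.id ℂ Q.P) Function.surjective_id (Q.ι_mem_idealP Γ ΓH)

/-- The extension `Γ(P) → Γ(Bᵢ) ⊗̂ Γ(H)` of `χᵢ`. -/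
def χΓ (i : I) : DiffHom (Q.calcP Γ ΓH) (skew (Γ i) ΓH) :=
  (Q.χΩΓ Γ ΓH i).quotLift (Q.idealP Γ ΓH) (fun _ hx => DiffIdeal.mem_iInf.1 hx i) _ _ _

lemma χΓ_surjective (i : I) : Function.Surjective (Q.χΓ Γ ΓH i).toAlgHom := by
  intro y
  obtain ⟨x, rfl⟩ := Omega.ext_surjective (Q.χ i) (Q.χ_surjective i) (skew (Γ i) ΓH) y
  exact ⟨Ideal.Quotient.mkₐ ℂ (Q.idealP Γ ΓH).toIdeal x, rfl⟩

lemma χΓ_ι (i : I) (f : Q.P) :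
    (Q.χΓ Γ ΓH i).toAlgHom ((Q.calcP Γ ΓH).ι f) = (skew (Γ i) ΓH).ι (Q.χ i f) := by
  have h : (Q.calcP Γ ΓH).ι f =
      Ideal.Quotient.mkₐ ℂ (Q.idealP Γ ΓH).toIdeal ((Omega Q.P).ι f) :=
    quotι_apply (Omega Q.P) (Q.idealP Γ ΓH) (AlgHom.id ℂ Q.P) Function.surjective_id
      (Q.ι_mem_idealP Γ ΓH) f
  rw [h]
  exact Omega.ext_ι (Q.χ i) (skew (Γ i) ΓH) f

/-- The differential ideal `χ_k(ker χ_l)` of `Γ(B_k) ⊗̂ Γ(H)`, with `χ_k, χ_l` extended to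
`Γ(P)`. -/
def idealOv (k l : I) : DiffIdeal (skew (Γ k) ΓH) :=
  ((Q.χΓ Γ ΓH l).ker).map (Q.χΓ Γ ΓH k) (Q.χΓ_surjective Γ ΓH k)

end

variable [Finite I] {Q : LocTrivQPFB I B H} (Γ : ∀ i, DiffCalculus (Q.Bl i))
  (ΓH : DiffCalculus H) {i j k l : I}

lemma ι_mem_idealOv (h : Q.J k ⊔ Q.J l = Q.J i ⊔ Q.J j) (x : Q.Bl k ⊗[ℂ] H) :
    (skew (Γ k) ΓH).ι x ∈ (Q.idealOv Γ ΓH k l).toIdeal ↔ resH h x = 0 := by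
  rw [← mem_χ_ker_iff h]
  constructor
  · rintro ⟨ω, hω, hx⟩
    have h0 := (Q.calcP Γ ΓH).proj_mem 0 ω
    rw [(Q.calcP Γ ΓH).gr_zero] at h0
    obtain ⟨f, hf⟩ := h0
    rw [AlgHom.toLinearMap_apply] at hf
    refine ⟨f, ?_, ?_⟩
    · have h1 : (Q.χΓ Γ ΓH l).toAlgHom ((Q.calcP Γ ΓH).proj 0 ω) = 0 :=
        (Q.χΓ Γ ΓH l).ker.proj_mem ω hω 0
      rw [← hf, χΓ_ι] at h1
      exact (skew (Γ l) ΓH).ι_injective (h1.trans (map_zero _).symm)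
    · have h1 := congrArg ((skew (Γ k) ΓH).proj 0) hx
      rw [← DiffHom.map_proj, ← hf, χΓ_ι,
        (skew (Γ k) ΓH).proj_of_mem ((skew (Γ k) ΓH).ι_mem x), if_pos rfl] at h1
      exact (skew (Γ k) ΓH).ι_injective h1
  · rintro ⟨f, hf, rfl⟩
    refine ⟨(Q.calcP Γ ΓH).ι f, ?_, Q.χΓ_ι Γ ΓH k f⟩
    change (Q.χΓ Γ ΓH l).toAlgHom ((Q.calcP Γ ΓH).ι f) = 0
    rw [χΓ_ι, hf, map_zero]

/-- The induced calculus `Γᵏ(B_ij ⊗ H) = (Γ(B_k) ⊗̂ Γ(H)) / χ_k(ker χ_l)` over `B_ij ⊗ H`, for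
`J_k + J_l = J_i + J_j`. -/
def calcOv (k l : I) (h : Q.J k ⊔ Q.J l = Q.J i ⊔ Q.J j) : DiffCalculus (Q.Bov i j ⊗[ℂ] H) :=
  (skew (Γ k) ΓH).quot (Q.idealOv Γ ΓH k l) (resH h) (resH_surjective h)
    (ι_mem_idealOv Γ ΓH h)

/-- The generators of the differential ideal `J_m(B_ij) ⊆ Ω(B_ij)`, for `J_k + J_l = J_i + J_j`:
the images of `J(B_k)` and `J(B_l)`, the elements `∑ τ_lk(r₁) dτ_kl(r₂)` for `r ∈ R`, and the
elements `(dτ_lk(x)) a - a dτ_lk(x)`. -/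
inductive JmGen (R : Submodule ℂ H) (k l : I) (h : Q.J k ⊔ Q.J l = Q.J i ⊔ Q.J j) :
    (Omega (Q.Bov i j)).Carrier → Prop
  | left (x : (Omega (Q.Bl k)).Carrier) (hx : x ∈ (Γ k).ideal.toIdeal) :
      JmGen R k l h ((Omega.ext (res h) (Omega (Q.Bov i j))).toAlgHom x)
  | right (x : (Omega (Q.Bl l)).Carrier) (hx : x ∈ (Γ l).ideal.toIdeal) :
      JmGen R k l h ((Omega.ext (res (swap h)) (Omega (Q.Bov i j))).toAlgHom x)
  | ofR (r : H) (hr : r ∈ R) :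
      JmGen R k l h (LinearMap.mul' ℂ (Omega (Q.Bov i j)).Carrier
        (TensorProduct.map ((Omega (Q.Bov i j)).ι.toLinearMap ∘ₗ (τ (swap h)).toLinearMap)
          ((Omega (Q.Bov i j)).d ∘ₗ (Omega (Q.Bov i j)).ι.toLinearMap ∘ₗ (τ h).toLinearMap)
          (comul r)))
  | comm (x : H) (a : Q.Bov i j) :
      JmGen R k l h
        ((Omega (Q.Bov i j)).d ((Omega (Q.Bov i j)).ι (τ (swap h) x)) * (Omega (Q.Bov i j)).ι a -
          (Omega (Q.Bov i j)).ι a * (Omega (Q.Bov i j)).d ((Omega (Q.Bov i j)).ι (τ (swap h) x)))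

/-- The differential ideal `J_m(B_ij) ⊆ Ω(B_ij)`. -/
def idealM (R : Submodule ℂ H) (k l : I) (h : Q.J k ⊔ Q.J l = Q.J i ⊔ Q.J j) :
    DiffIdeal (Omega (Q.Bov i j)) :=
  DiffIdeal.generate (Omega (Q.Bov i j)) {x | JmGen Γ R k l h x}

lemma ext_ideal_proj_zero {A A' : Type*} [Ring A] [Algebra ℂ A] [Ring A'] [Algebra ℂ A']
    (Γ : DiffCalculus A) (f : A →ₐ[ℂ] A') (x : (Omega A).Carrier) (hx : x ∈ Γ.ideal.toIdeal) :
    (Omega A').proj 0 ((Omega.ext f (Omega A')).toAlgHom x) = 0 := by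
  rw [← DiffHom.map_proj, Γ.proj_zero_of_mem_ideal hx, map_zero]

/-- The differential calculus `Γ_m(B_ij) = Ω(B_ij)/J_m(B_ij)`. -/
def calcM (R : Submodule ℂ H) (k l : I) (h : Q.J k ⊔ Q.J l = Q.J i ⊔ Q.J j) :
    DiffCalculus (Q.Bov i j) :=
  (Omega (Q.Bov i j)).quot (idealM Γ R k l h) (AlgHom.id ℂ _) Function.surjective_id fun a =>
    DiffIdeal.ι_mem_generate (by
      rintro _ (⟨x, hx⟩ | ⟨x, hx⟩ | ⟨r, hr⟩ | ⟨x, a⟩)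
      · exact ext_ideal_proj_zero (Γ k) (res h) x hx
      · exact ext_ideal_proj_zero (Γ l) (res (swap h)) x hx
      · exact (Omega (Q.Bov i j)).proj_zero_map _ _ _
      · rw [map_sub, proj_zero_mul,
          (Omega (Q.Bov i j)).proj_zero_mul_of_gr_one _ ((Omega (Q.Bov i j)).dι_mem _),
          (Omega (Q.Bov i j)).proj_of_mem ((Omega (Q.Bov i j)).dι_mem _), if_neg one_ne_zero,
          zero_mul, sub_zero])

/-- The condition `∑ τ_ij(S(r₁) r₃) ⊗ r₂ ∈ B_ij ⊗ R` for all `r ∈ R` and all `i, j`. -/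
def TransitionInvariant (Q : LocTrivQPFB I B H) (R : Submodule ℂ H) : Prop :=
  ∀ i j, ∀ r ∈ R, (τ (Q.ov i j)).toLinearMap.rTensor H (adMap r) ∈
    LinearMap.range (R.subtype.lTensor (Q.Bov i j))

end LocTrivQPFB

end Calculi

end

/-! Everything rests on the convolution (f ⋇ g)(x) = ∑ f(x₂) g(x₁). For it S⁻¹ plays the role of the
antipode, so an algebra homomorphism γ out of H has the convolution inverse γ ∘ S⁻¹. The form η_γ(x)
= ∑ γ(S⁻¹(x₂)) dγ(x₁) is then determined by dγ = γ ⋇ η_γ, and computations with Sweedler indices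
become cancellations in an associative algebra.

Let (k, l) be i and j in either order. The two trivializations over B_ij differ by φ_kl(1 ⊗ x) = ∑
τ_lk(x₁) ⊗ x₂, where the τ's have central values and τ_lk is the convolution inverse of τ_kl. So
φ_kl restricted to H is g ⋇ τ_lk, with g the embedding of H. Applying d and cancelling g gives η_φ =
τ_kl ⋇ η ⋇ τ_lk + τ_kl ⋇ dτ_lk. At r ∈ R the first term is ∑ τ_kl(S(r₁) r₃) η(r₂), which condition
(*) kills wherever η vanishes on R. The second is -∑ τ_lk(r₁) dτ_kl(r₂), provided that dτ_lk
commutes with B_ij. This is `ext_φH_ηΩ`. By the same cancellation, dφ_kl(H) commutes with B_ij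
exactly when dτ_lk(H) does (`d_φH_commutator`).

Pulled back to Ω(P), the relations of Γᵏ(B_ij ⊗ H) are the sum of the kernels of the extensions of
χ_k and χ_l. The calculus thus imposes the relations of both charts, those of chart l being
transported by φ_kl. The relations of a skew product are those of its factors together with one
commutation rule (`skew_ideal_le`). By the two results above, the transported relations of chart l
amount to the generators of J_m coming from J(B_l), from R and from the commutators with dτ_lk. This
yields the inclusions `calcOv_ideal_le` and `skew_calcM_ideal_le`. To compare (i, j) with (j, i) it
remains to see that J_m is symmetric (`idealM_swap_le`): dτ_lk ⋇ τ_kl = -τ_lk ⋇ (dτ_kl ⋇ τ_lk) ⋇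
τ_kl, again a conjugate to which (*) applies.

For the last claim, the left coaction sends η(r) to ∑ S⁻¹(r₃) r₁ ⊗ η(r₂), so η(r) = 0 forces ∑ S(r₁)
r₃ ⊗ η(r₂) = 0. To conclude that this tensor with r₂ in place of η(r₂) lies in H ⊗ R, one must know
that the generated ideal J(H) does not enlarge R in degree one. An explicit representation of Ω(H)
on H ⊕ (H ⊗ H/R) shows this (`exists_quotient_form`). -/

noncomputable section

/-! ## Convolution with respect to the opposite comultiplication -/

section CopConv

open Coalgebra

variable {C G : Type*} [AddCommGroup C] [Module ℂ C] [Coalgebra ℂ C] [Ring G] [Algebra ℂ G]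

/-- The convolution product `h ↦ ∑ f(h₂) g(h₁)` with respect to the opposite comultiplication. -/
def copConv (f g : C →ₗ[ℂ] G) : C →ₗ[ℂ] G :=
  LinearMap.mul' ℂ G ∘ₗ TensorProduct.map f g ∘ₗ (TensorProduct.comm ℂ C C).toLinearMap ∘ₗ comul

local infixl:70 " ⋇ " => copConv

variable (C G) in
/-- The unit `h ↦ ε(h) 1` of the convolution product. -/
def copOne : C →ₗ[ℂ] G := Algebra.linearMap ℂ G ∘ₗ counit

lemma copConv_apply (f g : C →ₗ[ℂ] G) (x : C) :
    (f ⋇ g) x = LinearMap.mul' ℂ G (TensorProduct.map f g (TensorProduct.comm ℂ C C (comul x))) :=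
  rfl

lemma copOne_apply (x : C) : copOne C G x = counit (R := ℂ) x • (1 : G) := by
  simp [copOne, Algebra.algebraMap_eq_smul_one]

/-- Coassociativity: both sides are the functional `M`, which multiplies three legs in reverse
order, applied to the iterated comultiplication. -/
lemma copConv_assoc (f g k : C →ₗ[ℂ] G) : f ⋇ g ⋇ k = f ⋇ (g ⋇ k) := by
  let M : C ⊗[ℂ] (C ⊗[ℂ] C) →ₗ[ℂ] G := LinearMap.mul' ℂ G ∘ₗ
    TensorProduct.map f (LinearMap.mul' ℂ G ∘ₗ TensorProduct.map g k ∘ₗ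
      (TensorProduct.comm ℂ C C).toLinearMap) ∘ₗ
    (TensorProduct.comm ℂ (C ⊗[ℂ] C) C).toLinearMap ∘ₗ (TensorProduct.assoc ℂ C C C).symm.toLinearMap
  have hM : ∀ a b c, M (a ⊗ₜ (b ⊗ₜ c)) = f c * (g b * k a) := fun a b c => by simp [M]
  have h1 : LinearMap.mul' ℂ G ∘ₗ TensorProduct.map f (g ⋇ k) ∘ₗ
      (TensorProduct.comm ℂ C C).toLinearMap =
      M ∘ₗ (TensorProduct.assoc ℂ C C C).toLinearMap ∘ₗ comul.rTensor C := by
    refine TensorProduct.ext' fun a b => ?_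
    simp only [LinearMap.comp_apply, LinearEquiv.coe_coe, TensorProduct.comm_tmul,
      TensorProduct.map_tmul, LinearMap.mul'_apply, LinearMap.rTensor_tmul, copConv_apply]
    induction (comul a : C ⊗[ℂ] C) using TensorProduct.induction_on with
    | zero => simp
    | add x y hx hy => simp only [map_add, mul_add, TensorProduct.add_tmul, hx, hy]
    | tmul x y => simp [hM]
  have h2 : LinearMap.mul' ℂ G ∘ₗ TensorProduct.map (f ⋇ g) k ∘ₗ
      (TensorProduct.comm ℂ C C).toLinearMap = M ∘ₗ comul.lTensor C := by
    refine TensorProduct.ext' fun a b => ?_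
    simp only [LinearMap.comp_apply, LinearEquiv.coe_coe, TensorProduct.comm_tmul,
      TensorProduct.map_tmul, LinearMap.mul'_apply, LinearMap.lTensor_tmul, copConv_apply]
    induction (comul b : C ⊗[ℂ] C) using TensorProduct.induction_on with
    | zero => simp
    | add x y hx hy => simp only [map_add, add_mul, TensorProduct.tmul_add, hx, hy]
    | tmul x y => simp [hM, mul_assoc]
  ext x
  have e1 := LinearMap.congr_fun h1 (comul x)
  have e2 := LinearMap.congr_fun h2 (comul x)
  simp only [LinearMap.comp_apply, LinearEquiv.coe_coe, Coalgebra.coassoc_apply] at e1 e2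
  exact e2.trans e1.symm

lemma copOne_copConv (f : C →ₗ[ℂ] G) : copOne C G ⋇ f = f := by
  ext x
  have h : ∀ z : C ⊗[ℂ] C, LinearMap.mul' ℂ G
      (TensorProduct.map (copOne C G) f (TensorProduct.comm ℂ C C z)) =
      f (TensorProduct.rid ℂ C ((counit : C →ₗ[ℂ] ℂ).lTensor C z)) := by
    intro z
    induction z using TensorProduct.induction_on with
    | zero => simp
    | add x y hx hy => simp only [map_add, hx, hy]
    | tmul x y => simp [copOne_apply]
  rw [copConv_apply, h, Coalgebra.lTensor_counit_comul]
  simp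

lemma copConv_copOne (f : C →ₗ[ℂ] G) : f ⋇ copOne C G = f := by
  ext x
  have h : ∀ z : C ⊗[ℂ] C, LinearMap.mul' ℂ G
      (TensorProduct.map f (copOne C G) (TensorProduct.comm ℂ C C z)) =
      f (TensorProduct.lid ℂ C ((counit : C →ₗ[ℂ] ℂ).rTensor C z)) := by
    intro z
    induction z using TensorProduct.induction_on with
    | zero => simp
    | add x y hx hy => simp only [map_add, hx, hy]
    | tmul x y => simp [copOne_apply]
  rw [copConv_apply, h, Coalgebra.rTensor_counit_comul]
  simp

lemma copConv_add (f g k : C →ₗ[ℂ] G) : f ⋇ (g + k) = f ⋇ g + f ⋇ k := by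
  ext x; simp [copConv_apply, TensorProduct.map_add_right]

lemma copConv_zero (f : C →ₗ[ℂ] G) : f ⋇ 0 = 0 := by
  ext x; simp [copConv_apply]

lemma map_copConv {G' : Type*} [Ring G'] [Algebra ℂ G'] (F : G →ₐ[ℂ] G') (f g : C →ₗ[ℂ] G) :
    F.toLinearMap ∘ₗ (f ⋇ g) = (F.toLinearMap ∘ₗ f) ⋇ (F.toLinearMap ∘ₗ g) := by
  ext x
  simp only [LinearMap.comp_apply, copConv_apply]
  induction TensorProduct.comm ℂ C C (comul x) using TensorProduct.induction_on with
  | zero => simp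
  | add x y hx hy => simp only [map_add, hx, hy]
  | tmul x y => simp

lemma map_copOne {G' : Type*} [Ring G'] [Algebra ℂ G'] (F : G →ₐ[ℂ] G') :
    F.toLinearMap ∘ₗ copOne C G = copOne C G' := by
  ext x; simp [copOne_apply]

/-- Convolution of maps with commuting values does not depend on the comultiplication. -/
lemma copConv_apply_of_commute (f g : C →ₗ[ℂ] G) (h : ∀ x y, f x * g y = g y * f x) (x : C) :
    (f ⋇ g) x = LinearMap.mul' ℂ G (TensorProduct.map g f (comul x)) := by
  rw [copConv_apply]
  induction (comul x : C ⊗[ℂ] C) using TensorProduct.induction_on with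
  | zero => simp
  | add x y hx hy => simp only [map_add, hx, hy]
  | tmul x y => simp [h]

/-- The tool behind the Sweedler computations below; the cancelled `f` is always an algebra
homomorphism out of H, inverted by `f ∘ S⁻¹`. -/
lemma copConv_cancel_left {f f' g k : C →ₗ[ℂ] G} (hf : f' ⋇ f = copOne C G) (h : f ⋇ g = f ⋇ k) :
    g = k := by
  have := congrArg (copConv f') h
  rwa [← copConv_assoc, ← copConv_assoc, hf, copOne_copConv, copOne_copConv] at this

lemma eq_copConv_of_copConv_eq {f f' g k : C →ₗ[ℂ] G} (hf : f' ⋇ f = copOne C G) (h : f ⋇ g = k) :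
    g = f' ⋇ k := by
  rw [← h, ← copConv_assoc, hf, copOne_copConv]

end CopConv

/-! ### The inverse antipode as a convolution inverse -/

section Antipode

open Coalgebra

variable {H G : Type*} [Ring H] [HopfAlgebra ℂ H] [Ring G] [Algebra ℂ G]

local infixl:70 " ⋇ " => copConv

lemma antipode_antipodeInv (hS : Function.Bijective (HopfAlgebra.antipode ℂ : H →ₗ[ℂ] H)) (x : H) :
    HopfAlgebra.antipode ℂ (antipodeInv hS x) = x :=
  LinearEquiv.apply_symm_apply (LinearEquiv.ofBijective _ hS) x

/-- S⁻¹ is the antipode of the co-opposite structure. Applying the injective, antimultiplicative S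
reduces the claim for the identity of H to the usual axiom ∑ S(x₁) x₂ = ε(x); composing with `γ`
gives the general case. -/
lemma antipodeInv_copConv (hS : Function.Bijective (HopfAlgebra.antipode ℂ : H →ₗ[ℂ] H))
    (γ : H →ₐ[ℂ] G) : (γ.toLinearMap ∘ₗ antipodeInv hS) ⋇ γ.toLinearMap = copOne H G := by
  have key : antipodeInv hS ⋇ LinearMap.id = copOne H H := by
    ext x
    apply hS.1
    have h : ∀ z : H ⊗[ℂ] H, HopfAlgebra.antipode ℂ (LinearMap.mul' ℂ H
        (TensorProduct.map (antipodeInv hS) LinearMap.id (TensorProduct.comm ℂ H H z))) =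
        LinearMap.mul' ℂ H ((HopfAlgebra.antipode ℂ).rTensor H z) := by
      intro z
      induction z using TensorProduct.induction_on with
      | zero => simp
      | add x y hx hy => simp only [map_add, hx, hy]
      | tmul x y =>
        simp [HopfAlgebra.antipode_mul_antidistrib, antipode_antipodeInv]
    rw [copConv_apply, h, HopfAlgebra.mul_antipode_rTensor_comul_apply]
    simp [copOne_apply, Algebra.algebraMap_eq_smul_one]
  rw [← map_copOne γ, ← key, map_copConv]
  rfl

lemma copConv_antipodeInv (hS : Function.Bijective (HopfAlgebra.antipode ℂ : H →ₗ[ℂ] H))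
    (γ : H →ₐ[ℂ] G) : γ.toLinearMap ⋇ (γ.toLinearMap ∘ₗ antipodeInv hS) = copOne H G := by
  have key : LinearMap.id ⋇ antipodeInv hS = copOne H H := by
    ext x
    apply hS.1
    have h : ∀ z : H ⊗[ℂ] H, HopfAlgebra.antipode ℂ (LinearMap.mul' ℂ H
        (TensorProduct.map LinearMap.id (antipodeInv hS) (TensorProduct.comm ℂ H H z))) =
        LinearMap.mul' ℂ H ((HopfAlgebra.antipode ℂ).lTensor H z) := by
      intro z
      induction z using TensorProduct.induction_on with
      | zero => simp
      | add x y hx hy => simp only [map_add, hx, hy]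
      | tmul x y =>
        simp [HopfAlgebra.antipode_mul_antidistrib, antipode_antipodeInv]
    rw [copConv_apply, h, HopfAlgebra.mul_antipode_lTensor_comul_apply]
    simp [copOne_apply, Algebra.algebraMap_eq_smul_one]
  rw [← map_copOne γ, ← key, map_copConv]
  rfl

end Antipode

/-! ## Differential ideals and extensions of homomorphisms -/

section General

variable {A A' A'' : Type*} [Ring A] [Algebra ℂ A] [Ring A'] [Algebra ℂ A'] [Ring A'']
  [Algebra ℂ A'']

lemma DiffIdeal.toIdeal_injective {Γ : DiffCalculus A} {J J' : DiffIdeal Γ}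
    (h : J.toIdeal = J'.toIdeal) : J = J' := by
  cases J; cases J'; cases h; rfl

lemma DiffIdeal.subset_generate {Γ : DiffCalculus A} {S : Set Γ.Carrier} {x : Γ.Carrier}
    (hx : x ∈ S) : x ∈ (DiffIdeal.generate Γ S).toIdeal :=
  DiffIdeal.mem_iInf.2 fun J => J.2 hx

lemma DiffIdeal.generate_le {Γ : DiffCalculus A} {S : Set Γ.Carrier} {J : DiffIdeal Γ}
    (h : ∀ x ∈ S, x ∈ J.toIdeal) {x : Γ.Carrier} (hx : x ∈ (DiffIdeal.generate Γ S).toIdeal) :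
    x ∈ J.toIdeal :=
  DiffIdeal.mem_iInf.1 hx ⟨J, h⟩

/-- A homomorphism out of Ω(A) is determined on A and dA, so for homomorphisms of differential
algebras it suffices to compare degree zero. -/
lemma DiffHom.map_ext {Γ : DiffCalculus A'} {Γ' : DiffCalculus A''} (F : DiffHom Γ Γ')
    (f : A →ₐ[ℂ] A') (g : A →ₐ[ℂ] A'') (h : ∀ a, F.toAlgHom (Γ.ι (f a)) = Γ'.ι (g a))
    (x : (Omega A).Carrier) :
    F.toAlgHom ((Omega.ext f Γ).toAlgHom x) = (Omega.ext g Γ').toAlgHom x := by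
  have : F.toAlgHom.comp (OmegaAlg.ext f Γ) = OmegaAlg.ext g Γ' := by
    refine OmegaAlg.hom_ext (fun a => ?_) (fun a => ?_)
    · rw [AlgHom.comp_apply, OmegaAlg.ext_of, OmegaAlg.ext_of, h]
    · rw [AlgHom.comp_apply, OmegaAlg.ext_del, OmegaAlg.ext_del, F.map_d, h]
  exact DFunLike.congr_fun this x

lemma Omega.ext_ext (f : A →ₐ[ℂ] A') (g : A' →ₐ[ℂ] A'') (Γ : DiffCalculus A'')
    (x : (Omega A).Carrier) : (Omega.ext g Γ).toAlgHom ((Omega.ext f (Omega A')).toAlgHom x) =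
      (Omega.ext (g.comp f) Γ).toAlgHom x :=
  (Omega.ext g Γ).map_ext f (g.comp f) (fun a => Omega.ext_ι g Γ (f a)) x

lemma Omega.ext_dι (f : A →ₐ[ℂ] A') (Γ : DiffCalculus A') (a : A) :
    (Omega.ext f Γ).toAlgHom ((Omega A).d ((Omega A).ι a)) = Γ.d (Γ.ι (f a)) := by
  rw [(Omega.ext f Γ).map_d, Omega.ext_ι]

lemma Omega.ext_id_surjective (Γ : DiffCalculus A) :
    Function.Surjective (Omega.ext (AlgHom.id ℂ A) Γ).toAlgHom :=
  Omega.ext_surjective _ Function.surjective_id Γ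

lemma Omega.ext_surjOn_gr (Γ : DiffCalculus A) {n : ℕ} {x : Γ.Carrier} (hx : x ∈ Γ.gr n) :
    ∃ y ∈ (Omega A).gr n, (Omega.ext (AlgHom.id ℂ A) Γ).toAlgHom y = x := by
  obtain ⟨y, rfl⟩ := Omega.ext_id_surjective Γ x
  refine ⟨(Omega A).proj n y, (Omega A).proj_mem n y, ?_⟩
  rw [DiffHom.map_proj, Γ.proj_of_mem hx, if_pos rfl]

lemma DiffCalculus.mem_ideal (Γ : DiffCalculus A) (x : (Omega A).Carrier) :
    x ∈ Γ.ideal.toIdeal ↔ (Omega.ext (AlgHom.id ℂ A) Γ).toAlgHom x = 0 := Iff.rfl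

/-- The homomorphism of differential algebras `Γ → Γ'` that extends `f`, if the relations of `Γ`
hold in `Γ'`. -/
def DiffHom.ofIdeal (Γ : DiffCalculus A) (Γ' : DiffCalculus A') (f : A →ₐ[ℂ] A')
    (h : ∀ x ∈ Γ.ideal.toIdeal, (Omega.ext f Γ').toAlgHom x = 0) : DiffHom Γ Γ' where
  toAlgHom := surjLift _ (Omega.ext_id_surjective Γ) (Omega.ext f Γ').toAlgHom
    fun x hx => h x ((Γ.mem_ideal x).2 hx)
  map_d x := by
    obtain ⟨x, rfl⟩ := Omega.ext_id_surjective Γ x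
    rw [← DiffHom.map_d, surjLift_apply, surjLift_apply, DiffHom.map_d]
  map_gr n x hx := by
    obtain ⟨y, hy, rfl⟩ := Omega.ext_surjOn_gr Γ hx
    rw [surjLift_apply]
    exact (Omega.ext f Γ').map_gr n y hy

lemma DiffHom.ofIdeal_ext (Γ : DiffCalculus A) (Γ' : DiffCalculus A') (f : A →ₐ[ℂ] A')
    (h : ∀ x ∈ Γ.ideal.toIdeal, (Omega.ext f Γ').toAlgHom x = 0) (x : (Omega A).Carrier) :
    (DiffHom.ofIdeal Γ Γ' f h).toAlgHom ((Omega.ext (AlgHom.id ℂ A) Γ).toAlgHom x) =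
      (Omega.ext f Γ').toAlgHom x :=
  surjLift_apply _ _ _ _ x

lemma DiffHom.ofIdeal_ι (Γ : DiffCalculus A) (Γ' : DiffCalculus A') (f : A →ₐ[ℂ] A')
    (h : ∀ x ∈ Γ.ideal.toIdeal, (Omega.ext f Γ').toAlgHom x = 0) (a : A) :
    (DiffHom.ofIdeal Γ Γ' f h).toAlgHom (Γ.ι a) = Γ'.ι (f a) := by
  have := DiffHom.ofIdeal_ext Γ Γ' f h ((Omega A).ι a)
  rwa [Omega.ext_ι, Omega.ext_ι] at this

/-- Being generated by A and dA, a calculus is a quotient of Ω(A). Equal kernels make the induced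
map both well defined and injective. -/
lemma DiffCalculus.isomorphic_of_ideal_eq {Γ Γ' : DiffCalculus A} (h : Γ.ideal = Γ'.ideal) :
    Γ.Isomorphic Γ' := by
  refine ⟨DiffHom.ofIdeal Γ Γ' (AlgHom.id ℂ A) fun x hx => ?_, ⟨?_, ?_⟩,
    fun a => DiffHom.ofIdeal_ι _ _ _ _ a⟩
  · rw [h] at hx; exact (Γ'.mem_ideal x).1 hx
  · rw [injective_iff_map_eq_zero]
    intro x hx
    obtain ⟨x, rfl⟩ := Omega.ext_id_surjective Γ x
    rw [DiffHom.ofIdeal_ext] at hx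
    have : x ∈ Γ'.ideal.toIdeal := hx
    rwa [← h] at this
  · intro y
    obtain ⟨y, rfl⟩ := Omega.ext_id_surjective Γ' y
    exact ⟨_, DiffHom.ofIdeal_ext _ _ _ _ y⟩

lemma DiffCalculus.quot_ι (Γ : DiffCalculus A) (J : DiffIdeal Γ) (f : A →ₐ[ℂ] A')
    (hf : Function.Surjective f) (hJ : ∀ a, Γ.ι a ∈ J.toIdeal ↔ f a = 0) (a : A) :
    (Γ.quotMk J f hf hJ).toAlgHom (Γ.ι a) = (Γ.quot J f hf hJ).ι (f a) :=
  (quotι_apply Γ J f hf hJ a).symm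

lemma DiffCalculus.quotMk_eq_zero_iff (Γ : DiffCalculus A) (J : DiffIdeal Γ) (f : A →ₐ[ℂ] A')
    (hf : Function.Surjective f) (hJ : ∀ a, Γ.ι a ∈ J.toIdeal ↔ f a = 0) (x : Γ.Carrier) :
    (Γ.quotMk J f hf hJ).toAlgHom x = 0 ↔ x ∈ J.toIdeal :=
  Ideal.Quotient.eq_zero_iff_mem

lemma Omega.ext_eq_self (x : (Omega A).Carrier) :
    (Omega.ext (AlgHom.id ℂ A) (Omega A)).toAlgHom x = x := by
  have : OmegaAlg.ext (AlgHom.id ℂ A) (Omega A) = AlgHom.id ℂ (OmegaAlg A) := by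
    refine OmegaAlg.hom_ext (fun a => ?_) (fun a => ?_)
    · rw [OmegaAlg.ext_of]; rfl
    · rw [OmegaAlg.ext_del]; exact OmegaAlg.d_of a
  exact DFunLike.congr_fun this x

lemma Omega.ext_quot (J : DiffIdeal (Omega A))
    (hJ : ∀ a, (Omega A).ι a ∈ J.toIdeal ↔ AlgHom.id ℂ A a = 0) (x : (Omega A).Carrier) :
    (Omega.ext (AlgHom.id ℂ A) ((Omega A).quot J (AlgHom.id ℂ A) Function.surjective_id hJ)).toAlgHom
      x = ((Omega A).quotMk J (AlgHom.id ℂ A) Function.surjective_id hJ).toAlgHom x := by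
  have := ((Omega A).quotMk J (AlgHom.id ℂ A) Function.surjective_id hJ).map_ext
    (AlgHom.id ℂ A) (AlgHom.id ℂ A) (fun a => (Omega A).quot_ι J _ _ hJ a) x
  rw [← this, Omega.ext_eq_self]

/-- The canonical map onto Ω(A)/J is the quotient projection. Hence membership in a generated ideal
can be tested by computing in the factor calculus. -/
lemma Omega.mem_quot_ideal (J : DiffIdeal (Omega A))
    (hJ : ∀ a, (Omega A).ι a ∈ J.toIdeal ↔ AlgHom.id ℂ A a = 0) (x : (Omega A).Carrier) :
    x ∈ ((Omega A).quot J (AlgHom.id ℂ A) Function.surjective_id hJ).ideal.toIdeal ↔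
      x ∈ J.toIdeal := by
  rw [DiffCalculus.mem_ideal, Omega.ext_quot]
  exact (Omega A).quotMk_eq_zero_iff J _ _ hJ x

lemma DiffCalculus.d_algHom_mul (G : DiffCalculus A') (a b : A') :
    G.d (G.ι (a * b)) = G.d (G.ι a) * G.ι b + G.ι a * G.d (G.ι b) := by
  rw [map_mul, G.leibniz_zero]

lemma DiffCalculus.d_one (G : DiffCalculus A') : G.d 1 = 0 := by
  have := G.leibniz_zero 1 1
  simpa using this

/-- If `a` and `b` commute and `da` commutes with `b`, then `a` commutes with `db`. -/
lemma DiffCalculus.commute_d (G : DiffCalculus A') {a b : A'} (h : a * b = b * a)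
    (hd : G.d (G.ι a) * G.ι b = G.ι b * G.d (G.ι a)) :
    G.d (G.ι b) * G.ι a = G.ι a * G.d (G.ι b) := by
  -- Both sides of d(ab) = d(ba) contain da · b = b · da, which cancels.
  have h1 := congrArg (fun x => G.d (G.ι x)) h
  simp only [G.d_algHom_mul, hd] at h1
  rw [add_comm] at h1
  exact (add_right_cancel h1).symm

end General

/-! ## The universal property of the skew tensor product -/

section SkewUniversal

open GradedTensorProduct

variable {A B E : Type*} [Ring A] [Algebra ℂ A] [Ring B] [Algebra ℂ B] [Ring E] [Algebra ℂ E]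

/-- Induction along Ωⁿ⁺¹ = Ωⁿ · dA, where each factor da contributes one factor `s`. It is needed
for `s` equal to 1, -1 and (-1)ᵐ. -/
lemma OmegaAlg.smul_commute_of_mem_gr {C : Type*} [Ring C] [Algebra ℂ C] (g : OmegaAlg A →ₐ[ℂ] C)
    (c : C) (s : ℂ) (h0 : ∀ a, g (of A a) * c = c * g (of A a))
    (h1 : ∀ a, g (del A a) * c = s • (c * g (del A a))) (n : ℕ) (x : OmegaAlg A) (hx : x ∈ gr A n) :
    g x * c = s ^ n • (c * g x) := by
  induction n generalizing x with
  | zero =>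
    obtain ⟨a, rfl⟩ := hx
    simpa using h0 a
  | succ n ih =>
    refine Submodule.mul_induction_on (C := fun x => g x * c = s ^ (n + 1) • (c * g x)) hx ?_ ?_
    · rintro y hy _ ⟨b, rfl⟩
      rw [map_mul, mul_assoc, h1, mul_smul_comm, ← mul_assoc, ih y hy, smul_mul_assoc, smul_smul,
        mul_assoc, pow_succ, mul_comm s]
    · intro y z hy hz
      rw [map_add, add_mul, mul_add, hy, hz, smul_add]

variable (Γ : DiffCalculus A) (Δ : DiffCalculus B) (G : DiffCalculus E)

/-- Differentiating the two assumed commutation rules yields the ones between f(A) and dg(B) and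
between df(A) and dg(B). Commutation on generators then spreads to all degrees, first in `x` and
then in `y`. -/
lemma Omega.ext_graded_commute (f : A →ₐ[ℂ] E) (g : B →ₐ[ℂ] E) (h : ∀ a b, f a * g b = g b * f a)
    (hd : ∀ a b, G.d (G.ι (f a)) * G.ι (g b) = G.ι (g b) * G.d (G.ι (f a)))
    (m n : ℕ) (x : (Omega A).Carrier) (hx : x ∈ (Omega A).gr m) (y : (Omega B).Carrier)
    (hy : y ∈ (Omega B).gr n) :
    (Omega.ext f G).toAlgHom x * (Omega.ext g G).toAlgHom y =
      (-1 : ℂ) ^ (n * m) • ((Omega.ext g G).toAlgHom y * (Omega.ext f G).toAlgHom x) := by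
  have hι : ∀ a b, G.ι (f a) * G.ι (g b) = G.ι (g b) * G.ι (f a) := fun a b => by
    rw [← map_mul, h, map_mul]
  have hd' : ∀ a b, G.ι (f a) * G.d (G.ι (g b)) = G.d (G.ι (g b)) * G.ι (f a) := fun a b =>
    (G.commute_d (h a b) (hd a b)).symm
  have hdd : ∀ a b, G.d (G.ι (f a)) * G.d (G.ι (g b)) =
      (-1 : ℂ) • (G.d (G.ι (g b)) * G.d (G.ι (f a))) := by
    intro a b
    -- The left side gives -df(a) dg(b), the right side dg(b) df(a).
    have h1 := congrArg G.d (hd a b)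
    rw [G.leibniz 1 _ (G.dι_mem _), G.leibniz_zero, G.d_d] at h1
    simp only [zero_mul, zero_add, pow_one, mul_zero, add_zero] at h1
    rw [← h1, smul_smul]; simp
  have e0 : ∀ b, (Omega.ext f G).toAlgHom x * G.ι (g b) = G.ι (g b) * (Omega.ext f G).toAlgHom x := by
    intro b
    have := OmegaAlg.smul_commute_of_mem_gr (OmegaAlg.ext f G) (G.ι (g b)) 1
      (fun a => by rw [OmegaAlg.ext_of, hι]) (fun a => by rw [OmegaAlg.ext_del, hd, one_smul]) m x hx
    rw [one_pow, one_smul] at this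
    exact this
  have e1 : ∀ b, (Omega.ext f G).toAlgHom x * G.d (G.ι (g b)) =
      (-1 : ℂ) ^ m • (G.d (G.ι (g b)) * (Omega.ext f G).toAlgHom x) := fun b =>
    OmegaAlg.smul_commute_of_mem_gr (OmegaAlg.ext f G) (G.d (G.ι (g b))) (-1)
      (fun a => by rw [OmegaAlg.ext_of, hd']) (fun a => by rw [OmegaAlg.ext_del, hdd]) m x hx
  have hs : (-1 : ℂ) ^ m * (-1) ^ m = 1 := by rw [← mul_pow]; simp
  -- Second pass: the image of `x` is now the fixed element, and passing one dg(b) costs (-1)ᵐ.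
  have := OmegaAlg.smul_commute_of_mem_gr (OmegaAlg.ext g G) ((Omega.ext f G).toAlgHom x)
      ((-1) ^ m) (fun b => by rw [OmegaAlg.ext_of, e0])
      (fun b => by rw [OmegaAlg.ext_del, e1, smul_smul, hs, one_smul]) n y hy
  change (Omega.ext g G).toAlgHom y * (Omega.ext f G).toAlgHom x = _ •
    ((Omega.ext f G).toAlgHom x * (Omega.ext g G).toAlgHom y) at this
  rw [this, smul_smul, mul_comm n m, pow_mul, ← mul_pow, hs, one_pow, one_smul]

/-- The relations of `Γ ⊗̂ Δ` are those of `Γ`, those of `Δ` and the commutation of `A` and `dA` with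
`B`. -/
theorem skew_ideal_le (f : A ⊗[ℂ] B →ₐ[ℂ] E)
    (hA : ∀ x ∈ Γ.ideal.toIdeal,
      (Omega.ext (f.comp Algebra.TensorProduct.includeLeft) G).toAlgHom x = 0)
    (hB : ∀ x ∈ Δ.ideal.toIdeal,
      (Omega.ext (f.comp Algebra.TensorProduct.includeRight) G).toAlgHom x = 0)
    (hc : ∀ a b, G.d (G.ι (f (a ⊗ₜ 1))) * G.ι (f (1 ⊗ₜ b)) =
      G.ι (f (1 ⊗ₜ b)) * G.d (G.ι (f (a ⊗ₜ 1))))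
    (x : (Omega (A ⊗[ℂ] B)).Carrier) (hx : x ∈ (skew Γ Δ).ideal.toIdeal) :
    (Omega.ext f G).toAlgHom x = 0 := by
  let α := DiffHom.ofIdeal Γ G _ hA
  let β := DiffHom.ofIdeal Δ G _ hB
  have hα : ∀ a, α.toAlgHom (Γ.ι a) = G.ι (f (a ⊗ₜ 1)) := fun a => DiffHom.ofIdeal_ι _ _ _ hA a
  have hβ : ∀ b, β.toAlgHom (Δ.ι b) = G.ι (f (1 ⊗ₜ b)) := fun b => DiffHom.ofIdeal_ι _ _ _ hB b
  have hαβ : ∀ ⦃m n⦄ (a : Γ.gr m) (b : Δ.gr n), α.toAlgHom a * β.toAlgHom b =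
      (-1 : ℤˣ) ^ (n * m) • (β.toAlgHom b * α.toAlgHom a) := by
    rintro m n ⟨a, ha⟩ ⟨b, hb⟩
    obtain ⟨a, ha', rfl⟩ := Omega.ext_surjOn_gr Γ ha
    obtain ⟨b, hb', rfl⟩ := Omega.ext_surjOn_gr Δ hb
    simp only [α, β, DiffHom.ofIdeal_ext]
    rw [Omega.ext_graded_commute G (f.comp Algebra.TensorProduct.includeLeft)
      (f.comp Algebra.TensorProduct.includeRight) (fun a b => ?_) hc m n a ha' b hb']
    · rcases Nat.even_or_odd (n * m) with h | h
      · simp [h.neg_one_pow]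
      · simp [h.neg_one_pow, Units.smul_def]
    · simp [← map_mul]
  let F : SkewAlg Γ Δ →ₐ[ℂ] G.Carrier := GradedTensorProduct.lift Γ.gr Δ.gr α.toAlgHom β.toAlgHom hαβ
  have hF : ∀ a b, F (a ᵍ⊗ₜ[ℂ] b) = α.toAlgHom a * β.toAlgHom b := fun a b =>
    GradedTensorProduct.lift_tmul _ _ _ _ _ a b
  have hFι : ∀ z, F (skewι Γ Δ z) = G.ι (f z) := by
    intro z
    induction z using TensorProduct.induction_on with
    | zero => simp
    | add x y hx hy => simp only [map_add, hx, hy]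
    | tmul a b => rw [skewι_tmul, hF, hα, hβ, ← map_mul, ← map_mul]; simp
  have hFd : ∀ z, F (skewD Γ Δ (skewι Γ Δ z)) = G.d (G.ι (f z)) := by
    intro z
    induction z using TensorProduct.induction_on with
    | zero => simp
    | add x y hx hy => simp only [map_add, hx, hy]
    | tmul a b =>
      rw [skewι_tmul, skewD_tmul Γ Δ (Γ.ι_mem a), map_add, map_smul, hF, hF, α.map_d, β.map_d, hα, hβ,
        pow_zero, one_smul, ← G.leibniz_zero, ← map_mul, ← map_mul]
      simp
  let F' : (skew Γ Δ).Carrier →ₐ[ℂ] G.Carrier := F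
  -- Compatibility of `F` with d need not be verified on all of Γ ⊗̂ Δ: agreement on z and dz
  -- suffices, because these generate Ω(A ⊗ B).
  have key : F'.comp (OmegaAlg.ext (AlgHom.id ℂ _) (skew Γ Δ)) = OmegaAlg.ext f G := by
    refine OmegaAlg.hom_ext (fun z => ?_) (fun z => ?_)
    · rw [AlgHom.comp_apply, OmegaAlg.ext_of, OmegaAlg.ext_of]; exact hFι z
    · rw [AlgHom.comp_apply, OmegaAlg.ext_del, OmegaAlg.ext_del]; exact hFd z
  have e := DFunLike.congr_fun key x
  have h0 : (Omega.ext (AlgHom.id ℂ _) (skew Γ Δ)).toAlgHom x = 0 := hx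
  exact e.symm.trans ((congrArg F' h0).trans (map_zero F'))

/-- The inclusion `Γ → Γ ⊗̂ Δ`. -/
def skewInl : DiffHom Γ (skew Γ Δ) where
  toAlgHom := includeLeft Γ.gr Δ.gr
  map_d := by
    intro x
    refine Γ.gr_induction (p := fun x => (Γ.d x ᵍ⊗ₜ[ℂ] 1 : SkewAlg Γ Δ) =
      skewD Γ Δ (x ᵍ⊗ₜ[ℂ] 1)) ?_ (fun n x hx => ?_) (fun x y hx hy => ?_) x
    · rw [map_zero, zero_gtmul Γ Δ, map_zero]
    · rw [skewD_tmul Γ Δ hx, Δ.d_one, gtmul_zero, smul_zero, add_zero]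
    · have e : ∀ u v : Γ.Carrier, ((u + v) ᵍ⊗ₜ[ℂ] (1 : Δ.Carrier) : SkewAlg Γ Δ) =
          u ᵍ⊗ₜ[ℂ] 1 + v ᵍ⊗ₜ[ℂ] 1 := map_add (includeLeft Γ.gr Δ.gr)
      rw [map_add, e, e, map_add, hx, hy]
  map_gr n x hx := tmul_mem_skewGr (Γ := Γ) (Δ := Δ) (add_zero n) hx (SetLike.one_mem_graded Δ.gr)

/-- The inclusion `Δ → Γ ⊗̂ Δ`. -/
def skewInr : DiffHom Δ (skew Γ Δ) where
  toAlgHom := includeRight Γ.gr Δ.gr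
  map_d x := by
    change (1 ᵍ⊗ₜ[ℂ] Δ.d x : SkewAlg Γ Δ) = skewD Γ Δ (1 ᵍ⊗ₜ[ℂ] x)
    rw [skewD_tmul Γ Δ (SetLike.one_mem_graded Γ.gr), Γ.d_one, zero_gtmul Γ Δ, zero_add]
    simp
  map_gr n x hx := tmul_mem_skewGr (Γ := Γ) (Δ := Δ) (zero_add n) (SetLike.one_mem_graded Γ.gr) hx

lemma skewInl_ι (a : A) : (skewInl Γ Δ).toAlgHom (Γ.ι a) = (skew Γ Δ).ι (a ⊗ₜ 1) := by
  refine Eq.trans ?_ (skewι_tmul Γ Δ a 1).symm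
  rw [map_one]; rfl

lemma skewInr_ι (b : B) : (skewInr Γ Δ).toAlgHom (Δ.ι b) = (skew Γ Δ).ι (1 ⊗ₜ b) := by
  refine Eq.trans ?_ (skewι_tmul Γ Δ 1 b).symm
  rw [map_one]; rfl

/-- No sign occurs, because the form from the second factor has degree zero. -/
lemma skew_d_commute (a : A) (b : B) :
    (skew Γ Δ).d ((skew Γ Δ).ι (a ⊗ₜ 1)) * (skew Γ Δ).ι (1 ⊗ₜ b) =
      (skew Γ Δ).ι (1 ⊗ₜ b) * (skew Γ Δ).d ((skew Γ Δ).ι (a ⊗ₜ 1)) := by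
  rw [← skewInl_ι, ← skewInr_ι, ← DiffHom.map_d]
  change (Γ.d (Γ.ι a) ᵍ⊗ₜ[ℂ] (1 : Δ.Carrier) : SkewAlg Γ Δ) *
    ((1 : Γ.Carrier) ᵍ⊗ₜ[ℂ] Δ.ι b : SkewAlg Γ Δ) = ((1 : Γ.Carrier) ᵍ⊗ₜ[ℂ] Δ.ι b : SkewAlg Γ Δ) *
    (Γ.d (Γ.ι a) ᵍ⊗ₜ[ℂ] (1 : Δ.Carrier) : SkewAlg Γ Δ)
  rw [tmul_one_mul_one_tmul, skew_mul Γ Δ _ (Δ.ι_mem b) (Γ.dι_mem a)]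
  simp

end SkewUniversal

/-! ## Properties of the transition functions -/

section TransitionProperties

open Coalgebra

namespace LocTrivQPFB

variable {I B H : Type*} [Ring B] [Algebra ℂ B] [Ring H] [HopfAlgebra ℂ H]
  {Q : LocTrivQPFB I B H} {i j k l : I}

local infixl:70 " ⋇ " => copConv

/-- The homomorphism `id ⊗ ε`. -/
def counitRight (A H : Type*) [Ring A] [Algebra ℂ A] [Ring H] [HopfAlgebra ℂ H] :
    A ⊗[ℂ] H →ₐ[ℂ] A :=
  (Algebra.TensorProduct.rid ℂ ℂ A).toAlgHom.comp
    (Algebra.TensorProduct.map (AlgHom.id ℂ _) (Bialgebra.counitAlgHom ℂ H))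

lemma counitRight_tmul {A : Type*} [Ring A] [Algebra ℂ A] (a : A) (x : H) :
    counitRight A H (a ⊗ₜ x) = (counit x : ℂ) • a := by
  simp [counitRight]

/-- Colinearity of χ_k survives the restriction of coefficients from B_k to B_ij, since the coaction
touches only the H leg. -/
lemma χOv_coact (h : Q.J k ⊔ Q.J l = Q.J i ⊔ Q.J j) (f : Q.P) :
    (comul : H →ₗ[ℂ] H ⊗[ℂ] H).lTensor (Q.Bov i j) (χOv h f) =
      TensorProduct.assoc ℂ (Q.Bov i j) H H ((χOv h).toLinearMap.rTensor H (Q.coact f)) := by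
  have h1 : ∀ z : Q.Bl k ⊗[ℂ] H, (comul : H →ₗ[ℂ] H ⊗[ℂ] H).lTensor (Q.Bov i j) (resH h z) =
      (res h).toLinearMap.rTensor (H ⊗[ℂ] H) ((comul : H →ₗ[ℂ] H ⊗[ℂ] H).lTensor (Q.Bl k) z) := by
    intro z
    induction z using TensorProduct.induction_on with
    | zero => simp
    | add x y hx hy => simp only [map_add, hx, hy]
    | tmul a x => simp [resH]
  have h2 : ∀ w : Q.P ⊗[ℂ] H, (res h).toLinearMap.rTensor (H ⊗[ℂ] H)
      (TensorProduct.assoc ℂ (Q.Bl k) H H ((Q.χ k).toLinearMap.rTensor H w)) =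
      TensorProduct.assoc ℂ (Q.Bov i j) H H ((χOv h).toLinearMap.rTensor H w) := by
    intro w
    induction w using TensorProduct.induction_on with
    | zero => simp
    | add x y hx hy => simp only [map_add, hx, hy]
    | tmul p x =>
      simp only [LinearMap.rTensor_tmul, AlgHom.toLinearMap_apply]
      change _ = TensorProduct.assoc ℂ (Q.Bov i j) H H (resH h (Q.χ k p) ⊗ₜ x)
      induction Q.χ k p using TensorProduct.induction_on with
      | zero => simp
      | add x y hx hy => simp only [map_add, TensorProduct.add_tmul, hx, hy]
      | tmul a y => simp [resH]
  change (comul : H →ₗ[ℂ] H ⊗[ℂ] H).lTensor (Q.Bov i j) (resH h (Q.χ k f)) = _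
  rw [h1, Q.χ_coact, h2]

lemma χOv_ι (h : Q.J k ⊔ Q.J l = Q.J i ⊔ Q.J j) (b : B) :
    χOv h (Q.ι b) = Ideal.Quotient.mk _ b ⊗ₜ 1 := by
  change resH h (Q.χ k (Q.ι b)) = _
  rw [Q.χ_ι]
  simp [resH, res_mk]

variable [Finite I]

/-- All charts agree on the base: each sends ι(b) to the class of b tensored with 1. -/
lemma φ_tmul_one (h : Q.J k ⊔ Q.J l = Q.J i ⊔ Q.J j) (b : Q.Bov i j) : φ h (b ⊗ₜ 1) = b ⊗ₜ 1 := by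
  obtain ⟨b, rfl⟩ := Ideal.Quotient.mk_surjective b
  exact (congrArg (φ h) (χOv_ι (swap h) b)).symm.trans ((φ_χOv h _).trans (χOv_ι h b))

lemma φ_φ (h : Q.J k ⊔ Q.J l = Q.J i ⊔ Q.J j) (z : Q.Bov i j ⊗[ℂ] H) : φ (swap h) (φ h z) = z := by
  obtain ⟨f, rfl⟩ := χOv_surjective (swap h) z
  rw [φ_χOv]
  exact φ_χOv (swap h) f

lemma τ_apply (h : Q.J k ⊔ Q.J l = Q.J i ⊔ Q.J j) (x : H) :
    τ h x = counitRight _ H (φ (swap h) (1 ⊗ₜ x)) := rfl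

/-- The change of chart inherits colinearity from the two charts, as every element of B_ij ⊗ H comes
from P. -/
lemma φ_coact (h : Q.J k ⊔ Q.J l = Q.J i ⊔ Q.J j) (z : Q.Bov i j ⊗[ℂ] H) :
    (comul : H →ₗ[ℂ] H ⊗[ℂ] H).lTensor (Q.Bov i j) (φ h z) =
      TensorProduct.assoc ℂ _ H H ((φ h).toLinearMap.rTensor H
        ((TensorProduct.assoc ℂ _ H H).symm
          ((comul : H →ₗ[ℂ] H ⊗[ℂ] H).lTensor (Q.Bov i j) z))) := by
  obtain ⟨f, rfl⟩ := χOv_surjective (swap h) z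
  rw [φ_χOv, χOv_coact, χOv_coact, LinearEquiv.symm_apply_apply, ← LinearMap.comp_apply,
    ← LinearMap.rTensor_comp]
  congr 3
  ext f
  exact (φ_χOv h f).symm

/-- `φ_kl(1 ⊗ x) = ∑ τ_lk(x₁) ⊗ x₂`. -/
lemma φ_one_tmul (h : Q.J k ⊔ Q.J l = Q.J i ⊔ Q.J j) (x : H) :
    φ h (1 ⊗ₜ x) = (τ (swap h)).toLinearMap.rTensor H (comul x) := by
  -- Contract the middle leg of the colinearity identity with ε. The left side becomes φ_kl(1 ⊗ x);
  -- on the right, (id ⊗ ε) ∘ φ_kl acts on the first leg of Δ(x), and that is τ_lk.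
  have e := congrArg (TensorProduct.map (LinearMap.id : Q.Bov i j →ₗ[ℂ] Q.Bov i j)
    ((TensorProduct.lid ℂ H).toLinearMap ∘ₗ (counit : H →ₗ[ℂ] ℂ).rTensor H)) (φ_coact h (1 ⊗ₜ x))
  have h1 : ∀ z : Q.Bov i j ⊗[ℂ] H, TensorProduct.map (LinearMap.id : Q.Bov i j →ₗ[ℂ] Q.Bov i j)
      ((TensorProduct.lid ℂ H).toLinearMap ∘ₗ (counit : H →ₗ[ℂ] ℂ).rTensor H)
      ((comul : H →ₗ[ℂ] H ⊗[ℂ] H).lTensor (Q.Bov i j) z) = z := by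
    intro z
    induction z using TensorProduct.induction_on with
    | zero => simp
    | add x y hx hy => simp only [map_add, hx, hy]
    | tmul a y => simp
  have h2 : ∀ w : (Q.Bov i j ⊗[ℂ] H) ⊗[ℂ] H,
      TensorProduct.map (LinearMap.id : Q.Bov i j →ₗ[ℂ] Q.Bov i j)
      ((TensorProduct.lid ℂ H).toLinearMap ∘ₗ (counit : H →ₗ[ℂ] ℂ).rTensor H)
      (TensorProduct.assoc ℂ _ H H w) = (counitRight _ H).toLinearMap.rTensor H w := by
    intro w
    induction w using TensorProduct.induction_on with
    | zero => simp
    | add x y hx hy => simp only [map_add, hx, hy]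
    | tmul w y =>
      induction w using TensorProduct.induction_on with
      | zero => simp
      | add x y hx hy => simp only [map_add, TensorProduct.add_tmul, hx, hy]
      | tmul a z => simp [counitRight_tmul, TensorProduct.smul_tmul]
  rw [h1, h2] at e
  rw [e, LinearMap.lTensor_tmul]
  induction (comul x : H ⊗[ℂ] H) using TensorProduct.induction_on with
  | zero => simp
  | add x y hx hy => simp only [map_add, TensorProduct.tmul_add, hx, hy]
  | tmul y z => simp [τ_apply]

/-- The values of the transition functions are central. -/
lemma τ_central (h : Q.J k ⊔ Q.J l = Q.J i ⊔ Q.J j) (x : H) (b : Q.Bov i j) :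
    τ h x * b = b * τ h x := by
  have hb : counitRight _ H (φ (swap h) (b ⊗ₜ 1)) = b := by
    rw [φ_tmul_one, counitRight_tmul]; simp
  -- The homomorphism (id ⊗ ε) ∘ φ sends b ⊗ 1 to b, and b ⊗ 1 commutes with 1 ⊗ x.
  rw [τ_apply]
  conv_lhs => rw [← hb]
  conv_rhs => rw [← hb]
  rw [← map_mul, ← map_mul, ← map_mul, ← map_mul]
  simp

lemma counitRight_φ_tmul (h : Q.J k ⊔ Q.J l = Q.J i ⊔ Q.J j) (b : Q.Bov i j) (x : H) :
    counitRight _ H (φ (swap h) (b ⊗ₜ x)) = b * τ h x := by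
  have : b ⊗ₜ[ℂ] x = (b ⊗ₜ 1) * (1 ⊗ₜ x) := by simp
  rw [this, map_mul, map_mul, φ_tmul_one, counitRight_tmul, τ_apply]
  simp

/-- Evaluate φ_lk ∘ φ_kl = id at 1 ⊗ x and apply id ⊗ ε. -/
lemma τ_mul_τ (h : Q.J k ⊔ Q.J l = Q.J i ⊔ Q.J j) (x : H) :
    LinearMap.mul' ℂ _ (TensorProduct.map (τ (swap h)).toLinearMap (τ h).toLinearMap (comul x)) =
      (counit x : ℂ) • 1 := by
  have e := congrArg (counitRight (Q.Bov i j) H) (φ_φ h (1 ⊗ₜ x))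
  rw [counitRight_tmul, φ_one_tmul] at e
  rw [← e]
  induction (comul x : H ⊗[ℂ] H) using TensorProduct.induction_on with
  | zero => simp
  | add x y hx hy => simp only [map_add, hx, hy]
  | tmul y z => exact (counitRight_φ_tmul h (τ (swap h) y) z).symm

lemma τ_copConv_τ (h : Q.J k ⊔ Q.J l = Q.J i ⊔ Q.J j) :
    (τ h).toLinearMap ⋇ (τ (swap h)).toLinearMap = copOne H _ := by
  ext x
  rw [copConv_apply_of_commute _ _ (fun x y => τ_central h x _), τ_mul_τ, copOne_apply]

/-- `τ_lk = τ_kl ∘ S`. -/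
lemma τ_antipode (h : Q.J k ⊔ Q.J l = Q.J i ⊔ Q.J j) (x : H) :
    τ h (HopfAlgebra.antipode ℂ x) = τ (swap h) x := by
  -- By the antipode axiom τ_kl ∘ S inverts τ_kl; centrality makes the choice between the
  -- comultiplication and its opposite irrelevant. Uniqueness of inverses then identifies it with
  -- τ_lk.
  have h1 : ((τ h).toLinearMap ∘ₗ HopfAlgebra.antipode ℂ) ⋇ (τ h).toLinearMap = copOne H _ := by
    ext x
    rw [copConv_apply_of_commute _ _ (fun x y => τ_central h _ _), copOne_apply]
    have : ∀ z : H ⊗[ℂ] H, LinearMap.mul' ℂ _ (TensorProduct.map (τ h).toLinearMap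
        ((τ h).toLinearMap ∘ₗ HopfAlgebra.antipode ℂ) z) =
        τ h (LinearMap.mul' ℂ H ((HopfAlgebra.antipode ℂ).lTensor H z)) := by
      intro z
      induction z using TensorProduct.induction_on with
      | zero => simp
      | add x y hx hy => simp only [map_add, hx, hy]
      | tmul x y => simp
    rw [this, HopfAlgebra.mul_antipode_lTensor_comul_apply, AlgHom.commutes,
      Algebra.algebraMap_eq_smul_one]
  have h2 := eq_copConv_of_copConv_eq h1 (τ_copConv_τ h)
  rw [copConv_copOne] at h2
  exact (LinearMap.congr_fun h2 x).symm

variable (Q) in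
/-- The transition functions do not depend on the presentation of the ideal `J_k + J_l`. -/
lemma τ_eq_factor (h : Q.J k ⊔ Q.J l = Q.J i ⊔ Q.J j) (x : H) :
    τ h x = Ideal.Quotient.factorₐ ℂ h.le (τ (Q.ov k l) x) := by
  let T : Q.Bov k l →ₐ[ℂ] Q.Bov i j := Ideal.Quotient.factorₐ ℂ h.le
  have h1 : ∀ (m n : I) (e : Q.J m ⊔ Q.J n = Q.J k ⊔ Q.J l) (f : Q.P),
      Algebra.TensorProduct.map T (AlgHom.id ℂ H) (χOv e f) = χOv (e.trans h) f := by
    intro m n e f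
    change Algebra.TensorProduct.map T (AlgHom.id ℂ H) (resH e (Q.χ m f)) =
      resH (e.trans h) (Q.χ m f)
    induction Q.χ m f using TensorProduct.induction_on with
    | zero => simp
    | add x y hx hy => simp only [map_add, hx, hy]
    | tmul a y =>
      obtain ⟨b, rfl⟩ := Ideal.Quotient.mk_surjective a
      simp only [resH, Algebra.TensorProduct.map_tmul, res_mk]
      rfl
  have h2 : ∀ z, φ (swap h) (Algebra.TensorProduct.map T (AlgHom.id ℂ H) z) =
      Algebra.TensorProduct.map T (AlgHom.id ℂ H) (φ (swap (Q.ov k l)) z) := by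
    intro z
    obtain ⟨f, rfl⟩ := χOv_surjective (Q.ov k l) z
    rw [h1, φ_χOv (swap (Q.ov k l)) f, h1]
    exact φ_χOv (swap h) f
  have h3 : ∀ z, counitRight _ H (Algebra.TensorProduct.map T (AlgHom.id ℂ H) z) =
      T (counitRight _ H z) := by
    intro z
    induction z using TensorProduct.induction_on with
    | zero => simp
    | add x y hx hy => simp only [map_add, hx, hy]
    | tmul a y => simp [counitRight_tmul]
  have h4 := h2 (1 ⊗ₜ x)
  rw [Algebra.TensorProduct.map_tmul, map_one] at h4
  rw [τ_apply, τ_apply]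
  exact (congrArg _ h4).trans (h3 _)

/-- Condition (*) is given with J_k + J_l as the ideal of the overlap. The passage to the equal
ideal J_i + J_j acts only on the first leg and so keeps the second one in R. -/
lemma TransitionInvariant.rTensor_mem {R : Submodule ℂ H} (hQ : Q.TransitionInvariant R)
    (h : Q.J k ⊔ Q.J l = Q.J i ⊔ Q.J j) {r : H} (hr : r ∈ R) :
    (τ h).toLinearMap.rTensor H (adMap r) ∈ LinearMap.range (R.subtype.lTensor (Q.Bov i j)) := by
  let T : Q.Bov k l →ₐ[ℂ] Q.Bov i j := Ideal.Quotient.factorₐ ℂ h.le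
  have hT : (τ h).toLinearMap = T.toLinearMap ∘ₗ (τ (Q.ov k l)).toLinearMap :=
    LinearMap.ext fun x => τ_eq_factor Q h x
  obtain ⟨z, hz⟩ := hQ k l r hr
  refine ⟨T.toLinearMap.rTensor R z, ?_⟩
  rw [hT, LinearMap.rTensor_comp, LinearMap.comp_apply, ← hz, ← LinearMap.comp_apply,
    ← LinearMap.comp_apply, LinearMap.lTensor_comp_rTensor, LinearMap.rTensor_comp_lTensor]

end LocTrivQPFB

end TransitionProperties

/-! ## Transformation of the generating forms -/

section Transformation

open Coalgebra

local infixl:70 " ⋇ " => copConv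

/-! ### The form η_γ of a homomorphism γ out of H -/

section

variable {A H : Type*} [Ring A] [Algebra ℂ A] [Ring H] [HopfAlgebra ℂ H] (G : DiffCalculus A)

/-- The Leibniz rule, without signs because both factors have degree zero. -/
lemma DiffCalculus.d_copConv (f g : H →ₗ[ℂ] A) :
    G.d ∘ₗ ((G.ι.toLinearMap ∘ₗ f) ⋇ (G.ι.toLinearMap ∘ₗ g)) =
      (G.d ∘ₗ G.ι.toLinearMap ∘ₗ f) ⋇ (G.ι.toLinearMap ∘ₗ g) +
        (G.ι.toLinearMap ∘ₗ f) ⋇ (G.d ∘ₗ G.ι.toLinearMap ∘ₗ g) := by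
  ext x
  simp only [LinearMap.comp_apply, LinearMap.add_apply, copConv_apply]
  induction TensorProduct.comm ℂ H H (comul x) using TensorProduct.induction_on with
  | zero => simp
  | add x y hx hy => simp only [map_add, hx, hy]; abel
  | tmul x y => simp [G.leibniz_zero]

/-- η itself is the convolution S⁻¹ ⋇ d in Ω(H), and the differential extension of `γ` respects
products and d. -/
lemma ext_comp_ηΩ (hS : Function.Bijective (HopfAlgebra.antipode ℂ : H →ₗ[ℂ] H)) (γ : H →ₐ[ℂ] A) :
    (Omega.ext γ G).toAlgHom.toLinearMap ∘ₗ ηΩ hS =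
      ((G.ι.comp γ).toLinearMap ∘ₗ antipodeInv hS) ⋇ (G.d ∘ₗ (G.ι.comp γ).toLinearMap) := by
  refine (map_copConv (Omega.ext γ G).toAlgHom _ _).trans ?_
  congr 1
  · ext x
    exact Omega.ext_ι γ G _
  · ext x
    exact Omega.ext_dι γ G x

/-- The differential is recovered from the forms `η`: `dγ(x) = ∑ γ(x₂) η_γ(x₁)`. -/
lemma copConv_ext_ηΩ (hS : Function.Bijective (HopfAlgebra.antipode ℂ : H →ₗ[ℂ] H))
    (γ : H →ₐ[ℂ] A) :
    (G.ι.comp γ).toLinearMap ⋇ ((Omega.ext γ G).toAlgHom.toLinearMap ∘ₗ ηΩ hS) =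
      G.d ∘ₗ (G.ι.comp γ).toLinearMap := by
  rw [ext_comp_ηΩ, ← copConv_assoc, copConv_antipodeInv, copOne_copConv]

/-- η_γ(x) is a sum of products of an element of γ(H) and one of dγ(H). -/
lemma commute_ext_ηΩ (hS : Function.Bijective (HopfAlgebra.antipode ℂ : H →ₗ[ℂ] H))
    (γ : H →ₐ[ℂ] A) (c : G.Carrier) (h0 : ∀ y, G.ι (γ y) * c = c * G.ι (γ y))
    (h1 : ∀ y, G.d (G.ι (γ y)) * c = c * G.d (G.ι (γ y))) (x : H) :
    (Omega.ext γ G).toAlgHom (ηΩ hS x) * c = c * (Omega.ext γ G).toAlgHom (ηΩ hS x) := by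
  have e := LinearMap.congr_fun (ext_comp_ηΩ G hS γ) x
  rw [LinearMap.comp_apply, AlgHom.toLinearMap_apply] at e
  rw [e, copConv_apply]
  induction TensorProduct.comm ℂ H H (comul x) using TensorProduct.induction_on with
  | zero => simp
  | add x y hx hy => simp only [map_add, add_mul, mul_add, hx, hy]
  | tmul x y =>
    simp only [TensorProduct.map_tmul, LinearMap.mul'_apply, LinearMap.comp_apply,
      AlgHom.toLinearMap_apply, AlgHom.comp_apply]
    rw [mul_assoc, h1, ← mul_assoc, h0, mul_assoc]

end

namespace LocTrivQPFB

variable {I B H : Type*} [Finite I] [Ring B] [Algebra ℂ B] [Ring H] [HopfAlgebra ℂ H]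
  {Q : LocTrivQPFB I B H} {i j k l : I}

/-- If `F` vanishes on `R` and the transition functions are compatible with `R`, then
`r ↦ ∑ τ_kl(r₃) F(r₂) τ_lk(r₁)` vanishes on `R`. -/
lemma copConv_conj_eq_zero {R : Submodule ℂ H} (hQ : Q.TransitionInvariant R)
    (h : Q.J k ⊔ Q.J l = Q.J i ⊔ Q.J j) {C : Type*} [Ring C] [Algebra ℂ C]
    (g : Q.Bov i j →ₐ[ℂ] C) (F : H →ₗ[ℂ] C)
    (hF : ∀ x y, F x * g (τ (swap h) y) = g (τ (swap h) y) * F x)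
    (hFR : ∀ r ∈ R, F r = 0) {r : H} (hr : r ∈ R) :
    ((g.comp (τ h)).toLinearMap ⋇ (F ⋇ (g.comp (τ (swap h))).toLinearMap)) r = 0 := by
  have key : ((g.comp (τ h)).toLinearMap ⋇ (F ⋇ (g.comp (τ (swap h))).toLinearMap)) r =
      LinearMap.mul' ℂ C (TensorProduct.map g.toLinearMap F
        ((τ h).toLinearMap.rTensor H (adMap r))) := by
    rw [← copConv_assoc, copConv_apply]
    simp only [adMap, LinearMap.comp_apply, LinearEquiv.coe_coe]
    induction (comul r : H ⊗[ℂ] H) using TensorProduct.induction_on with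
    | zero => simp
    | add x y hx hy => simp only [map_add, hx, hy]
    | tmul x y =>
      rw [TensorProduct.comm_tmul, TensorProduct.map_tmul, LinearMap.mul'_apply, copConv_apply,
        LinearMap.lTensor_tmul]
      induction (comul y : H ⊗[ℂ] H) using TensorProduct.induction_on with
      | zero => simp
      | add u v hu hv => simp only [map_add, add_mul, TensorProduct.tmul_add, hu, hv]
      | tmul u v =>
        simp only [TensorProduct.comm_tmul, TensorProduct.map_tmul, LinearMap.mul'_apply,
          LinearMap.lTensor_tmul, LinearEquiv.coe_coe, TensorProduct.assoc_symm_tmul,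
          LinearMap.rTensor_tmul, LinearMap.comp_apply, AlgHom.toLinearMap_apply,
          AlgHom.comp_apply, map_mul, τ_antipode]
        -- The factor τ_lk(r₁) = τ_kl(S(r₁)) moves left past F(r₂), and centrality puts it in front
        -- of τ_kl(r₃); together they form τ_kl(S(r₁) r₃).
        rw [mul_assoc, hF, ← mul_assoc, ← map_mul, ← map_mul, τ_central]
  -- By (*) the second leg may be taken in R, where F vanishes.
  obtain ⟨z, hz⟩ := hQ.rTensor_mem h hr
  rw [key, ← hz]
  clear hz key
  induction z using TensorProduct.induction_on with
  | zero => simp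
  | add x y hx hy => simp only [map_add, hx, hy, add_zero]
  | tmul b r => simp [hFR r r.2]

/-! ### Differentiating the change of chart -/

section

variable (h : Q.J k ⊔ Q.J l = Q.J i ⊔ Q.J j) (G : DiffCalculus (Q.Bov i j ⊗[ℂ] H))

/-- The restriction of `φ_kl` to `H`. -/
def φH : H →ₐ[ℂ] Q.Bov i j ⊗[ℂ] H := (φ h).comp Algebra.TensorProduct.includeRight

/-- B_ij ⊗ 1 and 1 ⊗ H commute, so ∑ τ_lk(x₁) ⊗ x₂ is also a convolution for the opposite
comultiplication. This form allows cancelling the embedding of H. -/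
lemma φH_eq : (G.ι.comp (φH h)).toLinearMap =
    (G.ι.comp Algebra.TensorProduct.includeRight).toLinearMap ⋇
      (G.ι.comp (Algebra.TensorProduct.includeLeft.comp (τ (swap h)))).toLinearMap := by
  ext x
  rw [copConv_apply_of_commute]
  · change G.ι (φ h (1 ⊗ₜ x)) = _
    rw [φ_one_tmul]
    induction (comul x : H ⊗[ℂ] H) using TensorProduct.induction_on with
    | zero => simp
    | add x y hx hy => simp only [map_add, hx, hy]
    | tmul x y => simp [← map_mul]
  · intro x y
    simp [← map_mul]

lemma d_φH_eq : G.d ∘ₗ (G.ι.comp (φH h)).toLinearMap =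
    (G.d ∘ₗ (G.ι.comp Algebra.TensorProduct.includeRight).toLinearMap) ⋇
      (G.ι.comp (Algebra.TensorProduct.includeLeft.comp (τ (swap h)))).toLinearMap +
    (G.ι.comp Algebra.TensorProduct.includeRight).toLinearMap ⋇
      (G.d ∘ₗ (G.ι.comp (Algebra.TensorProduct.includeLeft.comp (τ (swap h)))).toLinearMap) := by
  rw [φH_eq]
  exact G.d_copConv Algebra.TensorProduct.includeRight.toLinearMap
    (Algebra.TensorProduct.includeLeft.comp (τ (swap h))).toLinearMap

/-- Expand dφ by the Leibniz rule and take the commutator with b. The dx part drops out, since dx, x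
and τ_lk all commute with b, leaving the embedding of H convolved with [dτ_lk, b]. The embedding is
invertible, so one commutator vanishes exactly when the other does. -/
lemma d_φH_commutator
    (hc : ∀ (b : Q.Bov i j) (x : H), G.d (G.ι (b ⊗ₜ 1)) * G.ι (1 ⊗ₜ x) =
      G.ι (1 ⊗ₜ x) * G.d (G.ι (b ⊗ₜ 1)))
    (hS : Function.Bijective (HopfAlgebra.antipode ℂ : H →ₗ[ℂ] H))
    (b : Q.Bov i j) :
    (∀ x, G.d (G.ι (φH h x)) * G.ι (b ⊗ₜ 1) = G.ι (b ⊗ₜ 1) * G.d (G.ι (φH h x))) ↔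
      ∀ x, G.d (G.ι (τ (swap h) x ⊗ₜ 1)) * G.ι (b ⊗ₜ 1) =
        G.ι (b ⊗ₜ 1) * G.d (G.ι (τ (swap h) x ⊗ₜ 1)) := by
  let c : G.Carrier →ₗ[ℂ] G.Carrier :=
    (LinearMap.mul ℂ G.Carrier).flip (G.ι (b ⊗ₜ 1)) - LinearMap.mul ℂ G.Carrier (G.ι (b ⊗ₜ 1))
  have hcb : ∀ y, c y = y * G.ι (b ⊗ₜ 1) - G.ι (b ⊗ₜ 1) * y := fun y => rfl
  have e : c ∘ₗ G.d ∘ₗ (G.ι.comp (φH h)).toLinearMap =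
      (G.ι.comp Algebra.TensorProduct.includeRight).toLinearMap ⋇ (c ∘ₗ
      (G.d ∘ₗ (G.ι.comp (Algebra.TensorProduct.includeLeft.comp (τ (swap h)))).toLinearMap)) := by
    rw [d_φH_eq]
    ext x
    simp only [LinearMap.comp_apply, LinearMap.add_apply, copConv_apply]
    induction TensorProduct.comm ℂ H H (comul x) using TensorProduct.induction_on with
    | zero => simp
    | add x y hx hy =>
      simp only [map_add] at hx hy ⊢
      rw [← hx, ← hy]; abel
    | tmul x y =>
      have h1 : G.d (G.ι (1 ⊗ₜ x)) * G.ι (b ⊗ₜ 1) = G.ι (b ⊗ₜ 1) * G.d (G.ι (1 ⊗ₜ x)) :=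
        G.commute_d (by simp) (hc b x)
      have h2 : G.ι (τ (swap h) y ⊗ₜ 1) * G.ι (b ⊗ₜ 1) = G.ι (b ⊗ₜ 1) * G.ι (τ (swap h) y ⊗ₜ 1) := by
        rw [← map_mul, ← map_mul]; simp [τ_central]
      have h3 : G.ι (1 ⊗ₜ x) * G.ι (b ⊗ₜ 1) = G.ι (b ⊗ₜ 1) * G.ι (1 ⊗ₜ x) := by
        rw [← map_mul, ← map_mul]; simp
      simp only [TensorProduct.map_tmul, LinearMap.mul'_apply, LinearMap.comp_apply,
        AlgHom.toLinearMap_apply, AlgHom.comp_apply, hcb,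
        Algebra.TensorProduct.includeLeft_apply, Algebra.TensorProduct.includeRight_apply]
      have e1 : G.d (G.ι (1 ⊗ₜ x)) * G.ι (τ (swap h) y ⊗ₜ 1) * G.ι (b ⊗ₜ 1) =
          G.ι (b ⊗ₜ 1) * (G.d (G.ι (1 ⊗ₜ x)) * G.ι (τ (swap h) y ⊗ₜ 1)) := by
        rw [mul_assoc, h2, ← mul_assoc, h1, mul_assoc]
      have e3 : G.ι (b ⊗ₜ 1) * (G.ι (1 ⊗ₜ x) * G.d (G.ι (τ (swap h) y ⊗ₜ 1))) =
          G.ι (1 ⊗ₜ x) * (G.ι (b ⊗ₜ 1) * G.d (G.ι (τ (swap h) y ⊗ₜ 1))) := by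
        rw [← mul_assoc, ← h3, mul_assoc]
      rw [add_mul, mul_add, e1, e3, mul_sub, mul_assoc]
      abel
  constructor
  · intro hx x
    have h0 : c ∘ₗ G.d ∘ₗ (G.ι.comp (φH h)).toLinearMap = 0 := by
      ext x
      exact sub_eq_zero.2 (hx x)
    rw [h0, ← copConv_zero (G.ι.comp Algebra.TensorProduct.includeRight).toLinearMap] at e
    exact sub_eq_zero.1
      (LinearMap.congr_fun (copConv_cancel_left (antipodeInv_copConv hS _) e) x).symm
  · intro hx x
    have h0 : c ∘ₗ (G.d ∘ₗ
        (G.ι.comp (Algebra.TensorProduct.includeLeft.comp (τ (swap h)))).toLinearMap) = 0 := by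
      ext x
      exact sub_eq_zero.2 (hx x)
    rw [h0, copConv_zero] at e
    exact sub_eq_zero.1 (LinearMap.congr_fun e x)

/-- Under `φ_kl`, the form `η(r)`, `r ∈ R`, becomes `-∑ τ_lk(r₁) dτ_kl(r₂)`. -/
lemma ext_φH_ηΩ
    (hc : ∀ (b : Q.Bov i j) (x : H), G.d (G.ι (b ⊗ₜ 1)) * G.ι (1 ⊗ₜ x) =
      G.ι (1 ⊗ₜ x) * G.d (G.ι (b ⊗ₜ 1)))
    (hS : Function.Bijective (HopfAlgebra.antipode ℂ : H →ₗ[ℂ] H))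
    {R : Submodule ℂ H} (hQ : Q.TransitionInvariant R)
    (hτ : ∀ x b, G.d (G.ι (τ (swap h) x ⊗ₜ 1)) * G.ι (b ⊗ₜ 1) =
        G.ι (b ⊗ₜ 1) * G.d (G.ι (τ (swap h) x ⊗ₜ 1)))
    (hR : ∀ r ∈ R, (Omega.ext Algebra.TensorProduct.includeRight G).toAlgHom (ηΩ hS r) = 0)
    {r : H} (hr : r ∈ R) :
    (Omega.ext (φH h) G).toAlgHom (ηΩ hS r) = -(Omega.ext Algebra.TensorProduct.includeLeft
      G).toAlgHom (LinearMap.mul' ℂ (Omega (Q.Bov i j)).Carrier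
        (TensorProduct.map ((Omega (Q.Bov i j)).ι.toLinearMap ∘ₗ (τ (swap h)).toLinearMap)
          ((Omega (Q.Bov i j)).d ∘ₗ (Omega (Q.Bov i j)).ι.toLinearMap ∘ₗ (τ h).toLinearMap)
          (comul r))) := by
  let gB : Q.Bov i j →ₐ[ℂ] G.Carrier := G.ι.comp Algebra.TensorProduct.includeLeft
  let gH : H →ₐ[ℂ] G.Carrier := G.ι.comp Algebra.TensorProduct.includeRight
  let T : H →ₗ[ℂ] G.Carrier := (gB.comp (τ h)).toLinearMap
  let T' : H →ₗ[ℂ] G.Carrier := (gB.comp (τ (swap h))).toLinearMap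
  let η := (Omega.ext Algebra.TensorProduct.includeRight G).toAlgHom.toLinearMap ∘ₗ ηΩ hS
  let ηφ := (Omega.ext (φH h) G).toAlgHom.toLinearMap ∘ₗ ηΩ hS
  have hT : T ⋇ T' = copOne H _ := by
    have := congrArg (fun f => gB.toLinearMap ∘ₗ f) (τ_copConv_τ h)
    simp only [map_copConv, map_copOne] at this
    exact this
  -- Both sides equal dφ_kl on H: the left one as φ ⋇ η_φ, the right one by the Leibniz rule for φ =
  -- gH ⋇ T' together with d gH = gH ⋇ η.
  have h1 : gH.toLinearMap ⋇ (T' ⋇ ηφ) = gH.toLinearMap ⋇ (η ⋇ T' + G.d ∘ₗ T') := by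
    rw [← copConv_assoc, copConv_add, ← copConv_assoc]
    have e1 : gH.toLinearMap ⋇ T' = (G.ι.comp (φH h)).toLinearMap := (φH_eq h G).symm
    have e2 : gH.toLinearMap ⋇ η = G.d ∘ₗ gH.toLinearMap := copConv_ext_ηΩ G hS _
    have e3 : (G.ι.comp (φH h)).toLinearMap ⋇ ηφ = G.d ∘ₗ (G.ι.comp (φH h)).toLinearMap :=
      copConv_ext_ηΩ G hS _
    rw [e1, e2, e3]
    exact d_φH_eq h G
  have h2 : ηφ = T ⋇ (η ⋇ T') + T ⋇ (G.d ∘ₗ T') := by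
    rw [← copConv_add]
    exact eq_copConv_of_copConv_eq hT (copConv_cancel_left (antipodeInv_copConv hS gH) h1)
  -- Here (*) enters: this is ∑ τ_kl(S(r₁) r₃) η(r₂), and η vanishes on R.
  have h3 : (T ⋇ (η ⋇ T')) r = 0 := by
    refine copConv_conj_eq_zero hQ h gB η (fun x y => ?_) hR hr
    refine commute_ext_ηΩ G hS _ _ (fun z => ?_) (fun z => ?_) x
    · simp [gB, ← map_mul]
    · exact G.commute_d (by simp) (hc _ z)
  have h4 : ηφ r = (T ⋇ (G.d ∘ₗ T')) r := by
    rw [h2, LinearMap.add_apply, h3, zero_add]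
  refine h4.trans ?_
  rw [copConv_apply_of_commute _ _ (fun x y => (hτ y (τ h x)).symm)]
  rw [eq_neg_iff_add_eq_zero]
  -- Differentiating ∑ τ_lk(r₁) τ_kl(r₂) = ε(r) exchanges dτ_lk · τ_kl for -τ_lk · dτ_kl.
  have h5 : G.d (gB (LinearMap.mul' ℂ _ (TensorProduct.map (τ (swap h)).toLinearMap
      (τ h).toLinearMap (comul r)))) = 0 := by
    rw [τ_mul_τ, map_smul, map_one, map_smul, G.d_one, smul_zero]
  rw [← h5]
  induction (comul r : H ⊗[ℂ] H) using TensorProduct.induction_on with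
  | zero => simp
  | add x y hx hy => simp only [map_add, ← hx, ← hy]; abel
  | tmul x y =>
    simp only [TensorProduct.map_tmul, LinearMap.mul'_apply, LinearMap.comp_apply, map_mul,
      AlgHom.toLinearMap_apply, Omega.ext_ι, Omega.ext_dι]
    exact (G.leibniz_zero _ _).symm

end

end LocTrivQPFB

end Transformation

/-! ## The calculi on the overlaps -/

section Overlaps

open Coalgebra

local infixl:70 " ⋇ " => copConv

namespace LocTrivQPFB

variable {I B H : Type*} [Ring B] [Algebra ℂ B] [Ring H] [HopfAlgebra ℂ H]

/-- Forms on P lift to Ω(P), and J(P) lies in every chart kernel, so the kernel of χ_l may be taken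
in Ω(P). -/
lemma mem_idealOv {Q : LocTrivQPFB I B H} (Γ : ∀ i, DiffCalculus (Q.Bl i)) (ΓH : DiffCalculus H)
    (k l : I) (y : (Omega Q.P).Carrier) :
    (Q.χΩΓ Γ ΓH k).toAlgHom y ∈ (Q.idealOv Γ ΓH k l).toIdeal ↔
      ∃ z, (Q.χΩΓ Γ ΓH l).toAlgHom z = 0 ∧
        (Q.χΩΓ Γ ΓH k).toAlgHom z = (Q.χΩΓ Γ ΓH k).toAlgHom y := by
  constructor
  · rintro ⟨ω, hω, hy⟩
    obtain ⟨z, rfl⟩ := Ideal.Quotient.mkₐ_surjective ℂ (Q.idealP Γ ΓH).toIdeal ω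
    exact ⟨z, hω, hy⟩
  · rintro ⟨z, hz, hy⟩
    exact ⟨Ideal.Quotient.mkₐ ℂ (Q.idealP Γ ΓH).toIdeal z, hz, hy⟩

/-- Used twice: for m = k with the restriction B_k ⊗ H → B_ij ⊗ H, and for m = l with φ_kl after the
restriction. In each case a calculus on the overlap kills the kernel of the chart as soon as it
satisfies the relations of that chart's skew product. -/
lemma ext_χOv_eq_zero {Q : LocTrivQPFB I B H} {i j k l : I} (Γ : ∀ i, DiffCalculus (Q.Bl i))
    (ΓH : DiffCalculus H) (m : I) (h : Q.J k ⊔ Q.J l = Q.J i ⊔ Q.J j)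
    (G : DiffCalculus (Q.Bov i j ⊗[ℂ] H)) (f : Q.Bl m ⊗[ℂ] H →ₐ[ℂ] Q.Bov i j ⊗[ℂ] H)
    (hf : f.comp (Q.χ m) = χOv h)
    (hA : ∀ x ∈ (Γ m).ideal.toIdeal,
      (Omega.ext (f.comp Algebra.TensorProduct.includeLeft) G).toAlgHom x = 0)
    (hB : ∀ x ∈ ΓH.ideal.toIdeal,
      (Omega.ext (f.comp Algebra.TensorProduct.includeRight) G).toAlgHom x = 0)
    (hc : ∀ a b, G.d (G.ι (f (a ⊗ₜ 1))) * G.ι (f (1 ⊗ₜ b)) =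
      G.ι (f (1 ⊗ₜ b)) * G.d (G.ι (f (a ⊗ₜ 1))))
    (z : (Omega Q.P).Carrier) (hz : (Q.χΩΓ Γ ΓH m).toAlgHom z = 0) :
    (Omega.ext (χOv h) G).toAlgHom z = 0 := by
  rw [← hf, ← Omega.ext_ext]
  refine skew_ideal_le (Γ m) ΓH G f hA hB hc _ ?_
  rw [DiffCalculus.mem_ideal, Omega.ext_ext]
  exact hz

variable [Finite I] {Q : LocTrivQPFB I B H} (Γ : ∀ i, DiffCalculus (Q.Bl i))
  {i j k l : I}

/-! ### The relations of both charts in Γᵏ(B_ij ⊗ H) -/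

section

variable (ΓH : DiffCalculus H)

/-- The canonical projection `Γ(B_k) ⊗̂ Γ(H) → Γᵏ(B_ij ⊗ H)`. -/
def ovMk (h : Q.J k ⊔ Q.J l = Q.J i ⊔ Q.J j) : DiffHom (skew (Γ k) ΓH) (calcOv Γ ΓH k l h) :=
  (skew (Γ k) ΓH).quotMk (Q.idealOv Γ ΓH k l) (resH h) (resH_surjective h) (ι_mem_idealOv Γ ΓH h)

lemma ovMk_ι (h : Q.J k ⊔ Q.J l = Q.J i ⊔ Q.J j) (z : Q.Bl k ⊗[ℂ] H) :
    (ovMk Γ ΓH h).toAlgHom ((skew (Γ k) ΓH).ι z) = (calcOv Γ ΓH k l h).ι (resH h z) :=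
  (skew (Γ k) ΓH).quot_ι _ _ _ _ z

lemma ext_χOv_calcOv (h : Q.J k ⊔ Q.J l = Q.J i ⊔ Q.J j) (y : (Omega Q.P).Carrier) :
    (Omega.ext (χOv h) (calcOv Γ ΓH k l h)).toAlgHom y =
      (ovMk Γ ΓH h).toAlgHom ((Q.χΩΓ Γ ΓH k).toAlgHom y) :=
  ((ovMk Γ ΓH h).map_ext (Q.χ k) (χOv h) (fun f => ovMk_ι Γ ΓH h (Q.χ k f)) y).symm

/-- Writing y = (y - z) + z, the right-hand condition says that y lies in the sum of the two chart
kernels. This symmetric description is why chart l counts as much as chart k. -/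
lemma ext_χOv_calcOv_eq_zero_iff (h : Q.J k ⊔ Q.J l = Q.J i ⊔ Q.J j) (y : (Omega Q.P).Carrier) :
    (Omega.ext (χOv h) (calcOv Γ ΓH k l h)).toAlgHom y = 0 ↔
      ∃ z, (Q.χΩΓ Γ ΓH l).toAlgHom z = 0 ∧
        (Q.χΩΓ Γ ΓH k).toAlgHom z = (Q.χΩΓ Γ ΓH k).toAlgHom y := by
  rw [ext_χOv_calcOv, ← mem_idealOv]
  exact (skew (Γ k) ΓH).quotMk_eq_zero_iff _ _ _ _ _

/-- The homomorphism `Γ(B_l) ⊗̂ Γ(H) → Γᵏ(B_ij ⊗ H)` that extends `φ_kl`. -/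
lemma exists_skew_calcOv (h : Q.J k ⊔ Q.J l = Q.J i ⊔ Q.J j) :
    ∃ F : DiffHom (skew (Γ l) ΓH) (calcOv Γ ΓH k l h), ∀ z,
      F.toAlgHom ((skew (Γ l) ΓH).ι z) = (calcOv Γ ΓH k l h).ι (φ h (resH (swap h) z)) := by
  have key : ∀ x ∈ (skew (Γ l) ΓH).ideal.toIdeal,
      (Omega.ext ((φ h).comp (resH (swap h))) (calcOv Γ ΓH k l h)).toAlgHom x = 0 := by
    intro x hx
    obtain ⟨y, rfl⟩ := Omega.ext_surjective (Q.χ l) (Q.χ_surjective l) (Omega _) x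
    rw [DiffCalculus.mem_ideal, Omega.ext_ext] at hx
    rw [Omega.ext_ext]
    have e : ((φ h).comp (resH (swap h))).comp (Q.χ l) = χOv h := AlgHom.ext fun f => φ_χOv h f
    rw [e]
    -- Since `y` is itself in the kernel of χ_l, it is its own witness.
    exact (ext_χOv_calcOv_eq_zero_iff Γ ΓH h y).2 ⟨y, hx, rfl⟩
  exact ⟨DiffHom.ofIdeal _ _ _ key, DiffHom.ofIdeal_ι _ _ _ key⟩

/-- Inherited from Γ(B_k) ⊗̂ Γ(H), as B_k → B_ij is surjective. -/
lemma calcOv_d_commute (h : Q.J k ⊔ Q.J l = Q.J i ⊔ Q.J j) (b : Q.Bov i j) (x : H) :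
    (calcOv Γ ΓH k l h).d ((calcOv Γ ΓH k l h).ι (b ⊗ₜ 1)) * (calcOv Γ ΓH k l h).ι (1 ⊗ₜ x) =
      (calcOv Γ ΓH k l h).ι (1 ⊗ₜ x) *
        (calcOv Γ ΓH k l h).d ((calcOv Γ ΓH k l h).ι (b ⊗ₜ 1)) := by
  obtain ⟨b, rfl⟩ := res_surjective h b
  have h1 : res h b ⊗ₜ[ℂ] (1 : H) = resH h (b ⊗ₜ 1) := by simp [resH]
  have h2 : (1 : Q.Bov i j) ⊗ₜ[ℂ] x = resH h (1 ⊗ₜ x) := by simp [resH]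
  rw [h1, h2, ← ovMk_ι, ← ovMk_ι, ← DiffHom.map_d, ← map_mul, ← map_mul, skew_d_commute]

end

/-! ### Relations in Γ(H), in Γ_m(B_ij) and in their skew product -/

variable (hS : Function.Bijective (HopfAlgebra.antipode ℂ : H →ₗ[ℂ] H)) (R : Submodule ℂ H)

lemma mem_calcH_ideal (x : (Omega H).Carrier) :
    x ∈ (calcH hS R).ideal.toIdeal ↔ x ∈ (idealH hS R).toIdeal :=
  Omega.mem_quot_ideal _ _ x

lemma mem_calcM_ideal (h : Q.J k ⊔ Q.J l = Q.J i ⊔ Q.J j) (x : (Omega (Q.Bov i j)).Carrier) :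
    x ∈ (calcM Γ R k l h).ideal.toIdeal ↔ x ∈ (idealM Γ R k l h).toIdeal :=
  Omega.mem_quot_ideal _ _ x

lemma ηΩ_mem_calcH_ideal {r : H} (hr : r ∈ R) : ηΩ hS r ∈ (calcH hS R).ideal.toIdeal :=
  (mem_calcH_ideal hS R _).2 (DiffIdeal.subset_generate ⟨r, hr, rfl⟩)

lemma JmGen.mem_ideal {R : Submodule ℂ H} {h : Q.J k ⊔ Q.J l = Q.J i ⊔ Q.J j}
    {x : (Omega (Q.Bov i j)).Carrier} (hx : JmGen Γ R k l h x) :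
    x ∈ (calcM Γ R k l h).ideal.toIdeal :=
  (mem_calcM_ideal Γ R h x).2 (DiffIdeal.subset_generate hx)

lemma ext_inl_skew {A : Type*} [Ring A] [Algebra ℂ A] (Γ : DiffCalculus A) (Δ : DiffCalculus H)
    {x : (Omega A).Carrier} (hx : x ∈ Γ.ideal.toIdeal) :
    (Omega.ext Algebra.TensorProduct.includeLeft (skew Γ Δ)).toAlgHom x = 0 := by
  rw [← (skewInl Γ Δ).map_ext (AlgHom.id ℂ A) Algebra.TensorProduct.includeLeft (skewInl_ι Γ Δ),
    (Γ.mem_ideal x).1 hx, map_zero]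

lemma ext_inr_skew {A : Type*} [Ring A] [Algebra ℂ A] (Γ : DiffCalculus A) (Δ : DiffCalculus H)
    {x : (Omega H).Carrier} (hx : x ∈ Δ.ideal.toIdeal) :
    (Omega.ext Algebra.TensorProduct.includeRight (skew Γ Δ)).toAlgHom x = 0 := by
  rw [← (skewInr Γ Δ).map_ext (AlgHom.id ℂ H) Algebra.TensorProduct.includeRight (skewInr_ι Γ Δ),
    (Δ.mem_ideal x).1 hx, map_zero]

lemma calcM_d_τ_commute (h : Q.J k ⊔ Q.J l = Q.J i ⊔ Q.J j) (x : H) (b : Q.Bov i j) :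
    (calcM Γ R k l h).d ((calcM Γ R k l h).ι (τ (swap h) x)) * (calcM Γ R k l h).ι b =
      (calcM Γ R k l h).ι b * (calcM Γ R k l h).d ((calcM Γ R k l h).ι (τ (swap h) x)) := by
  have := (DiffCalculus.mem_ideal _ _).1 (JmGen.mem_ideal Γ (JmGen.comm (h := h) (R := R) x b))
  rw [map_sub, map_mul, map_mul, Omega.ext_dι, Omega.ext_ι] at this
  exact sub_eq_zero.1 this

/-! ### Comparison of the differential ideals -/

section

variable {R}

/-- It suffices that both chart kernels die in Γ_m ⊗̂ Γ(H). Chart k is immediate. In chart l the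
relations of Γ(H) become the R-generators of J_m, and the commutation rule of the skew product
follows from the commutator generators. -/
lemma calcOv_ideal_le (hQ : Q.TransitionInvariant R) (h : Q.J k ⊔ Q.J l = Q.J i ⊔ Q.J j)
    (x : (Omega (Q.Bov i j ⊗[ℂ] H)).Carrier) (hx : x ∈ (calcOv Γ (calcH hS R) k l h).ideal.toIdeal) :
    x ∈ (skew (calcM Γ R k l h) (calcH hS R)).ideal.toIdeal := by
  set M := calcM Γ R k l h with hM
  set G := skew M (calcH hS R) with hG
  obtain ⟨y, rfl⟩ := Omega.ext_surjective (χOv h) (χOv_surjective h) (Omega _) x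
  rw [DiffCalculus.mem_ideal, Omega.ext_ext] at hx ⊢
  obtain ⟨z, hz, hzy⟩ := (ext_χOv_calcOv_eq_zero_iff Γ _ h y).1 hx
  change (Omega.ext (χOv h) G).toAlgHom y = 0
  have hc : ∀ (b : Q.Bov i j) (x : H), G.d (G.ι (b ⊗ₜ 1)) * G.ι (1 ⊗ₜ x) =
    G.ι (1 ⊗ₜ x) * G.d (G.ι (b ⊗ₜ 1)) := skew_d_commute M (calcH hS R)
  have hτ : ∀ x b, G.d (G.ι (τ (swap h) x ⊗ₜ 1)) * G.ι (b ⊗ₜ 1) =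
      G.ι (b ⊗ₜ 1) * G.d (G.ι (τ (swap h) x ⊗ₜ 1)) := by
    intro x b
    rw [hG, ← skewInl_ι, ← skewInl_ι, ← DiffHom.map_d, ← map_mul, ← map_mul,
      calcM_d_τ_commute]
  have h1 : ∀ z, (Q.χΩΓ Γ (calcH hS R) k).toAlgHom z = 0 → (Omega.ext (χOv h) G).toAlgHom z = 0 := by
    refine ext_χOv_eq_zero Γ (calcH hS R) k h G (resH h) rfl (fun x hx => ?_) (fun x hx => ?_)
      (fun a b => ?_)
    · have e : (resH h).comp Algebra.TensorProduct.includeLeft =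
          (Algebra.TensorProduct.includeLeft : Q.Bov i j →ₐ[ℂ] _).comp (res h) := by
        ext a; simp [resH]
      rw [e, ← Omega.ext_ext]
      exact ext_inl_skew _ _ (JmGen.mem_ideal Γ (JmGen.left x hx))
    · have e : (resH h).comp Algebra.TensorProduct.includeRight =
          (Algebra.TensorProduct.includeRight : H →ₐ[ℂ] Q.Bov i j ⊗[ℂ] H) := by
        ext a; simp [resH]
      rw [e]
      exact ext_inr_skew _ _ hx
    · simp only [resH, Algebra.TensorProduct.map_tmul, map_one]
      exact hc _ _
  have h2 : ∀ z, (Q.χΩΓ Γ (calcH hS R) l).toAlgHom z = 0 → (Omega.ext (χOv h) G).toAlgHom z = 0 := by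
    refine ext_χOv_eq_zero Γ (calcH hS R) l h G ((φ h).comp (resH (swap h)))
      (AlgHom.ext fun f => φ_χOv h f) (fun x hx => ?_) (fun x hx => ?_) (fun a b => ?_)
    · have e : ((φ h).comp (resH (swap h))).comp Algebra.TensorProduct.includeLeft =
          (Algebra.TensorProduct.includeLeft : Q.Bov i j →ₐ[ℂ] _).comp (res (swap h)) := by
        refine AlgHom.ext fun a => ?_
        simp [resH, φ_tmul_one]
      rw [e, ← Omega.ext_ext]
      exact ext_inl_skew _ _ (JmGen.mem_ideal Γ (JmGen.right x hx))
    · have e : ((φ h).comp (resH (swap h))).comp Algebra.TensorProduct.includeRight = φH h := by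
        refine AlgHom.ext fun a => ?_
        simp [resH, φH]
      rw [e]
      refine DiffIdeal.generate_le (J := (Omega.ext (φH h) G).ker) ?_ ((mem_calcH_ideal hS R x).1 hx)
      rintro _ ⟨r, hr, rfl⟩
      change (Omega.ext (φH h) G).toAlgHom (ηΩ hS r) = 0
      rw [ext_φH_ηΩ h G hc hS hQ hτ
        (fun r hr => ext_inr_skew _ _ (ηΩ_mem_calcH_ideal hS R hr)) hr, neg_eq_zero]
      exact ext_inl_skew _ _ (JmGen.mem_ideal Γ (JmGen.ofR r hr))
    · have ea : ((φ h).comp (resH (swap h))) (a ⊗ₜ 1) = res (swap h) a ⊗ₜ 1 := by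
        simp [resH, φ_tmul_one]
      have eb : ((φ h).comp (resH (swap h))) (1 ⊗ₜ b) = φH h b := by
        simp [resH, φH]
      rw [ea, eb]
      -- The commutator generators give that dφ(H) commutes with B_ij; differentiating turns this
      -- into φ(H) commuting with dB_ij.
      refine G.commute_d ?_ ((d_φH_commutator h G hc hS _).2 (fun x => hτ x _) b)
      have := φ_tmul_one h (res (swap h) a)
      rw [← this, φH, AlgHom.comp_apply, ← map_mul, ← map_mul]
      simp
  have h3 := h1 (y - z) (by rw [map_sub, hzy, sub_self])
  rwa [map_sub, h2 z hz, sub_zero] at h3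

/-- By the universal property of the skew product only generators matter. The relations of chart k
arrive through the projection `ovMk`, those of chart l through the map `F` extending φ_kl. The
latter, read backwards through `d_φH_commutator` and `ext_φH_ηΩ`, supply the commutators with dτ_lk
and the R-generators. -/
lemma skew_calcM_ideal_le (hQ : Q.TransitionInvariant R) (h : Q.J k ⊔ Q.J l = Q.J i ⊔ Q.J j)
    (x : (Omega (Q.Bov i j ⊗[ℂ] H)).Carrier)
    (hx : x ∈ (skew (calcM Γ R k l h) (calcH hS R)).ideal.toIdeal) :
    x ∈ (calcOv Γ (calcH hS R) k l h).ideal.toIdeal := by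
  set G := calcOv Γ (calcH hS R) k l h with hG
  have hc : ∀ (b : Q.Bov i j) (x : H), G.d (G.ι (b ⊗ₜ 1)) * G.ι (1 ⊗ₜ x) =
    G.ι (1 ⊗ₜ x) * G.d (G.ι (b ⊗ₜ 1)) := calcOv_d_commute Γ (calcH hS R) h
  obtain ⟨F, hF⟩ := exists_skew_calcOv Γ (calcH hS R) h
  have hF1 : ∀ a, F.toAlgHom ((skew (Γ l) (calcH hS R)).ι (a ⊗ₜ 1)) = G.ι (res (swap h) a ⊗ₜ 1) := by
    intro a
    rw [hF]
    simp [resH, φ_tmul_one]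
    rfl
  have hF2 : ∀ y, F.toAlgHom ((skew (Γ l) (calcH hS R)).ι (1 ⊗ₜ y)) = G.ι (φH h y) := by
    intro y
    rw [hF]
    simp [resH, φH]
    rfl
  have hH : ∀ x ∈ (calcH hS R).ideal.toIdeal,
      (Omega.ext Algebra.TensorProduct.includeRight G).toAlgHom x = 0 := by
    intro x hx
    rw [← (ovMk Γ (calcH hS R) h).map_ext Algebra.TensorProduct.includeRight _ (fun y => ?_),
      ext_inr_skew _ _ hx, map_zero]
    rw [ovMk_ι]
    simp [resH]
  have hτ : ∀ x b, G.d (G.ι (τ (swap h) x ⊗ₜ 1)) * G.ι (b ⊗ₜ 1) =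
      G.ι (b ⊗ₜ 1) * G.d (G.ι (τ (swap h) x ⊗ₜ 1)) := by
    intro x b
    -- In Γ(B_l) ⊗̂ Γ(H) the forms dH commute with B_l; `F` carries this over to dφ(H) and B_ij.
    refine (d_φH_commutator h G hc hS b).1 (fun y => ?_) x
    obtain ⟨a, rfl⟩ := res_surjective (swap h) b
    rw [← hF1, ← hF2, ← DiffHom.map_d, ← map_mul, ← map_mul]
    congr 1
    exact DiffCalculus.commute_d _ (by simp) (skew_d_commute _ _ a y)
  refine skew_ideal_le (calcM Γ R k l h) (calcH hS R) G (AlgHom.id ℂ _) (fun x hx => ?_)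
    (fun x hx => ?_) hc x hx
  · rw [AlgHom.id_comp]
    refine DiffIdeal.generate_le (J := (Omega.ext Algebra.TensorProduct.includeLeft G).ker) ?_
      ((mem_calcM_ideal Γ R h x).1 hx)
    rintro _ (⟨x, hx⟩ | ⟨x, hx⟩ | ⟨r, hr⟩ | ⟨x, a⟩)
    · change (Omega.ext Algebra.TensorProduct.includeLeft G).toAlgHom _ = 0
      rw [Omega.ext_ext,
        ← (ovMk Γ (calcH hS R) h).map_ext Algebra.TensorProduct.includeLeft _ (fun y => ?_),
        ext_inl_skew _ _ hx, map_zero]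
      rw [ovMk_ι]
      simp [resH]
    · change (Omega.ext Algebra.TensorProduct.includeLeft G).toAlgHom _ = 0
      rw [Omega.ext_ext, ← F.map_ext Algebra.TensorProduct.includeLeft
        (Algebra.TensorProduct.includeLeft.comp (res (swap h))) hF1,
        ext_inl_skew _ _ hx, map_zero]
    · change (Omega.ext Algebra.TensorProduct.includeLeft G).toAlgHom _ = 0
      -- Up to sign this generator is the image under `F` of η(r), which is zero in Γ(H).
      rw [← neg_eq_zero, ← ext_φH_ηΩ h G hc hS hQ hτ
        (fun r hr => hH _ (ηΩ_mem_calcH_ideal hS R hr)) hr,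
        ← F.map_ext Algebra.TensorProduct.includeRight (φH h) hF2,
        ext_inr_skew _ _ (ηΩ_mem_calcH_ideal hS R hr), map_zero]
    · change (Omega.ext Algebra.TensorProduct.includeLeft G).toAlgHom _ = 0
      rw [map_sub, map_mul, map_mul, Omega.ext_dι, Omega.ext_ι, sub_eq_zero]
      exact hτ x a
  · exact hH x hx

lemma calcOv_ideal_eq (hQ : Q.TransitionInvariant R) (h : Q.J k ⊔ Q.J l = Q.J i ⊔ Q.J j) :
    (calcOv Γ (calcH hS R) k l h).ideal = (skew (calcM Γ R k l h) (calcH hS R)).ideal :=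
  DiffIdeal.toIdeal_injective (le_antisymm (calcOv_ideal_le Γ hS hQ h)
    (skew_calcM_ideal_le Γ hS hQ h))

/-- One of the inclusions between the ideals `J_m(B_ij)` for `(k, l)` and `(l, k)`. -/
lemma idealM_swap_le (hQ : Q.TransitionInvariant R) (h : Q.J k ⊔ Q.J l = Q.J i ⊔ Q.J j)
    {x : (Omega (Q.Bov i j)).Carrier} (hx : x ∈ (idealM Γ R l k (swap h)).toIdeal) :
    x ∈ (idealM Γ R k l h).toIdeal := by
  refine DiffIdeal.generate_le ?_ hx
  rintro _ (⟨x, hx⟩ | ⟨x, hx⟩ | ⟨r, hr⟩ | ⟨x, a⟩)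
  · exact DiffIdeal.subset_generate (JmGen.right x hx)
  · exact DiffIdeal.subset_generate (JmGen.left x hx)
  -- Work in Γ_m with T = τ_kl and T' = τ_lk. There dT ⋇ T' vanishes on R, and dT' ⋇ T = -T' ⋇ dT =
  -- -T' ⋇ (dT ⋇ T') ⋇ T, so (*) makes the conjugate vanish on R as well.
  · rw [← mem_calcM_ideal, DiffCalculus.mem_ideal]
    set G := calcM Γ R k l h with hG
    let T : H →ₗ[ℂ] G.Carrier := (G.ι.comp (τ h)).toLinearMap
    let T' : H →ₗ[ℂ] G.Carrier := (G.ι.comp (τ (swap h))).toLinearMap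
    have c' : ∀ x b, G.d (G.ι (τ (swap h) x)) * G.ι b = G.ι b * G.d (G.ι (τ (swap h) x)) :=
      calcM_d_τ_commute Γ R h
    -- Since τ_kl = τ_lk ∘ S, commutation for dτ_lk contains that for dτ_kl.
    have c : ∀ x b, G.d (G.ι (τ h x)) * G.ι b = G.ι b * G.d (G.ι (τ h x)) := by
      intro x b
      rw [← τ_antipode (swap h)]
      exact c' _ b
    have e1 : ∀ s, (Omega.ext (AlgHom.id ℂ _) G).toAlgHom (LinearMap.mul' ℂ _
        (TensorProduct.map ((Omega (Q.Bov i j)).ι.toLinearMap ∘ₗ (τ (swap h)).toLinearMap)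
          ((Omega (Q.Bov i j)).d ∘ₗ (Omega (Q.Bov i j)).ι.toLinearMap ∘ₗ (τ h).toLinearMap)
          (comul s))) = ((G.d ∘ₗ T) ⋇ T') s := by
      intro s
      rw [copConv_apply_of_commute _ _ (fun x y => c x (τ (swap h) y))]
      induction (comul s : H ⊗[ℂ] H) using TensorProduct.induction_on with
      | zero => simp
      | add x y hx hy => simp only [map_add, hx, hy]
      | tmul x y =>
        simp only [TensorProduct.map_tmul, LinearMap.mul'_apply, map_mul, LinearMap.comp_apply,
          AlgHom.toLinearMap_apply, Omega.ext_ι, Omega.ext_dι]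
        rfl
    have e2 : (Omega.ext (AlgHom.id ℂ _) G).toAlgHom (LinearMap.mul' ℂ _
        (TensorProduct.map ((Omega (Q.Bov i j)).ι.toLinearMap ∘ₗ (τ h).toLinearMap)
          ((Omega (Q.Bov i j)).d ∘ₗ (Omega (Q.Bov i j)).ι.toLinearMap ∘ₗ (τ (swap h)).toLinearMap)
          (comul r))) = ((G.d ∘ₗ T') ⋇ T) r := by
      rw [copConv_apply_of_commute _ _ (fun x y => c' x (τ h y))]
      induction (comul r : H ⊗[ℂ] H) using TensorProduct.induction_on with
      | zero => simp
      | add x y hx hy => simp only [map_add, hx, hy]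
      | tmul x y =>
        simp only [TensorProduct.map_tmul, LinearMap.mul'_apply, map_mul, LinearMap.comp_apply,
          AlgHom.toLinearMap_apply, Omega.ext_ι, Omega.ext_dι]
        rfl
    have hT : T' ⋇ T = copOne H _ := by
      have := congrArg (fun f => G.ι.toLinearMap ∘ₗ f) (τ_copConv_τ (swap h))
      simp only [map_copConv, map_copOne] at this
      exact this
    have hFR : ∀ s ∈ R, ((G.d ∘ₗ T) ⋇ T') s = 0 := by
      intro s hs
      rw [← e1]
      exact (DiffCalculus.mem_ideal _ _).1 (JmGen.mem_ideal Γ (JmGen.ofR s hs))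
    have hd : (G.d ∘ₗ T') ⋇ T + T' ⋇ (G.d ∘ₗ T) = 0 := by
      refine (G.d_copConv (τ (swap h)).toLinearMap (τ h).toLinearMap).symm.trans ?_
      change G.d ∘ₗ (T' ⋇ T) = 0
      rw [hT]
      ext x
      simp [copOne_apply, G.d_one]
    have hF : ∀ s y, ((G.d ∘ₗ T) ⋇ T') s * G.ι (τ h y) = G.ι (τ h y) * ((G.d ∘ₗ T) ⋇ T') s := by
      intro s y
      rw [copConv_apply]
      induction TensorProduct.comm ℂ H H (comul s) using TensorProduct.induction_on with
      | zero => simp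
      | add u v hu hv => simp only [map_add, add_mul, mul_add, hu, hv]
      | tmul u v =>
        have hT' : T' v * G.ι (τ h y) = G.ι (τ h y) * T' v := by
          change G.ι (τ (swap h) v) * G.ι (τ h y) = G.ι (τ h y) * G.ι (τ (swap h) v)
          rw [← map_mul, ← map_mul, τ_central]
        have hT : (G.d ∘ₗ T) u * G.ι (τ h y) = G.ι (τ h y) * (G.d ∘ₗ T) u := c u (τ h y)
        rw [TensorProduct.map_tmul, LinearMap.mul'_apply, mul_assoc, hT', ← mul_assoc, hT,
          mul_assoc]
    have h0 : (T' ⋇ (G.d ∘ₗ T)) r = 0 := by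
      have := copConv_conj_eq_zero hQ (swap h) G.ι _ hF hFR hr
      change (T' ⋇ ((G.d ∘ₗ T) ⋇ T' ⋇ T)) r = 0 at this
      rwa [copConv_assoc, hT, copConv_copOne] at this
    have h1 := LinearMap.congr_fun hd r
    rw [LinearMap.add_apply, h0, add_zero] at h1
    exact e2.trans h1
  -- This commutator is the generator for the original order taken at S(x).
  · refine DiffIdeal.subset_generate ?_
    have := JmGen.comm (Γ := Γ) (R := R) (h := h) (HopfAlgebra.antipode ℂ x) a
    rwa [τ_antipode] at this

end

end LocTrivQPFB

end Overlaps

/-! ## Bicovariant calculi on the Hopf algebra -/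

section Bicovariant

open Coalgebra

local infixl:70 " ⋇ " => copConv

/-! ### Differential ideals controlled in degree one -/

section DegreeOne

variable {A : Type*} [Ring A] [Algebra ℂ A] {Γ : DiffCalculus A}

lemma proj_one_mul (x y : Γ.Carrier) :
    Γ.proj 1 (x * y) = Γ.proj 0 x * Γ.proj 1 y + Γ.proj 1 x * Γ.proj 0 y := by
  refine Γ.gr_induction (p := fun x => Γ.proj 1 (x * y) =
    Γ.proj 0 x * Γ.proj 1 y + Γ.proj 1 x * Γ.proj 0 y) (by simp) (fun m x hx => ?_)
    (fun u v hu hv => by simp only [add_mul, map_add, hu, hv]; abel) x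
  refine Γ.gr_induction (p := fun y => Γ.proj 1 (x * y) =
    Γ.proj 0 x * Γ.proj 1 y + Γ.proj 1 x * Γ.proj 0 y) (by simp) (fun n y hy => ?_)
    (fun u v hu hv => by simp only [mul_add, map_add, hu, hv]; abel) y
  rw [Γ.proj_of_mem (SetLike.mul_mem_graded hx hy), Γ.proj_of_mem hx, Γ.proj_of_mem hx,
    Γ.proj_of_mem hy, Γ.proj_of_mem hy]
  by_cases h1 : m = 0
  · subst h1
    simp
  · by_cases h2 : m = 1
    · subst h2
      simp
    · have h3 : m + n ≠ 1 := by omega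
      simp [h1, h2, h3]

/-- The differential ideal of the elements without component of degree zero whose component of
degree one is annihilated by `g`. -/
def DiffIdeal.ofDegreeOne (Γ : DiffCalculus A) {C : Type*} [Ring C] [Algebra ℂ C]
    (g : Γ.Carrier →ₐ[ℂ] C) : DiffIdeal Γ where
  toIdeal :=
    { carrier := {x | Γ.proj 0 x = 0 ∧ g (Γ.proj 1 x) = 0}
      add_mem' := by
        rintro x y ⟨hx, hx'⟩ ⟨hy, hy'⟩
        exact ⟨by rw [map_add, hx, hy, add_zero], by rw [map_add, map_add, hx', hy', add_zero]⟩
      zero_mem' := ⟨map_zero _, by rw [map_zero, map_zero]⟩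
      smul_mem' := by
        rintro c x ⟨hx, hx'⟩
        refine ⟨?_, ?_⟩
        · rw [smul_eq_mul, proj_zero_mul, hx, mul_zero]
        · rw [smul_eq_mul, proj_one_mul, hx, mul_zero, add_zero, map_mul, hx', mul_zero] }
  isTwoSided := ⟨by
    rintro x c ⟨hx, hx'⟩
    refine ⟨?_, ?_⟩
    · rw [proj_zero_mul, hx, zero_mul]
    · rw [proj_one_mul, hx, zero_mul, zero_add, map_mul, hx', zero_mul]⟩
  d_mem := by
    have key : ∀ n, Γ.proj (n + 1) ∘ₗ Γ.d = Γ.d ∘ₗ Γ.proj n := by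
      intro n
      refine Γ.hom_ext_gr fun m x hx => ?_
      simp only [LinearMap.comp_apply]
      rw [Γ.proj_of_mem (Γ.d_mem m x hx), Γ.proj_of_mem hx]
      by_cases h : m = n <;> simp [h]
    -- The degree-one component of dx is d of the degree-zero component of x, hence zero; so `g`
    -- need not be compatible with d.
    rintro x ⟨hx, -⟩
    refine ⟨(DiffIdeal.positive Γ).d_mem x hx, ?_⟩
    have := LinearMap.congr_fun (key 0) x
    simp only [LinearMap.comp_apply, hx, map_zero, zero_add] at this
    rw [this, map_zero]
  proj_mem := by
    rintro x ⟨hx, hx'⟩ n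
    refine ⟨?_, ?_⟩
    · rw [Γ.proj_of_mem (Γ.proj_mem n x)]
      split_ifs with h
      · subst h; exact hx
      · rfl
    · rw [Γ.proj_of_mem (Γ.proj_mem n x)]
      split_ifs with h
      · subst h; exact hx'
      · exact map_zero g

end DegreeOne

variable {H : Type*} [Ring H] [HopfAlgebra ℂ H]

/-! ### A representation of Ω(H) that detects H/R -/

section Representation

variable (hS : Function.Bijective (HopfAlgebra.antipode ℂ : H →ₗ[ℂ] H))

section Inner

variable {E : Type*} [Ring E] [Algebra ℂ E] (f : H →ₐ[ℂ] E) (N : E)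

/-- The homomorphism `Ω(H) → E` that extends `f` and the inner derivation `a ↦ [N, f a]`. -/
def innerLift : (Omega H).Carrier →ₐ[ℂ] E :=
  OmegaAlg.lift f ((LinearMap.mulLeft ℂ N - LinearMap.mulRight ℂ N) ∘ₗ f.toLinearMap) fun a b => by
    simp only [LinearMap.comp_apply, LinearMap.sub_apply, AlgHom.toLinearMap_apply, map_mul,
      LinearMap.mulLeft_apply, LinearMap.mulRight_apply]
    noncomm_ring

/-- Since N f = f ⋇ P and f N = f ⋇ (ε N), the inner derivation a ↦ [N, f(a)] equals f ⋇ (P - ε N).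
As η is recovered from d by cancelling f, it goes to P - ε N. -/
lemma innerLift_ηΩ (P : H →ₗ[ℂ] E)
    (hP : f.toLinearMap ⋇ P = LinearMap.mulLeft ℂ N ∘ₗ f.toLinearMap) (r : H) :
    innerLift f N (ηΩ hS r) = P r - (counit r : ℂ) • N := by
  have e1 : (innerLift f N).toLinearMap ∘ₗ ηΩ hS = (f.toLinearMap ∘ₗ antipodeInv hS) ⋇
      ((LinearMap.mulLeft ℂ N - LinearMap.mulRight ℂ N) ∘ₗ f.toLinearMap) := by
    refine (map_copConv (innerLift f N) _ _).trans ?_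
    congr 1
    · ext1 x
      exact OmegaAlg.lift_of _ _ _ _
    · ext1 x
      exact (congrArg (innerLift f N) (OmegaAlg.d_of x)).trans (OmegaAlg.lift_del _ _ _ _)
  have e3 : f.toLinearMap ⋇ (LinearMap.mulRight ℂ N ∘ₗ copOne H E) =
      LinearMap.mulRight ℂ N ∘ₗ f.toLinearMap := by
    refine Eq.trans ?_ (congrArg (fun g => LinearMap.mulRight ℂ N ∘ₗ g)
      (copConv_copOne f.toLinearMap))
    ext1 x
    simp only [LinearMap.comp_apply, copConv_apply]
    induction TensorProduct.comm ℂ H H (comul x) using TensorProduct.induction_on with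
    | zero => simp
    | add x y hx hy => simp only [map_add, hx, hy]
    | tmul x y => simp [mul_assoc]
  have e2 : f.toLinearMap ⋇ (P - LinearMap.mulRight ℂ N ∘ₗ copOne H E) =
      (LinearMap.mulLeft ℂ N - LinearMap.mulRight ℂ N) ∘ₗ f.toLinearMap := by
    rw [LinearMap.sub_comp, eq_sub_iff_add_eq, ← e3, ← copConv_add, sub_add_cancel, hP]
  have e5 := eq_copConv_of_copConv_eq (antipodeInv_copConv hS f) e2
  refine (LinearMap.congr_fun (e1.trans e5.symm) r).trans ?_
  simp [copOne_apply]

end Inner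

variable (R : Submodule ℂ H)

/-- The functions and the right-invariant forms `H ⊗ H/R`, on which `Ω(H)` is represented. -/
def RepSpace : Type _ := H × (H ⊗[ℂ] (H ⧸ R))

instance : AddCommGroup (RepSpace R) := inferInstanceAs (AddCommGroup (H × (H ⊗[ℂ] (H ⧸ R))))
instance : Module ℂ (RepSpace R) := inferInstanceAs (Module ℂ (H × (H ⊗[ℂ] (H ⧸ R))))
instance : Module H (RepSpace R) := inferInstanceAs (Module H (H × (H ⊗[ℂ] (H ⧸ R))))
instance : IsScalarTower ℂ H (RepSpace R) :=
  inferInstanceAs (IsScalarTower ℂ H (H × (H ⊗[ℂ] (H ⧸ R))))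

/-- The bilinear map `(r, x) ↦ ∑ x₂ ⊗ [r x₁]`. -/
def repForm₂ : H →ₗ[ℂ] H →ₗ[ℂ] H ⊗[ℂ] (H ⧸ R) :=
  LinearMap.mk₂ ℂ (fun r x => R.mkQ.lTensor H
    (TensorProduct.comm ℂ H H ((LinearMap.mulLeft ℂ r).rTensor H (comul x))))
    (fun r s x => by
      have : LinearMap.mulLeft ℂ (r + s) = LinearMap.mulLeft ℂ r + LinearMap.mulLeft ℂ s := by
        ext; simp [add_mul]
      simp [this, LinearMap.rTensor_add])
    (fun c r x => by
      have : LinearMap.mulLeft ℂ (c • r) = c • LinearMap.mulLeft ℂ r := by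
        ext; simp
      simp [this, LinearMap.rTensor_smul])
    (fun r x y => by simp)
    (fun c r x => by simp)

lemma repForm₂_apply (r x : H) : repForm₂ R r x = R.mkQ.lTensor H
    (TensorProduct.comm ℂ H H ((LinearMap.mulLeft ℂ r).rTensor H (comul x))) := rfl

/-- The map `(x, y) ↦ (0, ∑ x₂ ⊗ [r x₁])`. -/
def repForm : H →ₗ[ℂ] Module.End ℂ (RepSpace R) :=
  LinearMap.mk₂ ℂ (fun r w => ((0, repForm₂ R r w.1) : H × (H ⊗[ℂ] (H ⧸ R))))
    (fun r s w => Prod.ext (add_zero 0).symm (LinearMap.map_add₂ _ r s w.1))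
    (fun c r w => Prod.ext (smul_zero c).symm (LinearMap.map_smul₂ _ c r w.1))
    (fun _ w w' => Prod.ext (add_zero 0).symm (map_add _ w.1 w'.1))
    (fun c _ w => Prod.ext (smul_zero c).symm (map_smul _ c w.1))

/-- The multiplication by functions. -/
def repMul : H →ₐ[ℂ] Module.End ℂ (RepSpace R) := Algebra.lsmul ℂ ℂ (RepSpace R)

/-- Multiplicativity of Δ: both sides send x to ∑ r₂ x₂ ⊗ [r₁ x₁]. This is the hypothesis of
`innerLift_ηΩ`. -/
lemma repMul_copConv_repForm : (repMul R).toLinearMap ⋇ repForm R =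
    LinearMap.mulLeft ℂ (repForm R 1) ∘ₗ (repMul R).toLinearMap := by
  ext1 r
  refine LinearMap.ext fun w => ?_
  have h1 : (repForm R 1 * repMul R r) w = ((0, R.mkQ.lTensor H
      (TensorProduct.comm ℂ H H (comul r * comul w.1))) : H × (H ⊗[ℂ] (H ⧸ R))) := by
    change ((0, repForm₂ R 1 (r * w.1)) : H × (H ⊗[ℂ] (H ⧸ R))) = _
    rw [repForm₂_apply, Bialgebra.comul_mul, LinearMap.mulLeft_one, LinearMap.rTensor_id]
    rfl
  refine Eq.trans ?_ h1.symm
  rw [copConv_apply]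
  induction (comul r : H ⊗[ℂ] H) using TensorProduct.induction_on with
  | zero => simp; rfl
  | add x y hx hy =>
    simp only [map_add, add_mul, LinearMap.add_apply, hx, hy]
    exact Prod.ext (add_zero 0) rfl
  | tmul x y =>
    refine Prod.ext (smul_zero y) ?_
    change y • repForm₂ R x w.1 = _
    rw [repForm₂_apply]
    induction (comul w.1 : H ⊗[ℂ] H) using TensorProduct.induction_on with
    | zero => simp
    | add u v hu hv => simp only [map_add, mul_add, smul_add, hu, hv]
    | tmul u v => simp [TensorProduct.smul_tmul']

/-- The representation of `Ω(H)` in which `d` is the commutator with `x ↦ ∑ x₂ ⊗ [x₁]`. -/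
def rep : (Omega H).Carrier →ₐ[ℂ] Module.End ℂ (RepSpace R) := innerLift (repMul R) (repForm R 1)

lemma rep_ηΩ (r : H) : rep R (ηΩ hS r) = repForm R r - (counit r : ℂ) • repForm R 1 :=
  innerLift_ηΩ hS (repMul R) (repForm R 1) (repForm R) (repMul_copConv_repForm R) r

lemma ηΩ_mem_gr (r : H) : ηΩ hS r ∈ (Omega H).gr 1 := by
  unfold ηΩ
  simp only [LinearMap.comp_apply]
  generalize (TensorProduct.comm ℂ H H).toLinearMap (comul r) = z
  induction z using TensorProduct.induction_on with
  | zero => simp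
  | add x y hx hy => simp only [map_add]; exact add_mem hx hy
  | tmul x y =>
    have := SetLike.mul_mem_graded ((Omega H).ι_mem (antipodeInv hS x)) ((Omega H).dι_mem y)
    rwa [zero_add] at this

variable {R}

/-- For r ∈ R all classes [r x₁] vanish because R is a right ideal, so η(r) acts by zero.
`DiffIdeal.ofDegreeOne` then contains all of J(H), including the parts produced by d. -/
lemma rep_eq_zero (hR : ∀ r ∈ R, ∀ x : H, r * x ∈ R) (hRε : ∀ r ∈ R, (counit r : ℂ) = 0)
    {x : (Omega H).Carrier} (hx : x ∈ (idealH hS R).toIdeal) : rep R ((Omega H).proj 1 x) = 0 := by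
  have : x ∈ (DiffIdeal.ofDegreeOne (Omega H) (rep R)).toIdeal := by
    refine DiffIdeal.generate_le ?_ hx
    rintro _ ⟨r, hr, rfl⟩
    have h1 : (Omega H).proj 0 (ηΩ hS r) = 0 := by
      rw [(Omega H).proj_of_mem (ηΩ_mem_gr hS r), if_neg one_ne_zero]
    have h2 : rep R ((Omega H).proj 1 (ηΩ hS r)) = 0 := by
      rw [(Omega H).proj_of_mem (ηΩ_mem_gr hS r), if_pos rfl, rep_ηΩ, hRε r hr, zero_smul, sub_zero]
      refine LinearMap.ext fun w => ?_
      refine Prod.ext rfl ?_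
      change repForm₂ R r w.1 = 0
      rw [repForm₂_apply]
      induction (comul w.1 : H ⊗[ℂ] H) using TensorProduct.induction_on with
      | zero => simp
      | add u v hu hv => simp only [map_add, hu, hv, add_zero]
      | tmul u v => simp [(Submodule.Quotient.mk_eq_zero R).2 (hR r hr u)]
    exact ⟨h1, h2⟩
  exact this.2

/-- A linear map on `Γ(H)` that recovers the class of `r - ε(r)` modulo `R` from the form `η(r)`. -/
lemma exists_quotient_form (hR : ∀ r ∈ R, ∀ x : H, r * x ∈ R)
    (hRε : ∀ r ∈ R, (counit r : ℂ) = 0) :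
    ∃ v : (calcH hS R).Carrier →ₗ[ℂ] H ⧸ R, ∀ r,
      v ((Omega.ext (AlgHom.id ℂ H) (calcH hS R)).toAlgHom (ηΩ hS r)) =
        R.mkQ r - (counit r : ℂ) • R.mkQ 1 := by
  let q : RepSpace R →ₗ[ℂ] H ⧸ R := (TensorProduct.lid ℂ (H ⧸ R)).toLinearMap ∘ₗ
    (counit : H →ₗ[ℂ] ℂ).rTensor (H ⧸ R) ∘ₗ LinearMap.snd ℂ H (H ⊗[ℂ] (H ⧸ R))
  -- η(r) sends this vector to (0, 1 ⊗ [r - ε(r)]); contracting the first tensor leg with ε then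
  -- isolates the class.
  let w : RepSpace R := ((1, 0) : H × (H ⊗[ℂ] (H ⧸ R)))
  have hq : ∀ r, q (repForm R r w) = R.mkQ r := by
    intro r
    change TensorProduct.lid ℂ (H ⧸ R) ((counit : H →ₗ[ℂ] ℂ).rTensor (H ⧸ R) (repForm₂ R r 1)) = _
    simp [repForm₂_apply, Algebra.TensorProduct.one_def]
  let v' : (Omega H).Carrier →ₗ[ℂ] H ⧸ R :=
    q ∘ₗ LinearMap.applyₗ w ∘ₗ (rep R).toLinearMap ∘ₗ (Omega H).proj 1
  have hv' : ∀ x, v' x = q (rep R ((Omega H).proj 1 x) w) := fun x => rfl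
  refine ⟨quotLinLift (idealH hS R).toIdeal v' fun x hx => ?_, fun r => ?_⟩
  · rw [hv', rep_eq_zero hS hR hRε hx, LinearMap.zero_apply, map_zero]
  · have e : (Omega.ext (AlgHom.id ℂ H) (calcH hS R)).toAlgHom (ηΩ hS r) =
      Ideal.Quotient.mkₐ ℂ (idealH hS R).toIdeal (ηΩ hS r) := Omega.ext_quot _ _ _
    rw [e]
    refine (quotLinLift_mk _ _ _ _).trans ?_
    rw [hv', (Omega H).proj_of_mem (ηΩ_mem_gr hS r), if_pos rfl, rep_ηΩ, LinearMap.sub_apply,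
      LinearMap.smul_apply, map_sub, map_smul, hq, hq]

end Representation

/-! ### Covariance and the adjoint coaction -/

variable (hS : Function.Bijective (HopfAlgebra.antipode ℂ : H →ₗ[ℂ] H)) {R : Submodule ℂ H}

/-- Contracting the middle leg leaves ∑ S(r₁) r₂ = ε(r). This disposes of the correction term
-ε(r)[1] in the quotient form. -/
lemma lTensor_counit_adMap (r : H) :
    (counit : H →ₗ[ℂ] ℂ).lTensor H (adMap r) = (counit r : ℂ) • (1 ⊗ₜ 1) := by
  apply (TensorProduct.rid ℂ H).injective
  have key : TensorProduct.rid ℂ H ((counit : H →ₗ[ℂ] ℂ).lTensor H (adMap r)) =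
      LinearMap.mul' ℂ H ((HopfAlgebra.antipode ℂ).rTensor H (comul r)) := by
    simp only [adMap, LinearMap.comp_apply, LinearEquiv.coe_coe]
    induction (comul r : H ⊗[ℂ] H) using TensorProduct.induction_on with
    | zero => simp
    | add x y hx hy => simp only [map_add, hx, hy]
    | tmul x y =>
      have hy : y = TensorProduct.lid ℂ H ((counit : H →ₗ[ℂ] ℂ).rTensor H (comul y)) := by
        rw [Coalgebra.rTensor_counit_comul]; simp
      conv_rhs => rw [hy]
      rw [LinearMap.lTensor_tmul]
      induction (comul y : H ⊗[ℂ] H) using TensorProduct.induction_on with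
      | zero => simp
      | add u v hu hv =>
        simp only [map_add, TensorProduct.tmul_add] at hu hv ⊢
        rw [hu, hv]
      | tmul u v => simp
  rw [key, HopfAlgebra.mul_antipode_rTensor_comul_apply]
  simp [Algebra.algebraMap_eq_smul_one]

/-- For a left covariant calculus, `R` is invariant under the adjoint coaction. -/
lemma adMap_mem_of_leftCovariant (hR : ∀ r ∈ R, ∀ x : H, r * x ∈ R)
    (hRε : ∀ r ∈ R, (counit r : ℂ) = 0) (hL : (calcH hS R).LeftCovariant) {r : H} (hr : r ∈ R) :
    adMap r ∈ LinearMap.range (R.subtype.lTensor H) := by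
  obtain ⟨v, hv⟩ := exists_quotient_form hS hR hRε
  let G := calcH hS R
  obtain ⟨δ, hδ0, hδ1, -, -⟩ : G.LeftCovariant := hL
  change G.Carrier →ₗ[ℂ] H ⧸ R at v
  let η : H →ₗ[ℂ] G.Carrier := (Omega.ext (AlgHom.id ℂ H) G).toAlgHom.toLinearMap ∘ₗ ηΩ hS
  let gL : H →ₐ[ℂ] H ⊗[ℂ] G.Carrier := Algebra.TensorProduct.includeLeft
  let gR : G.Carrier →ₐ[ℂ] H ⊗[ℂ] G.Carrier := Algebra.TensorProduct.includeRight
  -- The coaction formulas x₁ ⊗ f(x₂) are convolutions of the two embeddings into H ⊗ Γ(H), so the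
  -- cancellation calculus applies.
  have hconv : ∀ f : H →ₗ[ℂ] G.Carrier, ∀ x,
      ((gR.toLinearMap ∘ₗ f) ⋇ gL.toLinearMap) x = f.lTensor H (comul x) := by
    intro f x
    rw [copConv_apply]
    induction (comul x : H ⊗[ℂ] H) using TensorProduct.induction_on with
    | zero => simp
    | add x y hx hy => simp only [map_add, hx, hy]
    | tmul x y => simp [gL, gR]
  have h0 : (δ.comp G.ι).toLinearMap = (gR.comp G.ι).toLinearMap ⋇ gL.toLinearMap := by
    ext1 x
    exact (hδ0 x).trans (hconv _ x).symm
  have h1 : δ.toLinearMap ∘ₗ (G.d ∘ₗ G.ι.toLinearMap) =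
      (gR.toLinearMap ∘ₗ (G.d ∘ₗ G.ι.toLinearMap)) ⋇ gL.toLinearMap := by
    ext1 x
    exact (hδ1 x).trans (hconv _ x).symm
  have hη : G.ι.toLinearMap ⋇ η = G.d ∘ₗ G.ι.toLinearMap := copConv_ext_ηΩ G hS (AlgHom.id ℂ H)
  rw [← hη, map_copConv, map_copConv] at h1
  -- Apply δ to d = ι ⋇ η. Cancelling 1 ⊗ ι and then the embedding of H on the left gives δ(η(r)) =
  -- ∑ S⁻¹(r₃) r₁ ⊗ η(r₂).
  have h2 : (gR.comp G.ι).toLinearMap ⋇ (gL.toLinearMap ⋇ (δ.toLinearMap ∘ₗ η)) =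
      (gR.comp G.ι).toLinearMap ⋇ ((gR.toLinearMap ∘ₗ η) ⋇ gL.toLinearMap) := by
    rw [← copConv_assoc, ← copConv_assoc, ← h0]
    exact h1
  have h3 := eq_copConv_of_copConv_eq (antipodeInv_copConv hS gL)
    (copConv_cancel_left (antipodeInv_copConv hS (gR.comp G.ι)) h2)
  -- The antimultiplicative S turns S⁻¹(r₃) r₁ into S(r₁) r₃, the first leg of `adMap`.
  have h4 : (HopfAlgebra.antipode ℂ).rTensor G.Carrier
      (((gL.toLinearMap ∘ₗ antipodeInv hS) ⋇ ((gR.toLinearMap ∘ₗ η) ⋇ gL.toLinearMap)) r) =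
      η.lTensor H (adMap r) := by
    rw [← copConv_assoc, copConv_apply]
    simp only [adMap, LinearMap.comp_apply, LinearEquiv.coe_coe]
    induction (comul r : H ⊗[ℂ] H) using TensorProduct.induction_on with
    | zero => simp
    | add x y hx hy => simp only [map_add, hx, hy]
    | tmul x y =>
      rw [TensorProduct.comm_tmul, TensorProduct.map_tmul, LinearMap.mul'_apply, copConv_apply,
        LinearMap.lTensor_tmul]
      induction (comul y : H ⊗[ℂ] H) using TensorProduct.induction_on with
      | zero => simp
      | add u v hu hv => simp only [map_add, add_mul, TensorProduct.tmul_add, hu, hv]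
      | tmul u v =>
        simp [gL, gR, HopfAlgebra.antipode_mul_antidistrib, antipode_antipodeInv]
  have h5 : η r = 0 := (DiffCalculus.mem_ideal _ _).1
    ((Omega.mem_quot_ideal _ _ _).2 (DiffIdeal.subset_generate ⟨r, hr, rfl⟩))
  rw [← h3, LinearMap.comp_apply, h5, map_zero, map_zero] at h4
  have h6 : v ∘ₗ η = R.mkQ - LinearMap.toSpanSingleton ℂ _ (R.mkQ 1) ∘ₗ (counit : H →ₗ[ℂ] ℂ) := by
    ext1 x
    exact hv x
  -- Applying `v` to the second leg replaces η(r₂) by [r₂] - ε(r₂)[1]; the second part contributes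
  -- ε(r), which is zero on R.
  have h7 : R.mkQ.lTensor H (adMap r) = 0 := by
    have e := congrArg (v.lTensor H) h4
    rw [map_zero, ← LinearMap.comp_apply, ← LinearMap.lTensor_comp, h6, LinearMap.lTensor_sub,
      LinearMap.sub_apply, LinearMap.lTensor_comp, LinearMap.comp_apply, lTensor_counit_adMap,
      hRε r hr, zero_smul, map_zero, sub_zero] at e
    exact e.symm
  exact (lTensor_exact H (LinearMap.exact_subtype_mkQ R) R.mkQ_surjective _).1 h7

lemma LocTrivQPFB.transitionInvariant_of_bicovariant {I B : Type*} [Finite I] [Ring B] [Algebra ℂ B]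
    (Q : LocTrivQPFB I B H) (hR : ∀ r ∈ R, ∀ x : H, r * x ∈ R)
    (hRε : ∀ r ∈ R, (counit r : ℂ) = 0) (hb : (calcH hS R).Bicovariant) :
    Q.TransitionInvariant R := by
  intro i j r hr
  obtain ⟨z, hz⟩ := adMap_mem_of_leftCovariant hS hR hRε hb.1 hr
  refine ⟨(τ (Q.ov i j)).toLinearMap.rTensor R z, ?_⟩
  rw [← hz, ← LinearMap.comp_apply, ← LinearMap.comp_apply, LinearMap.lTensor_comp_rTensor,
    LinearMap.rTensor_comp_lTensor]

end Bicovariant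

end

/-! ### The comparison for both orders of the charts -/

theorem proposition8 {I B H : Type*} [Finite I] [Ring B] [Algebra ℂ B] [Ring H] [HopfAlgebra ℂ H]
    (hS : Function.Bijective (HopfAlgebra.antipode ℂ : H →ₗ[ℂ] H))
    (Q : LocTrivQPFB I B H) (Γ : ∀ i, DiffCalculus (Q.Bl i))
    (R : Submodule ℂ H) (hR : ∀ r ∈ R, ∀ x : H, r * x ∈ R)
    (hRε : ∀ r ∈ R, (Coalgebra.counit r : ℂ) = 0) :
    (Q.TransitionInvariant R → ∀ i j : I,
      (Q.calcOv Γ (calcH hS R) i j (Q.ov i j)).ideal =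
        (Q.calcOv Γ (calcH hS R) j i (Q.ovSwap i j)).ideal ∧
      (Q.calcOv Γ (calcH hS R) i j (Q.ov i j)).Isomorphic
        (skew (Q.calcM Γ R i j (Q.ov i j)) (calcH hS R)) ∧
      (Q.calcOv Γ (calcH hS R) j i (Q.ovSwap i j)).Isomorphic
        (skew (Q.calcM Γ R i j (Q.ov i j)) (calcH hS R)) ∧
      Q.idealM Γ R i j (Q.ov i j) = Q.idealM Γ R j i (Q.ovSwap i j)) ∧
    ((calcH hS R).Bicovariant → Q.TransitionInvariant R) := by
  refine ⟨fun hQ i j => ?_, Q.transitionInvariant_of_bicovariant hS hR hRε⟩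
  have hM : Q.idealM Γ R i j (Q.ov i j) = Q.idealM Γ R j i (Q.ovSwap i j) :=
    DiffIdeal.toIdeal_injective (le_antisymm
      (fun _ hx => LocTrivQPFB.idealM_swap_le Γ hQ (Q.ovSwap i j) hx)
      (fun _ hx => LocTrivQPFB.idealM_swap_le Γ hQ (Q.ov i j) hx))
  -- By the symmetry of J_m, both induced calculi are compared with one and the same Γ_m(B_ij) ⊗̂
  -- Γ(H), so their ideals coincide.
  have hC : Q.calcM Γ R j i (Q.ovSwap i j) = Q.calcM Γ R i j (Q.ov i j) := by
    unfold LocTrivQPFB.calcM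
    congr 1
    exact hM.symm
  have h1 := LocTrivQPFB.calcOv_ideal_eq Γ hS hQ (Q.ov i j)
  have h2 := LocTrivQPFB.calcOv_ideal_eq Γ hS hQ (Q.ovSwap i j)
  rw [hC] at h2
  exact ⟨h1.trans h2.symm, DiffCalculus.isomorphic_of_ideal_eq h1,
    DiffCalculus.isomorphic_of_ideal_eq h2, hM⟩
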